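/- All graphs are finite and simple. A graph $G$ contains a graph $F$ if $F$ is isomorphic to a (not necessarily induced) subgraph of $G$. All families $\mathcal{F}$ of graphs are non-empty and every $F \in \mathcal{F}$ has at least one edge; families are regarded up to isomorphism of their members. A graph $G$ is $\mathcal{F}$-saturated if $G$ contains no graph in $\mathcal{F}$, but every graph obtained from $G$ by adding a new edge between two of its vertices contains a graph in $\mathcal{F}$. For integers $n \geq 0$, let $\mathrm{sat}(n,\mathcal{F})$ be the minimum number of edges in an $\mathcal{F}$-saturated graph on $n$ vertices. A family $\mathcal{F}$ is quasi-finite if for every tree $T$ there is a constant $C_T$ such that every graph in $\mathcal{F}$ has at most $C_T$ connected components isomorphic to $T$. Below, $q$ and $r$ always denote integers $\geq 1$. 1. Let $\mathcal{F}$ be a quasi-finite family of graphs. Then for each integer $r \geq 1$ there is a set $S_r$ of residue classes modulo $r$, and for each residue class $C \in S_r$ there is an integer $k_C$, such that the following hold. (a) For every integer $r \geq 1$ and residue class $C \in S_r$, $$\mathrm{sat}(n,\mathcal{F}) = \frac{(r-1)n+k_C}{r}$$ for all large enough $n \in C \setminus \bigcup_{q<r,\, D \in S_q} D$. (b) For $n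 \in \mathbb{Z}_{\geq 0} \setminus \bigcup_{r \geq 1,\, C \in S_r} C$, $\mathrm{sat}(n,\mathcal{F}) \geq n + o(n)$; that is, there is a function $g$ with $g(n)=o(n)$ as $n \to \infty$ such that $\mathrm{sat}(n,\mathcal{F}) \geq n+g(n)$ for all these $n$. (c) For $r \in \{1,2,3,4,5,7\}$, $S_r$ contains either none or all of the residue classes modulo $r$. 2. For each integer $r \geq 1$, let $S_r$ be a set of residue classes modulo $r$. Suppose that for $r \in \{1,2,3,4,5,7\}$, $S_r$ contains either none or all of the residue classes modulo $r$. Then there exists a quasi-finite family $\mathcal{F}$ of graphs such that the following hold. (a) For every integer $r \geq 1$, $$\mathrm{sat}(n,\mathcal{F}) = \left(1-\frac{1}{r}\right)n + O(1)$$ for $n \in \mathbb{Z}_{\geq 0} \cap \left(\bigcup_{C \in S_r} C\right) \setminus \bigcup_{q<r,\, C \in S_q} C$, where the implied constant may depend on $r$ (and on $\mathcal{F}$) but not on $n$. (b) For $n \in \mathbb{Z}_{\geq 0} \setminus \bigcup_{r \geq 1,\, C \in S_r} C$, $\mathrm{sat}(n,\mathcal{F}) \geq n + o(n)$, in the same sense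 as in 1(b). (c) If there are only finitely many integers $r \geq 1$ with $\left(\bigcup_{C \in S_r} C\right) \setminus \bigcup_{q<r,\, C \in S_q} C \neq \emptyset$, then $\mathcal{F}$ is in fact finite. -/

import Mathlib

open SimpleGraph Asymptotics Filter

/-- Finite simple graphs. Every finite graph is isomorphic to one of these, and only finitely many
of them are isomorphic to a given graph, so a set of them is finite if and only if it is finite up
to isomorphism. -/
abbrev FinGraph : Type := Σ n : ℕ, SimpleGraph (Fin n)

/-- `G` contains (as a not necessarily induced subgraph) a member of the family `𝓕`. -/
def ContainsMember (𝓕 : Set FinGraph) {V : Type*} (G : SimpleGraph V) : Prop :=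
  ∃ F ∈ 𝓕, F.2.IsContained G

/-- `G` is `𝓕`-saturated: it contains no member of `𝓕`, but every graph obtained from it by adding
a new edge does. -/
def IsSaturated (𝓕 : Set FinGraph) {V : Type*} (G : SimpleGraph V) : Prop :=
  ¬ ContainsMember 𝓕 G ∧
    ∀ u v : V, u ≠ v → ¬ G.Adj u v → ContainsMember 𝓕 (G ⊔ SimpleGraph.edge u v)

/-- The families for which the saturation number is defined: non-empty families of graphs that all
have at least one edge. -/
def IsAdmissible (𝓕 : Set FinGraph) : Prop :=
  𝓕.Nonempty ∧ ∀ F ∈ 𝓕, F.2.edgeSet.Nonempty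

/-- The numbers of edges of the `𝓕`-saturated graphs on `n` vertices. -/
def satSizes (n : ℕ) (𝓕 : Set FinGraph) : Set ℕ :=
  {m | ∃ G : SimpleGraph (Fin n), IsSaturated 𝓕 G ∧ G.edgeSet.ncard = m}

/-- The saturation number: the minimum number of edges of an `𝓕`-saturated graph on `n` vertices. -/
noncomputable def sat (n : ℕ) (𝓕 : Set FinGraph) : ℕ :=
  sInf (satSizes n 𝓕)

/-- The minimum in the definition of `sat` is over a non-empty set. -/
theorem satSizes_nonempty (n : ℕ) {𝓕 : Set FinGraph} (h : IsAdmissible 𝓕) :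
    (satSizes n 𝓕).Nonempty := by
  have hne : {G : SimpleGraph (Fin n) | ¬ ContainsMember 𝓕 G}.Nonempty := by
    refine ⟨⊥, ?_⟩
    rintro ⟨F, hF, ⟨c⟩⟩
    obtain ⟨e, he⟩ := h.2 F hF
    induction e using Sym2.ind with
    | _ u v => exact c.toHom.map_adj he
  obtain ⟨G, hG⟩ := (Set.toFinite {G : SimpleGraph (Fin n) | ¬ ContainsMember 𝓕 G}).exists_maximal
    hne
  refine ⟨_, G, ⟨hG.1, fun u v huv hadj => ?_⟩, rfl⟩
  by_contra hc
  have hle : G ⊔ SimpleGraph.edge u v ≤ G := hG.2 hc le_sup_left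
  exact hadj (hle (Or.inr (by simp [SimpleGraph.edge_adj, huv])))

/-- A family is quasi-finite if for every tree `T` there is a constant such that every member of
the family has at most that many connected components isomorphic to `T`. -/
def IsQuasiFinite (𝓕 : Set FinGraph) : Prop :=
  ∀ (m : ℕ) (T : SimpleGraph (Fin m)), T.IsTree → ∃ B : ℕ, ∀ F ∈ 𝓕,
    {K : F.2.ConnectedComponent | Nonempty (K.toSimpleGraph ≃g T)}.ncard ≤ B

/-- For sets `S r` of residue classes modulo `r`, the natural numbers that lie in no class of `S q`
for any `1 ≤ q < r`. -/
def avoidsBelow (S : (r : ℕ) → Set (ZMod r)) (r : ℕ) : Set ℕ :=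
  {n | ∀ q : ℕ, 1 ≤ q → q < r → (n : ZMod q) ∉ S q}

/-- The natural numbers that lie in a class of `S r` but in no class of `S q` for `1 ≤ q < r`. -/
def firstCovered (S : (r : ℕ) → Set (ZMod r)) (r : ℕ) : Set ℕ :=
  {n | (n : ZMod r) ∈ S r} ∩ avoidsBelow S r

/-- The natural numbers that lie in no class of `S r` for any `r ≥ 1`. -/
def uncovered (S : (r : ℕ) → Set (ZMod r)) : Set ℕ :=
  {n | ∀ r : ℕ, 1 ≤ r → (n : ZMod r) ∉ S r}

/-- For `r ∈ {1, 2, 3, 4, 5, 7}`, the set `S r` contains none or all of the classes modulo `r`. -/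
def NoneOrAllSmall (S : (r : ℕ) → Set (ZMod r)) : Prop :=
  ∀ r ∈ ({1, 2, 3, 4, 5, 7} : Set ℕ), S r = ∅ ∨ S r = Set.univ

/-- `sat(n, 𝓕) ≥ n + o(n)` for `n` in the set `A`. -/
def SatAtLeastLinear (𝓕 : Set FinGraph) (A : Set ℕ) : Prop :=
  ∃ g : ℕ → ℝ, g =o[atTop] (fun n : ℕ => (n : ℝ)) ∧ ∀ n ∈ A, (n : ℝ) + g n ≤ (sat n 𝓕 : ℝ)

/-! Part 1. Suppose that a copy of a member of a quasi-finite family meets a component isomorphic to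
a fixed tree on r vertices. Then it places there a tree component of its own, with at most r
vertices, and quasi-finiteness bounds the number of these. So beyond a constant `K r`, further
copies of the tree do not matter for containing a member (`exists_absorbing`); with two more copies
reserved for the ends of a new edge, they do not matter for saturation either
(`isSaturated_sum_copies_congr`). Let S_r consist of the residues of the orders of saturated graphs
with at least `K r + 2` components isomorphic to a common tree on r vertices. Adding copies of that
tree gives sat(n) ≤ (1 - 1/r)n + O(1) on such a class. Conversely, a graph with t tree components
has at least n - t edges, and if n lies in no earlier class then only O(1) of these trees have fewer
than r vertices, so t ≤ n/r + O(1). For large n, an optimal graph must therefore contain many copies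
of one tree on r vertices, so r further vertices cost at most r - 1 edges. Hence the integer r
sat(n) - (r - 1)n does not increase along the relevant orders; being bounded below, it becomes
constant (`exists_eventually_eq`).

For r in {2, 3, 4, 5, 7}, S_r is closed under subtracting 1 (`sub_one_mem_satClasses`). To a
saturated graph with many components T, add T - ℓ for a suitable vertex ℓ and saturate again. If a
vertex of T - ℓ became adjacent to the same vertex of many copies of T, then one could find there
two copies of T joined by an edge, and this creates a member. So most copies stay components, while
the order drops by 1 modulo r. That every tree of these orders has such an ℓ is a finite
computation; for r = 1 there is only one class.

Part 2. The family forbids triangles, quadrilaterals, and certain configurations around cycles of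
special lengths h, where each h encodes an order r = ρ(h). The intended saturated graphs are a cycle
of length h together with disjoint trees on r vertices: stars if r is in {1, 2, 3, 4, 5, 7}, other
spiders otherwise (`isSaturated_cycle_sum`). For the lower bound (`treeComponents_of_isSaturated`),
a saturated graph without a special cycle is connected, since an edge between components creates no
cycle. If there is a special cycle, it is a component. For a small order, at most one tree component
has fewer than r vertices, because two of them could be joined. For any other order, either all
components but the cycle are spiders, which forces n ≡ h modulo r, or some vertex outside the
spiders can be joined to an end of any tree component elsewhere without creating a forbidden
configuration, so that at most one tree component exists. All members of the family have at most two
components, whence quasi-finiteness. -/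

/-! ### Disjoint copies of a graph, and counting edges by components. -/

/-- The disjoint union of copies of `T`, one for each element of `I`. -/
def copies (I : Type*) {W : Type*} (T : SimpleGraph W) : SimpleGraph (I × W) where
  Adj p q := p.1 = q.1 ∧ T.Adj p.2 q.2
  symm.symm _ _ h := ⟨h.1.symm, h.2.symm⟩
  loopless := ⟨fun _ h => T.irrefl h.2⟩

@[simp] theorem copies_adj {I W : Type*} {T : SimpleGraph W} {p q : I × W} :
    (copies I T).Adj p q ↔ p.1 = q.1 ∧ T.Adj p.2 q.2 := Iff.rfl

/-- Reindexing the copies. -/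
def copiesCongr {I J W : Type*} (e : I ≃ J) (T : SimpleGraph W) : copies I T ≃g copies J T where
  toEquiv := e.prodCongr (Equiv.refl W)
  map_rel_iff' := by simp

/-- Embedding of fewer copies into more copies. -/
def copiesEmb {I J W : Type*} (e : I ↪ J) (T : SimpleGraph W) : copies I T ↪g copies J T where
  toFun p := (e p.1, p.2)
  inj' p q h := by
    rcases p with ⟨i, a⟩; rcases q with ⟨j, b⟩
    simp only [Prod.mk.injEq] at h ⊢
    exact ⟨e.injective h.1, h.2⟩
  map_rel_iff' := by
    intro p q
    change (e p.1 = e q.1 ∧ T.Adj p.2 q.2) ↔ (p.1 = q.1 ∧ T.Adj p.2 q.2)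
    rw [e.injective.eq_iff]

/-- Splitting the index set of the copies. -/
def copiesSum (I J : Type*) {W : Type*} (T : SimpleGraph W) :
    copies (I ⊕ J) T ≃g copies I T ⊕g copies J T where
  toEquiv := Equiv.sumProdDistrib I J W
  map_rel_iff' := by
    rintro ⟨i | i, a⟩ ⟨j | j, b⟩ <;> simp [Equiv.sumProdDistrib]

theorem ContainsMember.mono {𝓕 : Set FinGraph} {V W : Type*} {G : SimpleGraph V}
    {H : SimpleGraph W} (h : ContainsMember 𝓕 G) (hGH : G ⊑ H) : ContainsMember 𝓕 H := by
  obtain ⟨F, hF, hc⟩ := h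
  exact ⟨F, hF, IsContained.trans hc hGH⟩

/-- An isomorphism extends to the graphs with one more edge. -/
def isoSupEdge {V W : Type*} {G : SimpleGraph V} {H : SimpleGraph W} (e : G ≃g H) (u v : V) :
    G ⊔ edge u v ≃g H ⊔ edge (e u) (e v) where
  toEquiv := e.toEquiv
  map_rel_iff' := by
    intro a b
    simp only [sup_adj, edge_adj]
    change H.Adj (e a) (e b) ∨ (e a = e u ∧ e b = e v ∨ e a = e v ∧ e b = e u) ∧ e a ≠ e b ↔ _
    simp [e.map_adj_iff]

theorem IsSaturated.iso {𝓕 : Set FinGraph} {V W : Type*} {G : SimpleGraph V}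
    {H : SimpleGraph W} (h : IsSaturated 𝓕 G) (e : G ≃g H) : IsSaturated 𝓕 H := by
  refine ⟨fun hc => h.1 (hc.mono e.isContained'), fun u v huv hadj => ?_⟩
  have := h.2 (e.symm u) (e.symm v) (by simpa using huv) (by rwa [e.symm.map_adj_iff])
  refine this.mono ?_
  have e' := isoSupEdge e (e.symm u) (e.symm v)
  simp only [RelIso.apply_symm_apply] at e'
  exact e'.isContained

theorem ncard_edgeSet_iso {V W : Type*} {G : SimpleGraph V} {H : SimpleGraph W} (e : G ≃g H) :
    G.edgeSet.ncard = H.edgeSet.ncard := by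
  rw [← Nat.card_coe_set_eq, ← Nat.card_coe_set_eq]
  exact Nat.card_congr e.mapEdgeSet

theorem sat_le {𝓕 : Set FinGraph} {V : Type*} [Fintype V] {n : ℕ} {G : SimpleGraph V}
    (h : IsSaturated 𝓕 G) (hn : Fintype.card V = n) : sat n 𝓕 ≤ G.edgeSet.ncard := by
  have e := G.overFinIso hn
  exact Nat.sInf_le ⟨_, h.iso e, (ncard_edgeSet_iso e).symm⟩

theorem exists_sat {𝓕 : Set FinGraph} (h : IsAdmissible 𝓕) (n : ℕ) :
    ∃ G : SimpleGraph (Fin n), IsSaturated 𝓕 G ∧ G.edgeSet.ncard = sat n 𝓕 :=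
  Nat.sInf_mem (satSizes_nonempty n h)

theorem ncard_edgeSet_sum {V W : Type*} [Finite V] [Finite W] (G : SimpleGraph V)
    (H : SimpleGraph W) :
    (G ⊕g H).edgeSet.ncard = G.edgeSet.ncard + H.edgeSet.ncard := by
  simp only [← Nat.card_coe_set_eq]
  rw [Nat.card_congr edgeSetSumEquiv, Nat.card_sum]

/-- There are twice as many ordered adjacent pairs as edges. -/
theorem two_mul_ncard_edgeSet {V : Type*} [Finite V] (G : SimpleGraph V) :
    2 * G.edgeSet.ncard = Nat.card {p : V × V // G.Adj p.1 p.2} := by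
  classical
  have := Fintype.ofFinite V
  rw [Nat.card_eq_fintype_card, Fintype.card_subtype, Set.ncard_eq_toFinset_card']
  exact two_mul_card_edgeFinset (G := G)

theorem ncard_edgeSet_copies {I W : Type*} [Finite I] [Finite W] (T : SimpleGraph W) :
    (copies I T).edgeSet.ncard = Nat.card I * T.edgeSet.ncard := by
  have h1 := two_mul_ncard_edgeSet (copies I T)
  have h2 := two_mul_ncard_edgeSet T
  have e : {p : (I × W) × (I × W) // (copies I T).Adj p.1 p.2} ≃
      I × {p : W × W // T.Adj p.1 p.2} :=
    { toFun := fun p => (p.1.1.1, ⟨(p.1.1.2, p.1.2.2), p.2.2⟩)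
      invFun := fun q => ⟨((q.1, q.2.1.1), (q.1, q.2.1.2)), rfl, q.2.2⟩
      left_inv := by
        rintro ⟨⟨⟨i, a⟩, ⟨j, b⟩⟩, h⟩
        obtain ⟨h, -⟩ := h
        dsimp only at h
        subst h
        rfl
      right_inv := by rintro ⟨i, ⟨⟨a, b⟩, h⟩⟩; rfl }
  rw [Nat.card_congr e, Nat.card_prod, ← h2] at h1
  have : 2 * (copies I T).edgeSet.ncard = 2 * (Nat.card I * T.edgeSet.ncard) := by
    rw [h1]; ring
  omega

/-- A component on v vertices has at least v - 1 edges, and at least v unless it is a tree; sum over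
the components. -/
theorem card_le_edges_add_treeComponents {V : Type*} [Finite V] (G : SimpleGraph V) :
    Nat.card V ≤ G.edgeSet.ncard +
      {K : G.ConnectedComponent | K.toSimpleGraph.IsTree}.ncard := by
  classical
  have := Fintype.ofFinite V
  have := Fintype.ofFinite G.ConnectedComponent
  have hV : Nat.card V = ∑ K : G.ConnectedComponent, Nat.card K := by
    rw [← Nat.card_sigma]
    refine Nat.card_congr ⟨fun v => ⟨G.connectedComponentMk v, v, rfl⟩, fun x => x.2.1,
      fun v => rfl, ?_⟩
    rintro ⟨K, v, rfl⟩
    rfl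
  have hE : 2 * G.edgeSet.ncard = ∑ K : G.ConnectedComponent, 2 * K.toSimpleGraph.edgeSet.ncard := by
    rw [two_mul_ncard_edgeSet]
    simp only [two_mul_ncard_edgeSet]
    rw [← Nat.card_sigma]
    refine Nat.card_congr ⟨fun p => ⟨G.connectedComponentMk p.1.1, ⟨(⟨p.1.1, rfl⟩, ⟨p.1.2, ?_⟩), ?_⟩⟩,
      fun x => ⟨(x.2.1.1.1, x.2.1.2.1), x.2.2⟩, fun v => rfl, ?_⟩
    · exact (ConnectedComponent.connectedComponentMk_eq_of_adj p.2).symm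
    · exact p.2
    · rintro ⟨K, ⟨⟨v, rfl⟩, ⟨w, hw⟩⟩, h⟩
      rfl
  rw [← Finset.mul_sum] at hE
  have hE' : G.edgeSet.ncard = ∑ K : G.ConnectedComponent, K.toSimpleGraph.edgeSet.ncard := by omega
  have hT : {K : G.ConnectedComponent | K.toSimpleGraph.IsTree}.ncard =
      ∑ K : G.ConnectedComponent, if K.toSimpleGraph.IsTree then 1 else 0 := by
    rw [Set.ncard_eq_toFinset_card', Finset.card_eq_sum_ones, Finset.sum_boole,
      Finset.card_eq_sum_ones]
    simp
  rw [hV, hE', hT, ← Finset.sum_add_distrib]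
  refine Finset.sum_le_sum fun K _ => ?_
  have hc := K.connected_toSimpleGraph
  have h1 := hc.card_vert_le_card_edgeSet_add_one
  split_ifs with ht
  · rw [← Nat.card_coe_set_eq]; exact h1
  · rw [isTree_iff_connected_and_card] at ht
    have : Nat.card K.toSimpleGraph.edgeSet + 1 ≠ Nat.card K := fun h => ht ⟨hc, h⟩
    rw [← Nat.card_coe_set_eq]
    change Nat.card K ≤ _ at h1
    omega

/-- The components of `G` that are trees on `q` vertices are counted by their isomorphism types. -/
theorem ncard_treeComponents_le {V : Type*} [Finite V] (G : SimpleGraph V) (q : ℕ)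
    [Fintype (SimpleGraph (Fin q))] (b : SimpleGraph (Fin q) → ℕ)
    (hb : ∀ T : SimpleGraph (Fin q), T.IsTree →
      {K : G.ConnectedComponent | Nonempty (K.toSimpleGraph ≃g T)}.ncard ≤ b T) :
    {K : G.ConnectedComponent | K.toSimpleGraph.IsTree ∧ Nat.card K = q}.ncard ≤ ∑ T, b T := by
  classical
  have hsub : {K : G.ConnectedComponent | K.toSimpleGraph.IsTree ∧ Nat.card K = q} ⊆
      ⋃ T ∈ (Finset.univ.filter fun T : SimpleGraph (Fin q) => T.IsTree),
        {K : G.ConnectedComponent | Nonempty (K.toSimpleGraph ≃g T)} := by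
    rintro K ⟨hK, hq⟩
    have := Fintype.ofFinite K
    have e := K.toSimpleGraph.overFinIso (n := q) (by rw [← hq, Nat.card_eq_fintype_card])
    simp only [Set.mem_iUnion]
    exact ⟨_, by simpa using (e.isTree_iff).1 hK, ⟨e⟩⟩
  refine (Set.ncard_le_ncard hsub (Set.toFinite _)).trans
    ((Finset.set_ncard_biUnion_le _ _).trans ?_)
  refine (Finset.sum_le_sum fun T hT => hb T (by simpa using hT)).trans ?_
  exact Finset.sum_le_univ_sum_of_nonneg fun _ => Nat.zero_le _

/-! ### Absorption: many copies of a tree are as good as more. -/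

/-- A copy that meets only the copies of `T` indexed by `s` lives in the smaller graph. -/
def restrictIndex {A I W : Type*} (H : SimpleGraph A) (T : SimpleGraph W) (s : Set I) :
    (H ⊕g copies I T).induce {x | ∀ i b, x = .inr (i, b) → i ∈ s} ↪g H ⊕g copies s T where
  toFun
    | ⟨.inl a, _⟩ => .inl a
    | ⟨.inr (i, b), h⟩ => .inr (⟨i, h i b rfl⟩, b)
  inj' := by
    rintro ⟨a | ⟨i, a⟩, h⟩ ⟨b | ⟨j, b⟩, h'⟩ hab <;> simp_all
  map_rel_iff' := by
    rintro ⟨a | ⟨i, a⟩, h⟩ ⟨b | ⟨j, b⟩, h'⟩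
    · simp [SimpleGraph.sum]
    · simp [SimpleGraph.sum]
    · simp [SimpleGraph.sum]
    · change ((⟨i, _⟩ : s) = ⟨j, _⟩ ∧ T.Adj a b) ↔ (i = j ∧ T.Adj a b)
      simp

/-- No edge leaves a copy of `T`, so a connected piece that meets the copy stays inside it. -/
theorem reachable_copies_index {A I W X : Type*} {H : SimpleGraph A} {T : SimpleGraph W}
    {F : SimpleGraph X} (f : F →g H ⊕g copies I T) {u w : X} (huw : F.Reachable u w) {i : I}
    (hu : ∃ b, f u = .inr (i, b)) : ∃ b, f w = .inr (i, b) := by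
  obtain ⟨p⟩ := huw
  induction p with
  | nil => exact hu
  | cons h p ih =>
    apply ih
    obtain ⟨b, hb⟩ := hu
    have := f.map_adj h
    rw [hb] at this
    rcases hv : f _ with a | ⟨j, c⟩
    · rw [hv] at this; simp at this
    · rw [hv] at this
      obtain ⟨rfl, -⟩ := (sum_adj_inr.1 this)
      exact ⟨c, rfl⟩

/-- For a quasi-finite family, all but a bounded number of copies of a fixed tree are irrelevant for
containing a member of the family. -/
theorem exists_absorbing {𝓕 : Set FinGraph} (hq : IsQuasiFinite 𝓕) :
    ∃ K : ℕ → ℕ, ∀ (r : ℕ) (T : SimpleGraph (Fin r)), T.IsAcyclic →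
      ∀ {A I J : Type} [Finite J] (H : SimpleGraph A), K r ≤ Nat.card J →
        ContainsMember 𝓕 (H ⊕g copies I T) → ContainsMember 𝓕 (H ⊕g copies J T) := by
  classical
  choose B hB using hq
  have hfin : ∀ m, Fintype (SimpleGraph (Fin m)) := fun m => Fintype.ofFinite _
  -- The constant bounds the number of components of a member that are trees on at most r vertices.
  refine ⟨fun r => ∑ m ∈ Finset.range (r + 1), ∑ T : SimpleGraph (Fin m),
    if h : T.IsTree then B m T h else 0, ?_⟩
  rintro r T hT A I J _ H hJ ⟨F, hF, ⟨f⟩⟩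
  set s : Set I := {i | ∃ u b, f u = .inr (i, b)} with hs
  have hsfin : s.Finite := by
    refine Set.Finite.subset (Set.Finite.preimage (Option.some_injective I).injOn
      (Set.finite_range fun u => (f u).elim (fun _ => none) fun x => some x.1)) ?_
    rintro i ⟨u, b, hu⟩
    exact ⟨u, by simp [hu]⟩
  have := hsfin.to_subtype
  -- a component of the member for every index that is used
  choose g hg using fun i : s => i.2
  let κ : s → F.2.ConnectedComponent := fun i => F.2.connectedComponentMk (g i)
  have hκ : ∀ i : s, ∀ w ∈ κ i, ∃ b, f w = .inr (i.1, b) := by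
    intro i w hw
    exact reachable_copies_index f.toHom (ConnectedComponent.exact hw).symm (hg i)
  have hκinj : Function.Injective κ := by
    intro i j hij
    obtain ⟨b, hb⟩ := hκ j (g i) (by rw [← hij]; exact rfl)
    obtain ⟨c, hc⟩ := hg i
    rw [hc] at hb
    simp only [Sum.inr.injEq, Prod.mk.injEq] at hb
    exact Subtype.ext hb.1
  -- The component chosen for an index embeds in `T`, hence is a tree on at most r vertices.
  have hκT : ∀ i : s, (κ i).toSimpleGraph.IsTree ∧ Nat.card (κ i) ≤ r := by
    intro i
    choose c hc using fun w : κ i => hκ i w.1 w.2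
    have hinj : Function.Injective c := by
      intro a b hab
      apply Subtype.ext
      apply f.injective
      have h1 := hc a
      have h2 := hc b
      rw [hab] at h1
      exact h1.trans h2.symm
    let φ : (κ i).toSimpleGraph →g T := ⟨c, by
      intro a b hab
      have h := f.toHom.map_adj (show F.2.Adj a.1 b.1 from hab)
      change (H ⊕g copies I T).Adj (f a.1) (f b.1) at h
      rw [hc a, hc b] at h
      exact (sum_adj_inr.1 h).2⟩
    refine ⟨⟨(κ i).connected_toSimpleGraph, hT.comap φ hinj⟩, ?_⟩
    simpa using Nat.card_le_card_of_injective c hinj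
  have hcard : Nat.card s ≤ Nat.card J := by
    refine le_trans ?_ hJ
    calc Nat.card s = (Set.range κ).ncard := by
          rw [← Nat.card_coe_set_eq]
          exact Nat.card_congr (Equiv.ofInjective κ hκinj)
      _ ≤ (⋃ m ∈ Finset.range (r + 1), {K : F.2.ConnectedComponent |
            K.toSimpleGraph.IsTree ∧ Nat.card K = m}).ncard := by
          refine Set.ncard_le_ncard ?_ (Set.toFinite _)
          rintro _ ⟨i, rfl⟩
          simp only [Set.mem_iUnion]
          exact ⟨Nat.card (κ i), by simpa using Nat.lt_succ_of_le (hκT i).2, (hκT i).1, rfl⟩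
      _ ≤ _ := (Finset.set_ncard_biUnion_le _ _)
      _ ≤ _ := by
          refine Finset.sum_le_sum fun m _ => ncard_treeComponents_le F.2 m _ ?_
          intro T' hT'
          rw [dif_pos hT']
          exact hB m T' hT' F hF
  have := Fintype.ofFinite s
  have := Fintype.ofFinite J
  obtain ⟨e⟩ : Nonempty (s ↪ J) := Function.Embedding.nonempty_of_card_le
    (by rwa [Nat.card_eq_fintype_card, Nat.card_eq_fintype_card] at hcard)
  refine ⟨F, hF, ?_⟩
  have h1 : F.2 ⊑ (H ⊕g copies I T).induce {x | ∀ i b, x = .inr (i, b) → i ∈ s} :=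
    ⟨⟨⟨fun u => ⟨f u, fun i b h => ⟨u, b, h⟩⟩, fun {a b} h => f.toHom.map_adj h⟩, fun a b h =>
      f.injective (congrArg Subtype.val h)⟩⟩
  exact h1.trans ((restrictIndex H T s).isContained.trans
    (Embedding.sum Embedding.refl (copiesEmb e T)).isContained)

/-! ### Saturation is independent of the number of copies. -/

theorem sum_sup_edge_inl {V W : Type*} (G : SimpleGraph V) (H : SimpleGraph W) (u v : V) :
    (G ⊕g H) ⊔ edge (.inl u) (.inl v) = (G ⊔ edge u v) ⊕g H := by
  ext (a | a) (b | b) <;> simp [edge_adj]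

/-- Any two vertices can be separated from all but two copies of `T`. -/
theorem exists_iso_sum_copies_two {A J W : Type*} [Fintype J] (H : SimpleGraph A)
    (T : SimpleGraph W) {m : ℕ} (hJ : Fintype.card J = m + 2) (x y : A ⊕ (J × W)) :
    ∃ (e : (H ⊕g copies J T) ≃g (H ⊕g copies (Fin 2) T) ⊕g copies (Fin m) T) (x' y' : _),
      e x = .inl x' ∧ e y = .inl y' := by
  classical
  -- The copy containing a vertex, if any; two vertices thus meet at most two copies.
  let idx : A ⊕ (J × W) → Finset J := fun z => z.elim (fun _ => ∅) (fun p => {p.1})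
  have hidx : ∀ z, (idx z).card ≤ 1 := by rintro (a | ⟨j, b⟩) <;> simp [idx]
  obtain ⟨s, hs, hs2⟩ := Finset.exists_superset_card_eq (s := idx x ∪ idx y) (n := 2)
    ((Finset.card_union_le _ _).trans (by have := hidx x; have := hidx y; omega)) (by omega)
  have e1 : {j // j ∈ s} ≃ Fin 2 := Fintype.equivFinOfCardEq (by simpa using hs2)
  have e2 : {j // j ∉ s} ≃ Fin m := Fintype.equivFinOfCardEq (by
    rw [Fintype.card_subtype_compl]
    simp only [Fintype.card_coe]
    omega)
  let σ : J ≃ Fin 2 ⊕ Fin m := (Equiv.sumCompl (· ∈ s)).symm.trans (e1.sumCongr e2)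
  have hσ : ∀ j ∈ s, ∃ k, σ j = .inl k := by
    intro j hj
    exact ⟨e1 ⟨j, hj⟩, by simp [σ, Equiv.sumCompl_symm_apply_of_pos hj]⟩
  let e : (H ⊕g copies J T) ≃g (H ⊕g copies (Fin 2) T) ⊕g copies (Fin m) T :=
    (Iso.sumCongr Iso.refl ((copiesCongr σ T).trans (copiesSum _ _ T))).trans Iso.sumAssoc.symm
  have key : ∀ z, idx z ⊆ s → ∃ z', e z = .inl z' := by
    rintro (a | ⟨j, b⟩) hz
    · exact ⟨.inl a, rfl⟩
    · obtain ⟨k, hk⟩ := hσ j (hz (by simp [idx]))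
      refine ⟨.inr (k, b), ?_⟩
      change Sum.elim _ _ _ = _
      simp [copiesCongr, copiesSum, hk, Equiv.sumProdDistrib]
  obtain ⟨x', hx⟩ := key x (Finset.subset_union_left.trans hs)
  obtain ⟨y', hy⟩ := key y (Finset.subset_union_right.trans hs)
  exact ⟨e, x', y', hx, hy⟩

/-- By symmetry of the copies, a new edge may be assumed to have its ends in `H` and two reserved
copies. Both conditions on the right are then about containment in a fixed graph plus `m` copies,
which is where absorption applies. -/
theorem isSaturated_sum_copies_iff {𝓕 : Set FinGraph} {A J W : Type*} [Fintype J]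
    (H : SimpleGraph A) (T : SimpleGraph W) {m : ℕ} (hJ : Fintype.card J = m + 2) :
    IsSaturated 𝓕 (H ⊕g copies J T) ↔
      ¬ ContainsMember 𝓕 ((H ⊕g copies (Fin 2) T) ⊕g copies (Fin m) T) ∧
      ∀ x y, x ≠ y → ¬ (H ⊕g copies (Fin 2) T).Adj x y →
        ContainsMember 𝓕 (((H ⊕g copies (Fin 2) T) ⊔ edge x y) ⊕g copies (Fin m) T) := by
  have σ : J ≃ Fin 2 ⊕ Fin m := Fintype.equivOfCardEq (by simp; omega)
  let e : (H ⊕g copies J T) ≃g (H ⊕g copies (Fin 2) T) ⊕g copies (Fin m) T :=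
    (Iso.sumCongr Iso.refl ((copiesCongr σ T).trans (copiesSum _ _ T))).trans Iso.sumAssoc.symm
  constructor
  · intro h
    have h' := h.iso e
    refine ⟨h'.1, fun x y hxy hadj => ?_⟩
    rw [← sum_sup_edge_inl]
    exact h'.2 _ _ (by simpa using hxy) (by simpa using hadj)
  · rintro ⟨h1, h2⟩
    refine ⟨fun hc => h1 (hc.mono e.isContained), fun x y hxy hadj => ?_⟩
    obtain ⟨e, x', y', hx, hy⟩ := exists_iso_sum_copies_two H T hJ x y
    have h3 := h2 x' y' (by rintro rfl; exact hxy (e.injective (hx.trans hy.symm)))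
      (fun h => hadj (by rw [← e.map_adj_iff, hx, hy]; simpa using h))
    rw [← sum_sup_edge_inl, ← hx, ← hy] at h3
    exact h3.mono (isoSupEdge e x y).isContained'

/-- Saturation does not depend on the number of copies of a tree, once there are enough of them. -/
theorem isSaturated_sum_copies_congr {𝓕 : Set FinGraph} {r : ℕ} {T : SimpleGraph (Fin r)} {K : ℕ}
    (hK : ∀ {A I J : Type} [Finite J] (H : SimpleGraph A), K ≤ Nat.card J →
        ContainsMember 𝓕 (H ⊕g copies I T) → ContainsMember 𝓕 (H ⊕g copies J T))
    {A I J : Type} [Fintype I] [Fintype J] {H : SimpleGraph A}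
    (hI : K + 2 ≤ Fintype.card I) (hJ : K + 2 ≤ Fintype.card J)
    (h : IsSaturated 𝓕 (H ⊕g copies I T)) : IsSaturated 𝓕 (H ⊕g copies J T) := by
  rw [isSaturated_sum_copies_iff (m := Fintype.card I - 2) H T (by omega)] at h
  rw [isSaturated_sum_copies_iff (m := Fintype.card J - 2) H T (by omega)]
  refine ⟨fun hc => h.1 (hK _ (by simp; omega) hc), fun x y hxy hadj => ?_⟩
  exact hK _ (by simp; omega) (h.2 x y hxy hadj)

/-- Splitting off components isomorphic to `T`. -/
theorem exists_iso_sum_copies {V W : Type*} [Finite V] (G : SimpleGraph V) (T : SimpleGraph W)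
    {m : ℕ} (hm : m ≤ {K : G.ConnectedComponent | Nonempty (K.toSimpleGraph ≃g T)}.ncard) :
    ∃ (a : ℕ) (H : SimpleGraph (Fin a)), Nonempty (H ⊕g copies (Fin m) T ≃g G) := by
  classical
  set S := {K : G.ConnectedComponent | Nonempty (K.toSimpleGraph ≃g T)} with hS
  have := Fintype.ofFinite S
  obtain ⟨κ⟩ : Nonempty (Fin m ↪ S) := Function.Embedding.nonempty_of_card_le (by
    rw [Fintype.card_fin, ← Nat.card_eq_fintype_card, Nat.card_coe_set_eq]; exact hm)
  have φ : ∀ i, (κ i).1.toSimpleGraph ≃g T := fun i => (κ i).2.some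
  let R : Set V := {v | ∀ i, G.connectedComponentMk v ≠ (κ i).1}
  have hmem : ∀ i b, G.connectedComponentMk ((φ i).symm b).1 = (κ i).1 :=
    fun i b => ((φ i).symm b).2
  let ψ : R ⊕ (Fin m × W) → V := Sum.elim (fun v => v.1) (fun p => ((φ p.1).symm p.2).1)
  have hψ : Function.Bijective ψ := by
    constructor
    · rintro (⟨a, ha⟩ | ⟨i, a⟩) (⟨b, hb⟩ | ⟨j, b⟩) hab
      · simpa [ψ] using hab
      · exact absurd (hmem j b) (by rw [← show a = ((φ j).symm b).1 from hab]; exact ha j)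
      · exact absurd (hmem i a) (by rw [show ((φ i).symm a).1 = b from hab]; exact hb i)
      · have hab : ((φ i).symm a).1 = ((φ j).symm b).1 := hab
        have hij : i = j := κ.injective (Subtype.ext (by rw [← hmem i a, ← hmem j b, hab]))
        subst hij
        have := (φ i).symm.injective (Subtype.ext hab)
        rw [this]
    · intro v
      by_cases hv : v ∈ R
      · exact ⟨.inl ⟨v, hv⟩, rfl⟩
      · simp only [R, Set.mem_ofPred_eq, not_forall, not_not] at hv
        obtain ⟨i, hi⟩ := hv
        exact ⟨.inr (i, φ i ⟨v, hi⟩), by simp [ψ]⟩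
  let e : (G.induce R) ⊕g copies (Fin m) T ≃g G := ⟨Equiv.ofBijective ψ hψ, by
    rintro (⟨a, ha⟩ | ⟨i, a⟩) (⟨b, hb⟩ | ⟨j, b⟩)
    · simp [ψ]
    · simp only [Equiv.ofBijective_apply, ψ, Sum.elim_inl, Sum.elim_inr, not_adj_sum_inl_inr,
        iff_false]
      intro h
      exact ha j ((ConnectedComponent.connectedComponentMk_eq_of_adj h).trans (hmem j b))
    · simp only [Equiv.ofBijective_apply, ψ, Sum.elim_inl, Sum.elim_inr]
      refine ⟨fun h => ?_, fun h => absurd h.symm (not_adj_sum_inl_inr _ _)⟩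
      exact (hb i ((ConnectedComponent.connectedComponentMk_eq_of_adj h.symm).trans
        (hmem i a))).elim
    · simp only [Equiv.ofBijective_apply, ψ, Sum.elim_inr, sum_adj_inr, copies_adj]
      constructor
      · intro h
        have hij : i = j := κ.injective (Subtype.ext (by
          rw [← hmem i a, ← hmem j b]
          exact ConnectedComponent.connectedComponentMk_eq_of_adj h))
        subst hij
        exact ⟨rfl, (φ i).symm.map_adj_iff.1 h⟩
      · rintro ⟨rfl, h⟩
        exact (φ i).symm.map_adj_iff.2 h⟩
  have := Fintype.ofFinite R
  exact ⟨Fintype.card R, _, ⟨(Iso.sumCongr ((G.induce R).overFinIso rfl).symm Iso.refl).trans e⟩⟩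

/-! ### The residue classes of a family and the linear formula on them. -/

/-- The residue classes modulo `r` that contain the order of a saturated graph with at least
`K r + 2` components isomorphic to a common tree on `r` vertices. -/
def satClasses (𝓕 : Set FinGraph) (K : ℕ → ℕ) (r : ℕ) : Set (ZMod r) :=
  {C | ∃ T : SimpleGraph (Fin r), T.IsTree ∧ ∃ (a : ℕ) (H : SimpleGraph (Fin a)),
    (a : ZMod r) = C ∧ IsSaturated 𝓕 (H ⊕g copies (Fin (K r + 2)) T)}

/-- `K r` copies of a tree on `r` vertices are as good as any larger number of them. -/
def IsAbsorbing (𝓕 : Set FinGraph) (K : ℕ → ℕ) : Prop :=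
  ∀ (r : ℕ) (T : SimpleGraph (Fin r)), T.IsAcyclic →
    ∀ {A I J : Type} [Finite J] (H : SimpleGraph A), K r ≤ Nat.card J →
      ContainsMember 𝓕 (H ⊕g copies I T) → ContainsMember 𝓕 (H ⊕g copies J T)

theorem SimpleGraph.IsTree.ncard_edgeSet {r : ℕ} {T : SimpleGraph (Fin r)} (hT : T.IsTree) :
    T.edgeSet.ncard + 1 = r := by
  have := (isTree_iff_connected_and_card.1 hT).2
  rwa [Nat.card_coe_set_eq, Nat.card_eq_fintype_card, Fintype.card_fin] at this

theorem sat_le_of_isSaturated_copies {𝓕 : Set FinGraph} {K : ℕ → ℕ} (hK : IsAbsorbing 𝓕 K)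
    {r : ℕ} {T : SimpleGraph (Fin r)} (hT : T.IsTree) {a : ℕ} {H : SimpleGraph (Fin a)}
    (h : IsSaturated 𝓕 (H ⊕g copies (Fin (K r + 2)) T)) {m : ℕ} (hm : K r + 2 ≤ m) :
    sat (a + m * r) 𝓕 ≤ H.edgeSet.ncard + m * (r - 1) := by
  have h' : IsSaturated 𝓕 (H ⊕g copies (Fin m) T) :=
    isSaturated_sum_copies_congr (K := K r) (hK r T hT.2) (by simp) (by simpa using hm) h
  refine (sat_le h' (by simp)).trans ?_
  rw [ncard_edgeSet_sum, ncard_edgeSet_copies, Nat.card_fin]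
  have := hT.ncard_edgeSet
  rw [show T.edgeSet.ncard = r - 1 by omega]

theorem exists_decomposition_of_many {𝓕 : Set FinGraph} {K : ℕ → ℕ} {r n : ℕ}
    {T : SimpleGraph (Fin r)} {G : SimpleGraph (Fin n)} (hG : IsSaturated 𝓕 G)
    (hm : K r + 2 ≤ {L : G.ConnectedComponent | Nonempty (L.toSimpleGraph ≃g T)}.ncard) :
    ∃ (a : ℕ) (H : SimpleGraph (Fin a)), n = a + (K r + 2) * r ∧
      IsSaturated 𝓕 (H ⊕g copies (Fin (K r + 2)) T) ∧
      G.edgeSet.ncard = H.edgeSet.ncard + (K r + 2) * T.edgeSet.ncard := by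
  obtain ⟨a, H, ⟨e⟩⟩ := exists_iso_sum_copies G T hm
  refine ⟨a, H, ?_, hG.iso e.symm, ?_⟩
  · have := Fintype.card_congr e.toEquiv
    simpa using this.symm
  · rw [← ncard_edgeSet_iso e, ncard_edgeSet_sum, ncard_edgeSet_copies, Nat.card_fin]

theorem mem_satClasses_of_many {𝓕 : Set FinGraph} {K : ℕ → ℕ} {r n : ℕ}
    {T : SimpleGraph (Fin r)} (hT : T.IsTree) {G : SimpleGraph (Fin n)} (hG : IsSaturated 𝓕 G)
    (hm : K r + 2 ≤ {L : G.ConnectedComponent | Nonempty (L.toSimpleGraph ≃g T)}.ncard) :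
    (n : ZMod r) ∈ satClasses 𝓕 K r := by
  obtain ⟨a, H, hn, hs, -⟩ := exists_decomposition_of_many hG hm
  exact ⟨T, hT, a, H, by rw [hn]; simp, hs⟩

/-- Adding `j` more copies of the tree keeps the graph saturated, and each brings r vertices and r -
1 edges. -/
theorem sat_add_le_of_many {𝓕 : Set FinGraph} {K : ℕ → ℕ} (hK : IsAbsorbing 𝓕 K) {r n : ℕ}
    {T : SimpleGraph (Fin r)} (hT : T.IsTree) {G : SimpleGraph (Fin n)} (hG : IsSaturated 𝓕 G)
    (hm : K r + 2 ≤ {L : G.ConnectedComponent | Nonempty (L.toSimpleGraph ≃g T)}.ncard) (j : ℕ) :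
    sat (n + r * j) 𝓕 ≤ G.edgeSet.ncard + (r - 1) * j := by
  obtain ⟨a, H, hn, hs, he⟩ := exists_decomposition_of_many hG hm
  have := sat_le_of_isSaturated_copies hK hT hs (m := K r + 2 + j) (by omega)
  have h1 := hT.ncard_edgeSet
  rw [show T.edgeSet.ncard = r - 1 by omega] at he
  rw [he, hn, show a + (K r + 2) * r + r * j = a + (K r + 2 + j) * r by ring]
  refine this.trans (le_of_eq ?_)
  ring

/-- The number of components of `G` that are trees on `q` vertices. -/
noncomputable def treeCount {V : Type*} (G : SimpleGraph V) (q : ℕ) : ℕ :=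
  {L : G.ConnectedComponent | L.toSimpleGraph.IsTree ∧ Nat.card L = q}.ncard

/-- The number of components of `G` that are trees on at least `q` vertices. -/
noncomputable def treeCountGE {V : Type*} (G : SimpleGraph V) (q : ℕ) : ℕ :=
  {L : G.ConnectedComponent | L.toSimpleGraph.IsTree ∧ q ≤ Nat.card L}.ncard

theorem treeCount_zero {V : Type*} [Finite V] (G : SimpleGraph V) : treeCount G 0 = 0 := by
  rw [treeCount, Set.ncard_eq_zero]
  ext L
  simp only [Set.mem_ofPred_eq, Set.mem_empty_iff_false, iff_false, not_and]
  intro h h0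
  have := h.1.nonempty
  exact (Nat.card_pos (α := L)).ne' h0

theorem card_le_edges_add_treeCount {V : Type*} [Finite V] (G : SimpleGraph V) (s : ℕ) :
    Nat.card V ≤ G.edgeSet.ncard + (∑ q ∈ Finset.range s, treeCount G q + treeCountGE G s) := by
  refine (card_le_edges_add_treeComponents G).trans (Nat.add_le_add_left ?_ _)
  have hsub : {L : G.ConnectedComponent | L.toSimpleGraph.IsTree} ⊆
      (⋃ q ∈ Finset.range s,
        {L : G.ConnectedComponent | L.toSimpleGraph.IsTree ∧ Nat.card L = q}) ∪
      {L : G.ConnectedComponent | L.toSimpleGraph.IsTree ∧ s ≤ Nat.card L} := by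
    intro L hL
    rcases lt_or_ge (Nat.card L) s with h | h
    · left
      simp only [Set.mem_iUnion]
      exact ⟨Nat.card L, by simpa using h, hL, rfl⟩
    · right
      exact ⟨hL, h⟩
  refine (Set.ncard_le_ncard hsub (Set.toFinite _)).trans ((Set.ncard_union_le _ _).trans ?_)
  exact Nat.add_le_add_right (Finset.set_ncard_biUnion_le _ _) _

theorem sum_card_components {V : Type*} [Finite V] (G : SimpleGraph V)
    [Fintype G.ConnectedComponent] :
    ∑ L : G.ConnectedComponent, Nat.card L = Nat.card V := by
  rw [← Nat.card_sigma]
  refine (Nat.card_congr ⟨fun v => ⟨G.connectedComponentMk v, v, rfl⟩, fun x => x.2.1,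
    fun v => rfl, ?_⟩).symm
  rintro ⟨K, v, rfl⟩
  rfl

theorem mul_treeCount_add_le {V : Type*} [Finite V] (G : SimpleGraph V) (r : ℕ) :
    r * treeCount G r + (r + 1) * treeCountGE G (r + 1) ≤ Nat.card V := by
  classical
  have := Fintype.ofFinite G.ConnectedComponent
  rw [← sum_card_components G, treeCount, treeCountGE, Set.ncard_eq_toFinset_card',
    Set.ncard_eq_toFinset_card', Finset.card_eq_sum_ones, Finset.card_eq_sum_ones,
    Finset.mul_sum, Finset.mul_sum, Set.toFinset_ofPred, Set.toFinset_ofPred, Finset.sum_filter,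
    Finset.sum_filter, ← Finset.sum_add_distrib]
  refine Finset.sum_le_sum fun L _ => ?_
  split_ifs <;> omega

theorem mul_treeCountGE_le {V : Type*} [Finite V] (G : SimpleGraph V) (r : ℕ) :
    r * treeCountGE G r ≤ Nat.card V := by
  classical
  have := Fintype.ofFinite G.ConnectedComponent
  rw [← sum_card_components G, treeCountGE, Set.ncard_eq_toFinset_card', Finset.card_eq_sum_ones,
    Finset.mul_sum, Set.toFinset_ofPred, Finset.sum_filter]
  refine Finset.sum_le_sum fun L _ => ?_
  split_ifs <;> omega

/-- A bound for the number of components that are trees on `q` vertices in a saturated graph whose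
order is not in `satClasses 𝓕 K q`. -/
noncomputable def treeBound (K : ℕ → ℕ) (q : ℕ) : ℕ :=
  Nat.card (SimpleGraph (Fin q)) * (K q + 1)

theorem exists_many_of_treeBound_lt {K : ℕ → ℕ} {q n : ℕ} {G : SimpleGraph (Fin n)}
    (h : treeBound K q < treeCount G q) : ∃ T : SimpleGraph (Fin q), T.IsTree ∧
      K q + 2 ≤ {L : G.ConnectedComponent | Nonempty (L.toSimpleGraph ≃g T)}.ncard := by
  classical
  by_contra! hc
  have := Fintype.ofFinite (SimpleGraph (Fin q))
  have h1 := ncard_treeComponents_le G q (fun _ => K q + 1)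
    (fun T hT => Nat.lt_succ_iff.1 (hc T hT))
  rw [Finset.sum_const, Finset.card_univ, smul_eq_mul, ← Nat.card_eq_fintype_card] at h1
  exact absurd h (not_lt.2 h1)

theorem treeCount_le {𝓕 : Set FinGraph} {K : ℕ → ℕ} {q n : ℕ} {G : SimpleGraph (Fin n)}
    (hG : IsSaturated 𝓕 G) (hn : (n : ZMod q) ∉ satClasses 𝓕 K q) :
    treeCount G q ≤ treeBound K q := by
  by_contra! h
  obtain ⟨T, hT, hm⟩ := exists_many_of_treeBound_lt h
  exact hn (mem_satClasses_of_many hT hG hm)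

theorem sum_treeCount_le {𝓕 : Set FinGraph} {K : ℕ → ℕ} {r n : ℕ} {G : SimpleGraph (Fin n)}
    (hG : IsSaturated 𝓕 G) (hn : n ∈ avoidsBelow (satClasses 𝓕 K) r) :
    ∑ q ∈ Finset.range r, treeCount G q ≤ ∑ q ∈ Finset.range r, treeBound K q := by
  refine Finset.sum_le_sum fun q hq => ?_
  rcases Nat.eq_zero_or_pos q with rfl | hq0
  · rw [treeCount_zero]; exact Nat.zero_le _
  · exact treeCount_le hG (hn q hq0 (by simpa using hq))

/-- This is sat(n) ≥ (1 - 1/r)n - O(1): trees on fewer than r vertices are bounded in number, and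
the others number at most n/r. -/
theorem le_sat_of_avoidsBelow {𝓕 : Set FinGraph} (h𝓕 : IsAdmissible 𝓕) {K : ℕ → ℕ} {r n : ℕ}
    (hn : n ∈ avoidsBelow (satClasses 𝓕 K) r) :
    r * n ≤ r * sat n 𝓕 + r * ∑ q ∈ Finset.range r, treeBound K q + n := by
  obtain ⟨G, hG, he⟩ := exists_sat h𝓕 n
  have h1 := card_le_edges_add_treeCount G r
  have h2 := sum_treeCount_le hG hn
  have h3 := mul_treeCountGE_le G r
  rw [Nat.card_fin] at h1 h3
  rw [he] at h1
  calc r * n ≤ r * (sat n 𝓕 + (∑ q ∈ Finset.range r, treeBound K q + treeCountGE G r)) :=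
        Nat.mul_le_mul_left _ (h1.trans (by omega))
    _ = r * sat n 𝓕 + r * ∑ q ∈ Finset.range r, treeBound K q + r * treeCountGE G r := by ring
    _ ≤ _ := by omega

/-- On a class of `satClasses`, away from the earlier classes, the saturation number is eventually
given by a linear formula. -/
theorem exists_eventually_eq {𝓕 : Set FinGraph} (h𝓕 : IsAdmissible 𝓕) {K : ℕ → ℕ}
    (hK : IsAbsorbing 𝓕 K) {r : ℕ} (hr : 1 ≤ r) {C : ZMod r} (hC : C ∈ satClasses 𝓕 K r) :
    ∃ (k : ℤ) (N : ℕ), ∀ n : ℕ, N ≤ n → (n : ZMod r) = C →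
      n ∈ avoidsBelow (satClasses 𝓕 K) r →
        (sat n 𝓕 : ℝ) = (((r : ℝ) - 1) * (n : ℝ) + (k : ℝ)) / (r : ℝ) := by
  obtain ⟨T, hT, a, H, ha, hs⟩ := hC
  set Ls := ∑ q ∈ Finset.range r, treeBound K q with hLs
  set c := r * H.edgeSet.ncard with hc
  have hmod : ∀ {m n : ℕ}, m ≤ n → (m : ZMod r) = (n : ZMod r) → ∃ j, n = m + r * j := by
    intro m n hmn h
    rw [ZMod.natCast_eq_natCast_iff] at h
    obtain ⟨j, hj⟩ := (Nat.modEq_iff_dvd' hmn).1 h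
    exact ⟨j, by omega⟩
  -- upper bound
  have hup : ∀ n : ℕ, a + (K r + 2) * r ≤ n → (n : ZMod r) = C →
      (r : ℤ) * sat n 𝓕 ≤ (r - 1) * n + c := by
    intro n hn hnC
    obtain ⟨j, rfl⟩ := hmod (m := a + (K r + 2) * r) hn (by simp [hnC, ha])
    have := sat_le_of_isSaturated_copies hK hT hs (m := K r + 2 + j) (by omega)
    rw [show a + (K r + 2 + j) * r = a + (K r + 2) * r + r * j by ring] at this
    zify [hr] at this
    rw [hc]
    push_cast
    have hr' : (1 : ℤ) ≤ r := by exact_mod_cast hr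
    have h2 := mul_le_mul_of_nonneg_left this (show (0 : ℤ) ≤ r by omega)
    have h3 : (0 : ℤ) ≤ (r - 1) * a := mul_nonneg (by omega) (by omega)
    linarith [h2, h3, show (r : ℤ) * (H.edgeSet.ncard + (K r + 2 + j) * (r - 1)) =
      (r - 1) * (a + (K r + 2) * r + r * j) + r * H.edgeSet.ncard - (r - 1) * a by ring]
  -- for large orders, an optimal graph has many components isomorphic to a common tree
  set N₁ := a + (K r + 2) * r + ((r + 1) * c + r * (r + 1) * Ls + r * (treeBound K r + 1)) with hN₁
  have hstep : ∀ n : ℕ, N₁ ≤ n → (n : ZMod r) = C → n ∈ avoidsBelow (satClasses 𝓕 K) r →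
      ∀ j, sat (n + r * j) 𝓕 ≤ sat n 𝓕 + (r - 1) * j := by
    intro n hn hnC hna j
    obtain ⟨G, hG, he⟩ := exists_sat h𝓕 n
    have h1 := card_le_edges_add_treeCount G (r + 1)
    have h2 := sum_treeCount_le hG hna
    have h3 := mul_treeCount_add_le G r
    have h4 := hup n (by omega) hnC
    rw [Finset.sum_range_succ] at h1
    rw [Nat.card_fin] at h1 h3
    rw [he] at h1
    -- With few trees on r vertices, nearly all tree components have at least r + 1 vertices, so
    -- sat(n) ≥ (1 - 1/(r + 1))n - O(1). This contradicts the upper bound `hup`; eliminating the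
    -- other quantities gives exactly n < `N₁`.
    have hlt : treeBound K r < treeCount G r := by
      by_contra! hle
      have h5 : n ≤ sat n 𝓕 + (Ls + treeCount G r + treeCountGE G (r + 1)) := by omega
      zify at h5 h3 hn hle
      have hr' : (1 : ℤ) ≤ r := by exact_mod_cast hr
      have h6 := mul_le_mul_of_nonneg_left h5 (show (0 : ℤ) ≤ r * (r + 1) by positivity)
      have h7 := mul_le_mul_of_nonneg_left h3 (show (0 : ℤ) ≤ r by omega)
      have h8 := mul_le_mul_of_nonneg_left h4 (show (0 : ℤ) ≤ r + 1 by omega)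
      have h9 := mul_le_mul_of_nonneg_left hle (show (0 : ℤ) ≤ r by omega)
      have h10 : (0 : ℤ) ≤ a + (K r + 2) * r := by positivity
      rw [hN₁] at hn
      push_cast at hn
      nlinarith [h6, h7, h8, h9, hn, h10]
    obtain ⟨T', hT', hm⟩ := exists_many_of_treeBound_lt hlt
    rw [← he]
    exact sat_add_le_of_many hK hT' hG hm j
  by_cases hne : ∃ n : ℕ, N₁ ≤ n ∧ (n : ZMod r) = C ∧ n ∈ avoidsBelow (satClasses 𝓕 K) r
  · -- a large order at which the constant term is minimal
    let κ : ℕ → ℤ := fun n => (r : ℤ) * sat n 𝓕 - (r - 1) * n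
    have hκ : ∀ n ∈ avoidsBelow (satClasses 𝓕 K) r, 0 ≤ κ n + r * Ls := by
      intro n hn
      have := le_sat_of_avoidsBelow h𝓕 hn
      rw [← hLs] at this
      zify at this
      simp only [κ]
      linarith
    obtain ⟨n₀, ⟨h0, h0C, h0a⟩, hmin⟩ := WellFounded.has_min
      (InvImage.wf (fun n => (κ n + r * Ls).toNat) Nat.lt_wfRel.wf)
      {n : ℕ | N₁ ≤ n ∧ (n : ZMod r) = C ∧ n ∈ avoidsBelow (satClasses 𝓕 K) r} hne
    -- Later orders have a constant term at most `κ n₀` by `hstep`, and at least `κ n₀` by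
    -- minimality.
    refine ⟨κ n₀, n₀, fun n hn hnC hna => ?_⟩
    obtain ⟨j, rfl⟩ := hmod hn (h0C.trans hnC.symm)
    have h1 := hstep n₀ h0 h0C h0a j
    have h2 := hmin _ ⟨by omega, hnC, hna⟩
    have h3 := hκ _ hna
    have h4 := hκ _ h0a
    have h5 : κ n₀ ≤ κ (n₀ + r * j) := by
      have : ¬ (κ (n₀ + r * j) + r * Ls).toNat < (κ n₀ + r * Ls).toNat := h2
      omega
    have hr' : (1 : ℤ) ≤ r := by exact_mod_cast hr
    have h6 : κ (n₀ + r * j) = κ n₀ := by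
      refine le_antisymm ?_ h5
      zify [hr] at h1
      simp only [κ]
      have := mul_le_mul_of_nonneg_left h1 (show (0 : ℤ) ≤ r by omega)
      push_cast
      linarith [this, show (r : ℤ) * (sat n₀ 𝓕 + (r - 1) * j) =
        r * sat n₀ 𝓕 - (r - 1) * n₀ + (r - 1) * (n₀ + r * j) by ring]
    rw [← h6]
    have hr0 : (r : ℝ) ≠ 0 := by positivity
    rw [eq_div_iff hr0]
    simp only [κ]
    push_cast
    ring
  · push Not at hne
    -- The class contains no large relevant orders, so any constant will do.
    exact ⟨0, N₁, fun n hn hnC hna => absurd hna (hne n hn hnC)⟩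

/-- An uncovered n avoids the classes below every r, so sat(n) ≥ (1 - 1/r)n - O_r(1) for each r. The
error function is the deficit itself, cut off at 0. -/
theorem satAtLeastLinear_uncovered {𝓕 : Set FinGraph} (h𝓕 : IsAdmissible 𝓕) (K : ℕ → ℕ) :
    SatAtLeastLinear 𝓕 (uncovered (satClasses 𝓕 K)) := by
  classical
  refine ⟨fun n => if n ∈ uncovered (satClasses 𝓕 K) then min 0 ((sat n 𝓕 : ℝ) - n) else 0,
    ?_, ?_⟩
  · rw [Asymptotics.isLittleO_iff]
    intro ε hε
    -- The errors n/r and `Ls` each get half of ε n.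
    obtain ⟨r, hr⟩ := exists_nat_gt (2 / ε)
    have hr0 : (0 : ℝ) < r := lt_trans (by positivity) hr
    set Ls := ∑ q ∈ Finset.range r, treeBound K q
    obtain ⟨N, hN⟩ := exists_nat_gt (2 * Ls / ε)
    filter_upwards [eventually_ge_atTop N] with n hn
    have hnN : (N : ℝ) ≤ n := by exact_mod_cast hn
    have hεn : (Ls : ℝ) ≤ ε / 2 * n := by
      have := (div_lt_iff₀ hε).1 hN
      nlinarith
    rw [Real.norm_of_nonneg (Nat.cast_nonneg n)]
    split_ifs with hu
    · have h1 := le_sat_of_avoidsBelow h𝓕 (r := r) (K := K)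
        (show n ∈ avoidsBelow (satClasses 𝓕 K) r from fun q hq _ => hu q hq)
      have h2 : (r : ℝ) * n ≤ r * sat n 𝓕 + r * Ls + n := by exact_mod_cast h1
      have h3 : (n : ℝ) ≤ r * (ε / 2 * n) := by
        have := (div_lt_iff₀ hε).1 hr
        have hn0 : (0 : ℝ) ≤ n := Nat.cast_nonneg n
        nlinarith
      have h4 : (n : ℝ) - sat n 𝓕 ≤ ε * n := by
        have : (r : ℝ) * (n - sat n 𝓕) ≤ r * (ε * n) := by nlinarith
        exact le_of_mul_le_mul_left this hr0
      rw [Real.norm_eq_abs, abs_le]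
      constructor
      · refine le_min ?_ (by linarith)
        have : (0 : ℝ) ≤ ε * n := by positivity
        linarith
      · exact (min_le_left _ _).trans (by positivity)
    · simp only [norm_zero]; positivity
  · intro n hn
    simp only [if_pos hn]
    have := min_le_right (0 : ℝ) ((sat n 𝓕 : ℝ) - n)
    linarith

/-! ### Fitting vertices and their certificates. -/

/-- `Fits T ℓ v x` says that two disjoint copies of `T`, joined by an edge, can be found in the graph
that consists of `T - ℓ` and sufficiently many copies of `T` whose vertices `x` are joined to the
vertex `v` of `T - ℓ`. One of the two copies of `T` is one of those attached to `v`; the other one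
has its vertex `y` at `v`, and `br` and `g` tell where its other vertices go: into the attached copy
with a given label, or into `T - ℓ` for the label `none`. -/
def Fits {W : Type*} (T : SimpleGraph W) (ℓ v x : W) : Prop :=
  ∃ (y : W) (br : W → Option W) (g : W → W),
    (∀ u, T.Adj y u → (br u ≠ none → g u = x) ∧ (br u = none → T.Adj v (g u))) ∧
    (∀ u w, u ≠ y → w ≠ y → T.Adj u w → br u = br w ∧ T.Adj (g u) (g w)) ∧
    (∀ u w, u ≠ y → w ≠ y → u ≠ w → br u = br w → g u ≠ g w) ∧
    (∀ u, u ≠ y → br u = none → g u ≠ ℓ ∧ g u ≠ v)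

/-- There is a vertex `ℓ` such that `Fits T ℓ v x` always holds. -/
def HasFittingVertex {W : Type*} (T : SimpleGraph W) : Prop :=
  ∃ ℓ, ∀ v, v ≠ ℓ → ∀ x, Fits T ℓ v x

theorem HasFittingVertex.iso {W W' : Type*} {T : SimpleGraph W} {T' : SimpleGraph W'}
    (h : HasFittingVertex T) (e : T ≃g T') : HasFittingVertex T' := by
  obtain ⟨ℓ, h⟩ := h
  refine ⟨e ℓ, fun v hv x => ?_⟩
  obtain ⟨y, br, g, h1, h2, h3, h4⟩ := h (e.symm v)
    (fun h => hv (by rw [← h, RelIso.apply_symm_apply])) (e.symm x)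
  have hne : ∀ {u}, u ≠ e y → e.symm u ≠ y := fun {u} hu h => hu (by simp [← h])
  refine ⟨e y, fun u => (br (e.symm u)).map e, fun u => e (g (e.symm u)), ?_, ?_, ?_, ?_⟩
  · intro u hu
    have := h1 (e.symm u) (by rw [← e.map_adj_iff]; simpa using hu)
    refine ⟨fun hb => ?_, fun hb => ?_⟩
    · change e (g (e.symm u)) = x
      rw [this.1 (by simpa using hb)]; simp
    · have := this.2 (by simpa using hb)
      rw [← e.map_adj_iff] at this
      simpa using this
  · intro u w hu hw huw
    have := h2 (e.symm u) (e.symm w) (hne hu) (hne hw) (e.symm.map_adj_iff.2 huw)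
    exact ⟨congrArg (Option.map e) this.1, e.map_adj_iff.2 this.2⟩
  · intro u w hu hw huw hb hg
    refine h3 (e.symm u) (e.symm w) (hne hu) (hne hw) (by simpa using huw) ?_ (e.injective hg)
    exact Option.map_injective e.injective hb
  · intro u hu hb
    have := h4 (e.symm u) (hne hu) (by simpa using hb)
    refine ⟨fun h => this.1 (e.injective h), fun h => this.2 (by rw [← h]; simp)⟩

/-- Adjacency in the tree on `{0, …, p.length}` in which the parent of `k + 1` is the `k`-th entry of
`p`. -/
def parAdj (p : List ℕ) (i j : ℕ) : Bool :=
  (Nat.blt i j && Nat.beq (p.getD (j - 1) 0) i) || (Nat.blt j i && Nat.beq (p.getD (i - 1) 0) j)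

theorem parAdj_comm (p : List ℕ) (i j : ℕ) : parAdj p i j = parAdj p j i := by
  simp only [parAdj, Bool.or_comm]

theorem parAdj_self (p : List ℕ) (i : ℕ) : parAdj p i i = false := by
  have : Nat.blt i i = false := by rw [Bool.eq_false_iff]; simp [Nat.blt_eq]
  simp [parAdj, this]

/-- The tree on `n` vertices given by a list of parents. -/
def parGraph (p : List ℕ) (n : ℕ) : SimpleGraph (Fin n) where
  Adj i j := parAdj p i j = true
  symm.symm _ _ h := (parAdj_comm p _ _).trans h
  loopless := ⟨fun i h => by simp [parAdj_self] at h⟩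

/-- The neighbours of every vertex. -/
def parNeighbors (p : List ℕ) (n : ℕ) : List (List ℕ) :=
  (List.range n).map fun i => (List.range n).filter fun j => parAdj p i j

/-- Injective assignment of the elements of a list to those of another one, by backtracking. -/
def matchAll (emb : ℕ → ℕ → Option (List (ℕ × ℕ))) : List ℕ → List ℕ → Option (List (ℕ × ℕ))
  | [], _ => some []
  | c :: cs, hs => hs.findSome? fun k =>
      match emb c k with
      | none => none
      | some A => match matchAll emb cs (hs.filter fun i => !(Nat.beq i k)) with
        | none => none
        | some B => some (A ++ B)

/-- Search for an embedding of the branch at `u` (away from `pu`) of one tree into the branch at `h`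
(away from `ph`) of another tree, avoiding `forb`. -/
def branchEmb (nb nb' : List (List ℕ)) (forb : ℕ) : ℕ → ℕ → ℕ → ℕ → ℕ → Option (List (ℕ × ℕ))
  | 0, _, _, _, _ => none
  | fuel + 1, u, pu, h, ph =>
    match matchAll (fun c k => branchEmb nb nb' forb fuel c u k h)
        ((nb.getD u []).filter fun i => !(Nat.beq i pu))
        ((nb'.getD h []).filter fun i => !(Nat.beq i ph) && !(Nat.beq i forb)) with
    | none => none
    | some B => some ((u, h) :: B)

/-- Embeddings of several branches at `y` into the tree rooted at `x`, as triples of a vertex, a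
label and the image. -/
def allBranches (nb : List (List ℕ)) (n y x : ℕ) : List ℕ → Option (List (ℕ × ℕ × ℕ))
  | [] => some []
  -- The number `n` is not a vertex, so as forbidden vertex or as parent it excludes nothing. The
  -- label `c + 1` leaves 0 free for the branch that goes into T - ℓ.
  | c :: cs => match branchEmb nb nb n n c y x n with
    | none => none
    | some A => match allBranches nb n y x cs with
      | none => none
      | some B => some (A.map (fun a => (a.1, c + 1, a.2)) ++ B)

/-- Search for a witness of `Fits` that does not use `T - ℓ`. -/
def findFit (nb : List (List ℕ)) (n x : ℕ) : Option (ℕ × List (ℕ × ℕ × ℕ)) :=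
  (List.range n).findSome? fun y => (allBranches nb n y x (nb.getD y [])).map fun A => (y, A)

/-- Search for a witness of `Fits` that puts one branch into `T - ℓ`. -/
def findFitUsing (nb : List (List ℕ)) (n l v x : ℕ) : Option (ℕ × List (ℕ × ℕ × ℕ)) :=
  (List.range n).findSome? fun y => (nb.getD y []).findSome? fun c =>
    (nb.getD v []).findSome? fun w => if Nat.beq w l then none else
      match branchEmb nb nb l n c y w v with
      | none => none
      | some A => match allBranches nb n y x ((nb.getD y []).filter fun i => !(Nat.beq i c)) with
        | none => none
        | some B => some (y, A.map (fun a => (a.1, 0, a.2)) ++ B)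

/-- Lookup in a list of triples. -/
def lookupTriple (A : List (ℕ × ℕ × ℕ)) (u : ℕ) : ℕ × ℕ :=
  match A with
  | [] => (0, 0)
  | a :: A => if Nat.beq a.1 u then a.2 else lookupTriple A u

/-- Verification of a witness of `Fits`. -/
def validFit (p : List ℕ) (n l v x y : ℕ) (A : List (ℕ × ℕ × ℕ)) : Bool :=
  Nat.blt y n && (List.range n).all fun u => Nat.beq u y ||
    (Nat.ble (lookupTriple A u).1 n && Nat.blt (lookupTriple A u).2 n &&
    (!(parAdj p y u) || (if Nat.beq (lookupTriple A u).1 0 then parAdj p v (lookupTriple A u).2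
      else Nat.beq (lookupTriple A u).2 x)) &&
    (!(Nat.beq (lookupTriple A u).1 0) ||
      (!(Nat.beq (lookupTriple A u).2 l) && !(Nat.beq (lookupTriple A u).2 v))) &&
    (List.range n).all fun w => Nat.beq w y || Nat.beq u w ||
      ((!(parAdj p u w) || (Nat.beq (lookupTriple A u).1 (lookupTriple A w).1 &&
        parAdj p (lookupTriple A u).2 (lookupTriple A w).2)) &&
      (!(Nat.beq (lookupTriple A u).1 (lookupTriple A w).1) ||
        !(Nat.beq (lookupTriple A u).2 (lookupTriple A w).2))))

theorem natBeq_eq_false {a b : ℕ} : Nat.beq a b = false ↔ a ≠ b := by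
  rw [← Bool.not_eq_true, Nat.beq_eq]

/-- Only the certificate is verified, so the searches need no proof of correctness. Label 0 becomes
`none` and a positive label becomes `some` of its predecessor; the reductions modulo `n` produce
elements of `Fin n` and change no value that is used. -/
theorem fits_of_validFit {p : List ℕ} {n l v x y : ℕ} {A : List (ℕ × ℕ × ℕ)}
    (hl : l < n) (hv : v < n) (hx : x < n) (h : validFit p n l v x y A = true) :
    Fits (parGraph p n) ⟨l, hl⟩ ⟨v, hv⟩ ⟨x, hx⟩ := by
  have hn : 0 < n := by omega
  simp only [validFit, Bool.and_eq_true, Nat.blt_eq, List.all_eq_true, List.mem_range,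
    Bool.or_eq_true, Nat.beq_eq, Nat.ble_eq, Bool.not_eq_true', natBeq_eq_false] at h
  obtain ⟨hy, h⟩ := h
  let lab : Fin n → ℕ := fun u => (lookupTriple A u).1
  let im : Fin n → ℕ := fun u => (lookupTriple A u).2
  refine ⟨⟨y, hy⟩, fun u => if lab u = 0 then none else some ⟨(lab u - 1) % n, Nat.mod_lt _ hn⟩,
    fun u => ⟨im u % n, Nat.mod_lt _ hn⟩, ?_⟩
  have key : ∀ u : Fin n, u ≠ ⟨y, hy⟩ → lab u ≤ n ∧ im u < n := by
    intro u hu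
    rcases h u u.2 with h' | ⟨⟨⟨⟨h1, h2⟩, h3⟩, h4⟩, h5⟩
    · exact absurd (Fin.ext h') hu
    · exact ⟨h1, h2⟩
  have him : ∀ u : Fin n, u ≠ ⟨y, hy⟩ → im u % n = im u :=
    fun u hu => Nat.mod_eq_of_lt (key u hu).2
  have hlab : ∀ u w : Fin n, u ≠ ⟨y, hy⟩ → w ≠ ⟨y, hy⟩ →
      ((if lab u = 0 then none else some (⟨(lab u - 1) % n, Nat.mod_lt _ hn⟩ : Fin n)) =
        (if lab w = 0 then none else some ⟨(lab w - 1) % n, Nat.mod_lt _ hn⟩)) →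
      lab u = lab w := by
    intro u w hu hw huw
    have h1 := (key u hu).1
    have h2 := (key w hw).1
    split_ifs at huw with ha hb hb
    · omega
    · simp only [Option.some.injEq, Fin.mk.injEq] at huw
      rw [Nat.mod_eq_of_lt (by omega), Nat.mod_eq_of_lt (by omega)] at huw
      omega
  refine ⟨?_, ?_, ?_, ?_⟩
  · intro u hu
    have huy : u ≠ ⟨y, hy⟩ := hu.ne'
    rcases h u u.2 with h' | ⟨⟨⟨⟨h1, h2⟩, h3⟩, h4⟩, h5⟩
    · exact absurd (Fin.ext h') huy
    · have hadj : parAdj p y u = true := hu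
      rw [hadj] at h3
      simp only [Bool.true_eq_false, false_or] at h3
      refine ⟨fun hb => ?_, fun hb => ?_⟩
      · have h0 : lab u ≠ 0 := fun h0 => hb (by simp [h0])
        rw [if_neg (by simpa using h0)] at h3
        simp only [Nat.beq_eq] at h3
        ext
        change im u % n = x
        rw [him u huy]
        exact h3
      · have h0 : lab u = 0 := by
          by_contra h0
          simp [h0] at hb
        rw [if_pos (by simpa using h0)] at h3
        change parAdj p v (im u % n) = true
        rw [him u huy]
        exact h3
  · intro u w hu hw huw
    rcases h u u.2 with h' | ⟨⟨⟨⟨h1, h2⟩, h3⟩, h4⟩, h5⟩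
    · exact absurd (Fin.ext h') hu
    rcases h5 w w.2 with (h' | h') | ⟨h6, h7⟩
    · exact absurd (Fin.ext h') hw
    · exact absurd (Fin.ext h') huw.ne
    · have hadj : parAdj p u w = true := huw
      rw [hadj] at h6
      simp only [Bool.true_eq_false, false_or] at h6
      have h8 : lab u = lab w := h6.1
      refine ⟨by simp only [h8], ?_⟩
      change parAdj p (im u % n) (im w % n) = true
      rw [him u hu, him w hw]
      exact h6.2
  · intro u w hu hw huw hb hg
    rcases h u u.2 with h' | ⟨⟨⟨⟨h1, h2⟩, h3⟩, h4⟩, h5⟩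
    · exact absurd (Fin.ext h') hu
    rcases h5 w w.2 with (h' | h') | ⟨h6, h7⟩
    · exact absurd (Fin.ext h') hw
    · exact absurd (Fin.ext h') huw
    · have h8 := hlab u w hu hw hb
      have h9 : im u % n = im w % n := by simpa using hg
      rw [him u hu, him w hw] at h9
      rcases h7 with h7 | h7
      · exact h7 h8
      · exact h7 h9
  · intro u hu hb
    rcases h u u.2 with h' | ⟨⟨⟨⟨h1, h2⟩, h3⟩, h4⟩, h5⟩
    · exact absurd (Fin.ext h') hu
    · have h0 : lab u = 0 := by
        by_contra h0
        simp [h0] at hb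
      rcases h4 with h4 | h4
      · exact absurd h0 h4
      · simp only [ne_eq, Fin.mk.injEq]
        rw [him u hu]
        exact h4

/-- Verification of the outcome of a search. -/
def checkFit (p : List ℕ) (n l v x : ℕ) : Option (ℕ × List (ℕ × ℕ × ℕ)) → Bool
  | none => false
  | some (y, A) => validFit p n l v x y A

theorem fits_of_checkFit {p : List ℕ} {n l v x : ℕ} {o : Option (ℕ × List (ℕ × ℕ × ℕ))}
    (hl : l < n) (hv : v < n) (hx : x < n) (h : checkFit p n l v x o = true) :
    Fits (parGraph p n) ⟨l, hl⟩ ⟨v, hv⟩ ⟨x, hx⟩ := by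
  rcases o with _ | ⟨y, A⟩
  · simp [checkFit] at h
  · exact fits_of_validFit hl hv hx h

/-- A decision procedure for `HasFittingVertex`. -/
def checkPar (p : List ℕ) (n : ℕ) : Bool :=
  (List.range n).any fun l => (List.range n).all fun v => Nat.beq v l || (List.range n).all fun x =>
    checkFit p n l v x (findFit (parNeighbors p n) n x) ||
      checkFit p n l v x (findFitUsing (parNeighbors p n) n l v x)

theorem hasFittingVertex_of_checkPar {p : List ℕ} {n : ℕ} (h : checkPar p n = true) :
    HasFittingVertex (parGraph p n) := by
  simp only [checkPar, List.any_eq_true, List.mem_range, List.all_eq_true, Bool.or_eq_true,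
    Nat.beq_eq] at h
  obtain ⟨l, hl, h⟩ := h
  refine ⟨⟨l, hl⟩, fun v hv x => ?_⟩
  rcases h v v.2 with h | h
  · exact absurd (Fin.ext h) hv
  · rcases h x x.2 with h | h
    · exact fits_of_checkFit hl v.2 x.2 h
    · exact fits_of_checkFit hl v.2 x.2 h

/-- Lookup in a list of pairs. -/
def lookupPair (A : List (ℕ × ℕ)) (u : ℕ) : ℕ :=
  match A with
  | [] => 0
  | a :: A => if Nat.beq a.1 u then a.2 else lookupPair A u

/-- Verification of an isomorphism. -/
def validIso (p q : List ℕ) (n : ℕ) (A : List (ℕ × ℕ)) : Bool :=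
  (List.range n).all fun u => Nat.blt (lookupPair A u) n && (List.range n).all fun w =>
    (Nat.beq u w || !(Nat.beq (lookupPair A u) (lookupPair A w))) &&
    (parAdj p u w == parAdj q (lookupPair A u) (lookupPair A w))

/-- Search for an isomorphism. -/
def checkIso (p q : List ℕ) (n : ℕ) : Bool :=
  (List.range n).any fun y =>
    match branchEmb (parNeighbors p n) (parNeighbors q n) n n 0 n y n with
    | none => false
    | some A => validIso p q n A

theorem nonempty_iso_of_checkIso {p q : List ℕ} {n : ℕ} (h : checkIso p q n = true) :
    Nonempty (parGraph p n ≃g parGraph q n) := by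
  simp only [checkIso, List.any_eq_true, List.mem_range] at h
  obtain ⟨y, -, h⟩ := h
  split at h
  · simp at h
  rename_i A _
  simp only [validIso, List.all_eq_true, List.mem_range, Bool.and_eq_true, Nat.blt_eq,
    Bool.or_eq_true, Nat.beq_eq, Bool.not_eq_true', natBeq_eq_false, beq_iff_eq] at h
  let f : Fin n → Fin n := fun u => ⟨lookupPair A u, (h u u.2).1⟩
  have hf : Function.Injective f := by
    intro u w huw
    rcases ((h u u.2).2 w w.2).1 with h' | h'
    · exact Fin.ext h'
    · exact absurd (congrArg Fin.val huw) h'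
  exact ⟨⟨Equiv.ofBijective f (Finite.injective_iff_bijective.1 hf), by
    intro u w
    change parAdj q (lookupPair A u) (lookupPair A w) = true ↔ parAdj p u w = true
    rw [((h u u.2).2 w w.2).2]⟩⟩

/-! ### The trees on at most seven vertices. -/

/-- Representatives for the trees on `n + 1` vertices, for `n ≤ 6`. -/
def smallTrees : ℕ → List (List ℕ)
  | 0 => [[]]
  | 1 => [[0]]
  | 2 => [[0, 0]]
  | 3 => [[0, 0, 0], [0, 0, 1]]
  | 4 => [[0, 0, 0, 0], [0, 0, 0, 1], [0, 0, 1, 2]]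
  | 5 => [[0, 0, 0, 0, 0], [0, 0, 0, 0, 1], [0, 0, 0, 1, 1], [0, 0, 0, 1, 2], [0, 0, 0, 1, 4],
      [0, 0, 1, 2, 3]]
  | 6 => [[0, 0, 0, 0, 0, 0], [0, 0, 0, 0, 0, 1], [0, 0, 0, 0, 1, 1], [0, 0, 0, 0, 1, 2],
      [0, 0, 0, 0, 1, 5], [0, 0, 0, 1, 1, 2], [0, 0, 0, 1, 2, 3], [0, 0, 0, 1, 2, 4],
      [0, 0, 0, 1, 4, 4], [0, 0, 0, 1, 4, 5], [0, 0, 1, 2, 3, 4]]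
  | _ => []

/-- Every tree obtained by attaching a leaf to a representative has a representative. -/
def checkStep (n : ℕ) : Bool :=
  (smallTrees n).all fun p => p.length == n && (List.range (n + 1)).all fun j =>
    (smallTrees (n + 1)).any fun q => checkIso (p ++ [j]) q (n + 2)

set_option maxRecDepth 100000 in
theorem checkStep_eq_true : (List.range 6).all checkStep = true := by decide +kernel

-- The trees on six vertices are left out: they only serve the enumeration of those on seven.
set_option maxRecDepth 100000 in
theorem checkPar_eq_true :
    ([1, 2, 3, 4, 6].all fun n => (smallTrees n).all fun p => checkPar p (n + 1)) = true := by
  decide +kernel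

universe u

/-- Removing a leaf from a tree and putting it last in the list of parents. -/
theorem exists_iso_parGraph_succ {V : Type u} [Fintype V] {n : ℕ} {T : SimpleGraph V}
    (hV : Fintype.card V = n + 2)
    (hT : T.IsTree) (P : List ℕ → Prop)
    (ih : ∀ (U : Type u) [Fintype U] (T' : SimpleGraph U), Fintype.card U = n + 1 → T'.IsTree →
      ∃ p, p.length = n ∧ P p ∧ Nonempty (T' ≃g parGraph p (n + 1))) :
    ∃ p j, p.length = n ∧ P p ∧ j < n + 1 ∧ Nonempty (T ≃g parGraph (p ++ [j]) (n + 2)) := by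
  classical
  have : Nontrivial V := Fintype.one_lt_card_iff_nontrivial.1 (by omega)
  obtain ⟨l, hl⟩ := hT.exists_vert_degree_one_of_nontrivial
  have hT' : (T.induce ({l}ᶜ : Set V)).IsTree :=
    ⟨hT.1.induce_compl_singleton_of_degree_eq_one hl, hT.2.induce _⟩
  obtain ⟨p, hp, hP, ⟨e⟩⟩ := ih (↥({l}ᶜ : Set V)) _ (by
    rw [Fintype.card_compl_set]
    simp [hV]) hT'
  obtain ⟨s, hs, hs'⟩ := (degree_eq_one_iff_existsUnique_adj).1 hl
  have hsl : s ≠ l := hs.ne'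
  have hlt : ∀ i j : ℕ, i < n + 1 → j < n + 1 →
      parAdj (p ++ [(e ⟨s, hsl⟩ : ℕ)]) i j = parAdj p i j := by
    intro i j hi hj
    simp only [parAdj]
    have key : ∀ a b : ℕ, a < n + 1 → b < n + 1 →
        (Nat.blt a b && Nat.beq ((p ++ [(e ⟨s, hsl⟩ : ℕ)]).getD (b - 1) 0) a) =
        (Nat.blt a b && Nat.beq (p.getD (b - 1) 0) a) := by
      intro a b ha hb
      by_cases hab : a < b
      · rw [List.getD_append _ _ _ _ (by omega)]
      · have : Nat.blt a b = false := by rw [Bool.eq_false_iff]; simpa [Nat.blt_eq] using hab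
        simp [this]
    rw [key i j hi hj, key j i hj hi]
  have hnew : ∀ i : ℕ, i < n + 1 →
      (parAdj (p ++ [(e ⟨s, hsl⟩ : ℕ)]) i (n + 1) = true ↔ (e ⟨s, hsl⟩ : ℕ) = i) := by
    intro i hi
    have h1 : Nat.blt i (n + 1) = true := by rw [Nat.blt_eq]; exact hi
    have h2 : Nat.blt (n + 1) i = false := by
      rw [Bool.eq_false_iff]; simp only [ne_eq, Nat.blt_eq]; omega
    have h3 : (p ++ [(e ⟨s, hsl⟩ : ℕ)]).getD n 0 = e ⟨s, hsl⟩ := by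
      rw [List.getD_append_right _ _ _ _ (by omega)]
      simp [hp]
    have h4 : n + 1 - 1 = n := rfl
    rw [parAdj, h1, h2, h4, h3]
    simp [Nat.beq_eq]
  let f : V → Fin (n + 2) := fun v => if h : v = l then Fin.last _ else (e ⟨v, h⟩).castSucc
  have hf : Function.Injective f := by
    intro u v huv
    by_cases hu : u = l <;> by_cases hv : v = l
    · rw [hu, hv]
    · simp only [f, dif_pos hu, dif_neg hv] at huv
      exact absurd huv.symm (Fin.castSucc_lt_last _).ne
    · simp only [f, dif_neg hu, dif_pos hv] at huv
      exact absurd huv (Fin.castSucc_lt_last _).ne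
    · simp only [f, dif_neg hu, dif_neg hv] at huv
      have := e.injective (Fin.castSucc_injective _ huv)
      exact congrArg Subtype.val this
  refine ⟨p, e ⟨s, hsl⟩, hp, hP, (e ⟨s, hsl⟩).2, ⟨⟨Equiv.ofBijective f
    ((Fintype.bijective_iff_injective_and_card f).2 ⟨hf, by simp [hV]⟩), ?_⟩⟩⟩
  have hleaf : ∀ v, T.Adj l v ↔ v = s := fun v => ⟨fun h => hs' v h, fun h => h ▸ hs⟩
  have hlastadj : ∀ v (hv : v ≠ l),
      (parAdj (p ++ [(e ⟨s, hsl⟩ : ℕ)]) (e ⟨v, hv⟩) (n + 1) = true ↔ v = s) := by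
    intro v hv
    rw [hnew _ (e ⟨v, hv⟩).2]
    refine ⟨fun h => ?_, fun h => by subst h; rfl⟩
    have := e.injective (Fin.ext h)
    exact congrArg Subtype.val this.symm
  intro u v
  change parAdj (p ++ [(e ⟨s, hsl⟩ : ℕ)]) (f u) (f v) = true ↔ T.Adj u v
  by_cases hu : u = l <;> by_cases hv : v = l
  · simp [f, hu, hv, parAdj_self]
  · simp only [f, dif_pos hu, dif_neg hv]
    rw [parAdj_comm, hu, hleaf]
    exact hlastadj v hv
  · simp only [f, dif_neg hu, dif_pos hv]
    rw [hv, adj_comm, hleaf]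
    exact hlastadj u hu
  · simp only [f, dif_neg hu, dif_neg hv]
    change parAdj _ (e ⟨u, hu⟩ : ℕ) (e ⟨v, hv⟩ : ℕ) = true ↔ _
    rw [hlt _ _ (e ⟨u, hu⟩).2 (e ⟨v, hv⟩).2]
    change (parGraph p (n + 1)).Adj (e ⟨u, hu⟩) (e ⟨v, hv⟩) ↔ _
    rw [e.map_adj_iff]
    simp

/-- Every tree arises by attaching a leaf to a smaller one, and `checkStep` says that the lists are
closed under this operation up to isomorphism. -/
theorem exists_iso_smallTrees (n : ℕ) (hn : n ≤ 6) (V : Type u) [Fintype V] (T : SimpleGraph V)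
    (hV : Fintype.card V = n + 1) (hT : T.IsTree) :
    ∃ p, p.length = n ∧ p ∈ smallTrees n ∧ Nonempty (T ≃g parGraph p (n + 1)) := by
  induction n generalizing V with
  | zero =>
    refine ⟨[], rfl, by simp [smallTrees], ⟨⟨Fintype.equivFinOfCardEq hV, ?_⟩⟩⟩
    have := Fintype.card_le_one_iff_subsingleton.1 hV.le
    intro a b
    rw [Subsingleton.elim a b]
    simp
  | succ n ih =>
    obtain ⟨p, j, hp, hP, hj, ⟨e⟩⟩ := exists_iso_parGraph_succ hV hT (· ∈ smallTrees n)
      (fun U _ T' hU hT' => ih (by omega) U T' hU hT')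
    have h := checkStep_eq_true
    simp only [List.all_eq_true, List.mem_range] at h
    have h1 := h n (by omega)
    simp only [checkStep, List.all_eq_true, Bool.and_eq_true, List.mem_range,
      List.any_eq_true] at h1
    obtain ⟨q, hq, hc⟩ := (h1 p hP).2 j hj
    obtain ⟨e'⟩ := nonempty_iso_of_checkIso hc
    refine ⟨q, ?_, hq, ⟨e.trans e'⟩⟩
    clear * - hq hn
    have h2 : ∀ m ≤ 6, ∀ q ∈ smallTrees m, q.length = m := by decide
    exact h2 (n + 1) hn q hq

theorem hasFittingVertex_of_small {r : ℕ} (hr : r ∈ ({2, 3, 4, 5, 7} : Set ℕ))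
    {T : SimpleGraph (Fin r)} (hT : T.IsTree) : HasFittingVertex T := by
  have hr' : ∃ n ∈ [1, 2, 3, 4, 6], r = n + 1 := by
    simp only [Set.mem_insert_iff, Set.mem_singleton_iff] at hr
    rcases hr with rfl | rfl | rfl | rfl | rfl
    exacts [⟨1, by simp⟩, ⟨2, by simp⟩, ⟨3, by simp⟩, ⟨4, by simp⟩, ⟨6, by simp⟩]
  obtain ⟨n, hn, rfl⟩ := hr'
  obtain ⟨p, -, hp, ⟨e⟩⟩ := exists_iso_smallTrees n (by simp at hn; omega) _ T (by simp) hT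
  have h := checkPar_eq_true
  simp only [List.all_eq_true] at h
  exact (hasFittingVertex_of_checkPar (h n hn p hp)).iso e.symm

/-! ### Shifting a residue class by one. -/

theorem exists_isSaturated_ge {𝓕 : Set FinGraph} {V : Type*} [Finite V] {G : SimpleGraph V}
    (hG : ¬ ContainsMember 𝓕 G) : ∃ G', G ≤ G' ∧ IsSaturated 𝓕 G' := by
  obtain ⟨G', hG', hmax⟩ :=
    (Set.toFinite {G' : SimpleGraph V | ¬ ContainsMember 𝓕 G'}).exists_le_maximal hG
  refine ⟨G', hG', hmax.1, fun u v huv hadj => ?_⟩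
  by_contra hc
  have hle : G' ⊔ edge u v ≤ G' := hmax.2 hc le_sup_left
  exact hadj (hle (Or.inr (by simp [edge_adj, huv])))

/-- Splitting off a union of components that are copies of `T`. -/
theorem nonempty_iso_sum_copies {V U W : Type*} {G : SimpleGraph V} {T : SimpleGraph W}
    (ι : U × W → V) (hι : Function.Injective ι)
    (h : ∀ i a z, G.Adj (ι (i, a)) z ↔ ∃ b, z = ι (i, b) ∧ T.Adj a b) :
    Nonempty (G.induce (Set.range ι)ᶜ ⊕g copies U T ≃g G) := by
  classical
  let f : ((Set.range ι)ᶜ : Set V) ⊕ (U × W) → V := Sum.elim Subtype.val ι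
  have hf : Function.Bijective f := by
    constructor
    · rintro (x | x) (y | y) hxy
      · exact congrArg _ (Subtype.ext hxy)
      · exact absurd ⟨y, hxy.symm⟩ x.2
      · exact absurd ⟨x, hxy⟩ y.2
      · exact congrArg _ (hι hxy)
    · intro v
      by_cases hv : v ∈ Set.range ι
      · obtain ⟨x, rfl⟩ := hv
        exact ⟨.inr x, rfl⟩
      · exact ⟨.inl ⟨v, hv⟩, rfl⟩
  refine ⟨⟨Equiv.ofBijective f hf, ?_⟩⟩
  rintro (x | ⟨i, a⟩) (y | ⟨j, b⟩)
  · exact Iff.rfl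
  · change G.Adj x.1 (ι (j, b)) ↔ _
    simp only [not_adj_sum_inl_inr, iff_false]
    intro hadj
    obtain ⟨c, hc, -⟩ := (h j b x.1).1 hadj.symm
    exact x.2 ⟨_, hc.symm⟩
  · change G.Adj (ι (i, a)) y.1 ↔ _
    rw [adj_comm (G.induce _ ⊕g copies U T)]
    simp only [not_adj_sum_inl_inr, iff_false]
    intro hadj
    obtain ⟨c, hc, -⟩ := (h i a y.1).1 hadj
    exact y.2 ⟨_, hc.symm⟩
  · change G.Adj (ι (i, a)) (ι (j, b)) ↔ _
    rw [h]
    simp only [sum_adj_inr, copies_adj]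
    constructor
    · rintro ⟨c, hc, hadj⟩
      have := hι hc
      simp only [Prod.mk.injEq] at this
      exact ⟨this.1.symm, this.2 ▸ hadj⟩
    · rintro ⟨rfl, hadj⟩
      exact ⟨b, rfl, hadj⟩

section Shift

variable {𝓕 : Set FinGraph} {A J W : Type} {H : SimpleGraph A} {T : SimpleGraph W} {ℓ : W}

/-- If a vertex of `T - ℓ` is joined to the same vertex of many copies of `T`, then two copies of `T`
joined by an edge can be found. -/
theorem isContained_of_fits (G : SimpleGraph ((A ⊕ (J × W)) ⊕ {w : W // w ≠ ℓ}))
    (hG : (H ⊕g copies J T) ⊕g T.induce {w | w ≠ ℓ} ≤ G)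
    {y x : W} {v : {w : W // w ≠ ℓ}} {br : W → Option W} {g : W → W}
    (h1 : ∀ u, T.Adj y u → (br u ≠ none → g u = x) ∧ (br u = none → T.Adj v.1 (g u)))
    (h2 : ∀ u w, u ≠ y → w ≠ y → T.Adj u w → br u = br w ∧ T.Adj (g u) (g w))
    (h3 : ∀ u w, u ≠ y → w ≠ y → u ≠ w → br u = br w → g u ≠ g w)
    (h4 : ∀ u, u ≠ y → br u = none → g u ≠ ℓ ∧ g u ≠ v.1)
    (ι : Option W ↪ J) (hι : ∀ o, G.Adj (.inr v) (.inl (.inr (ι o, x)))) :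
    ((H ⊕g copies (Fin 2) T) ⊔ edge (.inr (0, y)) (.inr (1, x))) ⊕g
      copies {j // j ∉ Set.range ι} T ⊑ G := by
  classical
  -- The default value at `ℓ` is irrelevant: by `h4`, no vertex is sent to `ℓ`.
  let τ : W → {w : W // w ≠ ℓ} := fun w => if h : w ≠ ℓ then ⟨w, h⟩ else v
  have hτ : ∀ w, w ≠ ℓ → (τ w).1 = w := fun w hw => by simp [τ, hw]
  -- The first copy of `T`: `y` goes to `v`, and each remaining vertex goes into T - ℓ or into the
  -- attached copy with its label. The copy `ι none` is kept as the second one, joined to `v` at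
  -- `x`.
  let φ : W → (A ⊕ (J × W)) ⊕ {w : W // w ≠ ℓ} := fun u =>
    if u = y then .inr v else
      match br u with
      | none => .inr (τ (g u))
      | some l => .inl (.inr (ι (some l), g u))
  have φy : φ y = .inr v := by simp [φ]
  have φn : ∀ {u}, u ≠ y → br u = none → φ u = .inr (τ (g u)) := fun {u} hu hb => by
    simp [φ, hu, hb]
  have φs : ∀ {u l}, u ≠ y → br u = some l → φ u = .inl (.inr (ι (some l), g u)) :=
    fun {u l} hu hb => by simp [φ, hu, hb]
  let f : (A ⊕ (Fin 2 × W)) ⊕ ({j // j ∉ Set.range ι} × W) → (A ⊕ (J × W)) ⊕ {w : W // w ≠ ℓ} :=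
    Sum.elim (Sum.elim (fun a => .inl (.inl a))
      (fun p => if p.1 = 0 then φ p.2 else .inl (.inr (ι none, p.2))))
      (fun p => .inl (.inr (p.1.1, p.2)))
  have f0 : ∀ u, f (.inl (.inr (0, u))) = φ u := fun u => rfl
  have f1 : ∀ u, f (.inl (.inr (1, u))) = .inl (.inr (ι none, u)) := fun u => rfl
  have φadj_y : ∀ u, T.Adj y u → G.Adj (φ y) (φ u) := by
    intro u hu
    rw [φy]
    cases hb : br u with
    | none =>
      rw [φn hu.ne' hb]
      apply hG
      simp only [sum_adj_inr, comap_adj, Function.Embedding.subtype_apply]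
      rw [hτ _ (h4 u hu.ne' hb).1]
      exact (h1 u hu).2 hb
    | some l =>
      rw [φs hu.ne' hb, (h1 u hu).1 (by simp [hb])]
      exact hι _
  have φadj : ∀ u w, T.Adj u w → G.Adj (φ u) (φ w) := by
    intro u w huw
    by_cases hu : u = y
    · subst hu; exact φadj_y w huw
    by_cases hw : w = y
    · subst hw; exact (φadj_y u huw.symm).symm
    obtain ⟨hb, hg⟩ := h2 u w hu hw huw
    cases hbu : br u with
    | none =>
      rw [φn hu hbu, φn hw (hb ▸ hbu)]
      apply hG
      simp only [sum_adj_inr, comap_adj, Function.Embedding.subtype_apply]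
      rwa [hτ _ (h4 u hu hbu).1, hτ _ (h4 w hw (hb ▸ hbu)).1]
    | some l =>
      rw [φs hu hbu, φs hw (hb ▸ hbu)]
      apply hG
      simpa using hg
  have φinj : Function.Injective φ := by
    have hy : ∀ u, φ u = φ y → u = y := by
      intro u huy
      by_contra hu
      rw [φy] at huy
      cases hb : br u with
      | none =>
        rw [φn hu hb] at huy
        have := congrArg Subtype.val (Sum.inr_injective huy)
        rw [hτ _ (h4 u hu hb).1] at this
        exact (h4 u hu hb).2 this
      | some l => rw [φs hu hb] at huy; simp at huy
    intro u w huw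
    by_cases hw : w = y
    · subst hw; exact hy u huw
    by_cases hu : u = y
    · subst hu; exact (hy w huw.symm).symm
    by_contra hne
    have h5 := h3 u w hu hw hne
    cases hbu : br u with
    | none =>
      cases hbw : br w with
      | none =>
        rw [φn hu hbu, φn hw hbw] at huw
        have := congrArg Subtype.val (Sum.inr_injective huw)
        rw [hτ _ (h4 u hu hbu).1, hτ _ (h4 w hw hbw).1] at this
        exact h5 (hbu.trans hbw.symm) this
      | some l => rw [φn hu hbu, φs hw hbw] at huw; simp at huw
    | some l =>
      cases hbw : br w with
      | none => rw [φs hu hbu, φn hw hbw] at huw; simp at huw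
      | some l' =>
        rw [φs hu hbu, φs hw hbw] at huw
        simp only [Sum.inl.injEq, Sum.inr.injEq, Prod.mk.injEq, ι.injective.eq_iff,
          Option.some.injEq] at huw
        exact h5 (by rw [hbu, hbw, huw.1]) huw.2
  have φA : ∀ u a, φ u ≠ .inl (.inl a) := by
    intro u a hua
    by_cases hu : u = y
    · subst hu; rw [φy] at hua; simp at hua
    · cases hb : br u with
      | none => rw [φn hu hb] at hua; simp at hua
      | some l => rw [φs hu hb] at hua; simp at hua
  have φJ : ∀ u j w, φ u = .inl (.inr (j, w)) → ∃ l, j = ι (some l) := by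
    intro u j w hua
    by_cases hu : u = y
    · subst hu; rw [φy] at hua; simp at hua
    · cases hb : br u with
      | none => rw [φn hu hb] at hua; simp at hua
      | some l =>
        rw [φs hu hb] at hua
        simp only [Sum.inl.injEq, Sum.inr.injEq, Prod.mk.injEq] at hua
        exact ⟨l, hua.1.symm⟩
  have fin2 : ∀ i : Fin 2, i = 0 ∨ i = 1 := by decide
  refine ⟨⟨⟨f, ?_⟩, ?_⟩⟩
  · rintro ((a | ⟨i, u⟩) | ⟨j, u⟩) ((b | ⟨i', w⟩) | ⟨j', w⟩) hadj
    · apply hG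
      simpa [edge_adj, f] using hadj
    · simp [edge_adj] at hadj
    · simp at hadj
    · simp [edge_adj] at hadj
    · simp only [sum_adj_inl, sup_adj, sum_adj_inr, copies_adj, edge_adj, Sum.inr.injEq,
        Prod.mk.injEq] at hadj
      rcases hadj with ⟨h, hadj⟩ | ⟨⟨⟨h, h'⟩, h'', h'''⟩ | ⟨⟨h, h'⟩, h'', h'''⟩, -⟩
      · subst h
        rcases fin2 i with rfl | rfl
        · exact φadj u w hadj
        · rw [f1, f1]
          apply hG
          simpa using hadj
      · subst h h' h'' h'''
        rw [f0, f1, φy]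
        exact hι none
      · subst h h' h'' h'''
        rw [f0, f1, φy]
        exact (hι none).symm
    · simp at hadj
    · simp at hadj
    · simp at hadj
    · apply hG
      simpa [f, Subtype.ext_iff] using hadj
  · have key : ∀ i u j w, f (.inl (.inr (i, u))) = .inl (.inr (j, w)) → j ∈ Set.range ι := by
      intro i u j w h
      rcases fin2 i with rfl | rfl
      · obtain ⟨l, hl⟩ := φJ _ _ _ h
        exact ⟨_, hl.symm⟩
      · rw [f1] at h
        simp only [Sum.inl.injEq, Sum.inr.injEq, Prod.mk.injEq] at h
        exact ⟨_, h.1⟩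
    have keyA : ∀ i u a, f (.inl (.inr (i, u))) ≠ .inl (.inl a) := by
      intro i u a
      rcases fin2 i with rfl | rfl
      · exact φA u a
      · rw [f1]; simp
    rintro ((a | ⟨i, u⟩) | ⟨j, u⟩) ((b | ⟨i', w⟩) | ⟨j', w⟩) hfe
    · simpa [f] using hfe
    · exact absurd hfe.symm (keyA _ _ _)
    · simp [f] at hfe
    · exact absurd hfe (keyA _ _ _)
    · rcases fin2 i with rfl | rfl <;> rcases fin2 i' with rfl | rfl
      · exact congrArg (fun u => Sum.inl (Sum.inr (0, u))) (φinj hfe)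
      · obtain ⟨l, hl⟩ := φJ _ _ _ hfe
        exact absurd (ι.injective hl) (by simp)
      · obtain ⟨l, hl⟩ := φJ _ _ _ hfe.symm
        exact absurd (ι.injective hl) (by simp)
      · have h := (f1 u).symm.trans (hfe.trans (f1 w))
        simpa using h
    · exact absurd (key _ _ _ _ hfe) j'.2
    · simp [f] at hfe
    · exact absurd (key _ _ _ _ hfe.symm) j.2
    · simpa [f, Subtype.ext_iff] using hfe

end Shift

/-- Saturating `H` plus many copies of `T` plus T - ℓ changes the order by r - 1 modulo r. The point
is that the edges added leave enough copies of `T` as components. -/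
theorem sub_one_mem_satClasses {𝓕 : Set FinGraph} {K : ℕ → ℕ} (hK : IsAbsorbing 𝓕 K) {r : ℕ}
    (hfit : ∀ T : SimpleGraph (Fin r), T.IsTree → HasFittingVertex T) {C : ZMod r}
    (hC : C ∈ satClasses 𝓕 K r) : C - 1 ∈ satClasses 𝓕 K r := by
  classical
  obtain ⟨T, hT, a, H, rfl, hs⟩ := hC
  obtain ⟨ℓ, hℓ⟩ := hfit T hT
  have hr : 1 ≤ r := ℓ.pos
  -- At most r³ copies will be touched, leaving `K r + 2`; moreover, `K r` copies must remain when r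
  -- + 1 are used up.
  let m := r ^ 3 + r + K r + 4
  have hsJ : ∀ {J : Type} [Fintype J], K r + 2 ≤ Fintype.card J →
      IsSaturated 𝓕 (H ⊕g copies J T) := fun {J} _ hJ =>
    isSaturated_sum_copies_congr (K := K r) (hK r T hT.2) (by simp) hJ hs
  have hsm : IsSaturated 𝓕 (H ⊕g copies (Fin m) T) := hsJ (by simp only [Fintype.card_fin]; omega)
  -- T - ℓ is part of one more copy of `T`, and `H` with m + 1 copies contains no member.
  have hfree : ¬ ContainsMember 𝓕 ((H ⊕g copies (Fin m) T) ⊕g T.induce {w | w ≠ ℓ}) := by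
    intro hc
    refine (hsJ (J := Fin m ⊕ Unit) (by simp; omega)).1 (hc.mono ?_)
    let f : (Fin a ⊕ (Fin m × Fin r)) ⊕ {w | w ≠ ℓ} → Fin a ⊕ ((Fin m ⊕ Unit) × Fin r) :=
      Sum.elim (Sum.elim .inl (fun p => .inr (.inl p.1, p.2))) (fun w => .inr (.inr (), w.1))
    refine ⟨⟨⟨f, ?_⟩, ?_⟩⟩
    · rintro ((x | ⟨i, x⟩) | ⟨x, hx⟩) ((y | ⟨j, y⟩) | ⟨y, hy⟩) h <;>
        first | (simp at h; done) | simpa [f] using h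
    · rintro ((x | ⟨i, x⟩) | ⟨x, hx⟩) ((y | ⟨j, y⟩) | ⟨y, hy⟩) h <;>
        first | (simp [f] at h; done) | simpa [f] using h
  obtain ⟨G, hle, hG⟩ := exists_isSaturated_ge hfree
  -- The old part was already saturated, so it receives no new edge.
  have hold : ∀ x y, G.Adj (.inl x) (.inl y) → (H ⊕g copies (Fin m) T).Adj x y := by
    intro x y hxy
    by_contra hn
    have hne : x ≠ y := fun h => hxy.ne (congrArg _ h)
    refine hG.1 ((hsm.2 x y hne hn).mono ⟨⟨⟨Sum.inl, ?_⟩, Sum.inl_injective⟩⟩)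
    intro u v huv
    rcases huv with huv | huv
    · exact hle (by simpa using huv)
    · rw [edge_adj] at huv
      rcases huv.1 with ⟨rfl, rfl⟩ | ⟨rfl, rfl⟩
      · exact hxy
      · exact hxy.symm
  -- With r + 1 attached copies, one for each label and one more, two copies of `T` joined by an
  -- edge appear next to `H` and at least `K r` free copies. By saturation of the original graph,
  -- this contains a member.
  have hfew : ∀ (v : {w // w ≠ ℓ}) (x : Fin r),
      (Finset.univ.filter fun j : Fin m => G.Adj (.inr v) (.inl (.inr (j, x)))).card ≤ r := by
    intro v x
    by_contra hcard
    push Not at hcard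
    obtain ⟨ι⟩ : Nonempty (Option (Fin r) ↪
        {j : Fin m // G.Adj (.inr v) (.inl (.inr (j, x)))}) :=
      Function.Embedding.nonempty_of_card_le (by
        rw [Fintype.card_subtype]; simpa using hcard)
    obtain ⟨y, br, g, h1, h2, h3, h4⟩ := hℓ v.1 v.2 x
    have hc := isContained_of_fits (H := H) G hle h1 h2 h3 h4
      (ι.trans (Function.Embedding.subtype _)) (fun o => (ι o).2)
    have hle' : K r ≤ Fintype.card
        {j // j ∉ Set.range (ι.trans (Function.Embedding.subtype _))} := by
      have h5 := Fintype.card_subtype_compl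
        (fun j => j ∈ Set.range (ι.trans (Function.Embedding.subtype _)))
      have h6 : Fintype.card {j // j ∈ Set.range (ι.trans (Function.Embedding.subtype _))} =
          r + 1 := by
        have := Set.card_range_of_injective (ι.trans (Function.Embedding.subtype _)).injective
        rw [Fintype.card_option, Fintype.card_fin] at this
        exact this
      rw [h5, h6, Fintype.card_fin]
      omega
    refine hG.1 (ContainsMember.mono ?_ hc)
    refine hK r T hT.2 (I := Fin (K r)) _ (by simpa using hle') ?_
    refine ((isSaturated_sum_copies_iff (m := K r) H T (by simp)).1 hs).2 _ _ (by simp) (by simp)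
  -- The untouched copies; there are at most r · r pairs (v, x), and each spoils at most r copies.
  let U := {j : Fin m // ∀ v x, ¬ G.Adj (.inr v) (.inl (.inr (j, x)))}
  have hU : K r + 2 ≤ Fintype.card U := by
    have h1 : Fintype.card {j : Fin m // ¬ ∀ v x, ¬ G.Adj (.inr v) (.inl (.inr (j, x)))} ≤ r ^ 3 := by
      rw [Fintype.card_subtype]
      have hsub : (Finset.univ.filter fun j : Fin m =>
          ¬ ∀ v x, ¬ G.Adj (.inr v) (.inl (.inr (j, x)))) ⊆
          (Finset.univ : Finset ({w // w ≠ ℓ} × Fin r)).biUnion fun p =>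
            Finset.univ.filter fun j : Fin m => G.Adj (.inr p.1) (.inl (.inr (j, p.2))) := by
        intro j hj
        simp only [Finset.mem_filter, Finset.mem_univ, true_and, not_forall, not_not] at hj
        obtain ⟨v, x, h⟩ := hj
        simp only [Finset.mem_biUnion, Finset.mem_univ, Finset.mem_filter, true_and]
        exact ⟨(v, x), h⟩
      refine (Finset.card_le_card hsub).trans
        ((Finset.card_biUnion_le_card_mul _ _ r fun p _ => hfew p.1 p.2).trans ?_)
      have h2 : Fintype.card {w : Fin r // w ≠ ℓ} ≤ r := by
        simp
      rw [Finset.card_univ, Fintype.card_prod, Fintype.card_fin, pow_succ, sq]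
      gcongr
    have h2 := Fintype.card_subtype_compl
      (fun j : Fin m => ∀ v x, ¬ G.Adj (.inr v) (.inl (.inr (j, x))))
    rw [h2, Fintype.card_fin] at h1
    change _ - Fintype.card U ≤ _ at h1
    omega
  obtain ⟨e⟩ := nonempty_iso_sum_copies (G := G) (T := T)
    (fun p : U × Fin r => .inl (.inr (p.1.1, p.2))) (by
      rintro ⟨⟨i, hi⟩, x⟩ ⟨⟨j, hj⟩, y⟩ h
      simp only [Sum.inl.injEq, Sum.inr.injEq, Prod.mk.injEq] at h
      obtain ⟨rfl, rfl⟩ := h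
      rfl) (by
      rintro ⟨i, hi⟩ x ((z | ⟨j, z⟩) | z)
      · simp only [reduceCtorEq, false_and, exists_false, iff_false, Sum.inl.injEq]
        intro h
        have := hold _ _ h.symm
        simp at this
      · simp only [Sum.inl.injEq, Sum.inr.injEq, Prod.mk.injEq]
        constructor
        · intro h
          have := hold _ _ h
          simp only [sum_adj_inr, copies_adj] at this
          exact ⟨z, ⟨this.1.symm, rfl⟩, this.2⟩
        · rintro ⟨b, ⟨rfl, rfl⟩, h⟩
          exact hle (by simpa using h)
      · simp only [reduceCtorEq, false_and, exists_false, iff_false]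
        intro h
        exact hi _ _ h.symm)
  set X := (Set.range fun p : U × Fin r =>
    (Sum.inl (.inr (p.1.1, p.2)) : (Fin a ⊕ (Fin m × Fin r)) ⊕ {w // w ≠ ℓ}))ᶜ
  clear_value X
  have := Fintype.ofFinite X
  have hcard : Fintype.card X + Fintype.card U * r = a + m * r + (r - 1) := by
    have h1 := Nat.card_congr e.toEquiv
    have h2 : Fintype.card {w : Fin r // w ≠ ℓ} = r - 1 := by simp
    rw [Nat.card_sum, Nat.card_prod, Nat.card_eq_fintype_card (α := U),
      Nat.card_eq_fintype_card (α := X), Nat.card_sum, Nat.card_sum, Nat.card_prod, Nat.card_fin,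
      Nat.card_fin, Nat.card_fin] at h1
    rw [h1, ← h2, ← Nat.card_eq_fintype_card]
    rfl
  refine ⟨T, hT, Fintype.card X, (G.induce X).overFin rfl, ?_, ?_⟩
  · have h1 := congrArg (fun n : ℕ => (n : ZMod r)) hcard
    simp only [Nat.cast_add, Nat.cast_mul, CharP.cast_eq_zero, mul_zero, add_zero,
      Nat.cast_sub hr, Nat.cast_one, zero_sub] at h1
    rw [h1, sub_eq_add_neg]
  · have e' : (G.induce X).overFin rfl ⊕g copies U T ≃g G :=
      (Iso.sumCongr ((G.induce X).overFinIso rfl).symm Iso.refl).trans e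
    exact isSaturated_sum_copies_congr (K := K r) (hK r T hT.2) hU (by simp) (hG.iso e'.symm)

/-- Repeated subtraction of 1 from one class reaches all classes. -/
theorem noneOrAllSmall_satClasses {𝓕 : Set FinGraph} {K : ℕ → ℕ} (hK : IsAbsorbing 𝓕 K) :
    NoneOrAllSmall (satClasses 𝓕 K) := by
  intro r hr
  rcases Set.eq_empty_or_nonempty (satClasses 𝓕 K r) with h | ⟨C, hC⟩
  · exact Or.inl h
  right
  by_cases hr1 : r = 1
  · subst hr1
    exact Set.eq_univ_of_forall fun D => Subsingleton.elim C D ▸ hC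
  have hr' : r ∈ ({2, 3, 4, 5, 7} : Set ℕ) := by
    simp only [Set.mem_insert_iff, Set.mem_singleton_iff] at hr ⊢
    tauto
  have : NeZero r := ⟨by rintro rfl; simp at hr⟩
  have key : ∀ j : ℕ, C - j ∈ satClasses 𝓕 K r := by
    intro j
    induction j with
    | zero => simpa using hC
    | succ j ih =>
      have := sub_one_mem_satClasses hK (fun T hT => hasFittingVertex_of_small hr' hT) ih
      rwa [sub_sub, ← Nat.cast_succ] at this
  refine Set.eq_univ_of_forall fun D => ?_
  have := key (C - D).val
  rwa [ZMod.natCast_zmod_val, sub_sub_cancel] at this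

theorem exists_satClasses {𝓕 : Set FinGraph} (h𝓕 : IsAdmissible 𝓕) (hq : IsQuasiFinite 𝓕) :
    ∃ (S : (r : ℕ) → Set (ZMod r)) (k : (r : ℕ) → ZMod r → ℤ),
      (∀ r : ℕ, 1 ≤ r → ∀ C ∈ S r, ∃ N : ℕ, ∀ n : ℕ, N ≤ n → (n : ZMod r) = C →
        n ∈ avoidsBelow S r →
          (sat n 𝓕 : ℝ) = (((r : ℝ) - 1) * (n : ℝ) + (k r C : ℝ)) / (r : ℝ)) ∧
      SatAtLeastLinear 𝓕 (uncovered S) ∧ NoneOrAllSmall S := by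
  classical
  obtain ⟨K, hK⟩ := exists_absorbing hq
  have hK : IsAbsorbing 𝓕 K := hK
  refine ⟨satClasses 𝓕 K, fun r C => if h : 1 ≤ r ∧ C ∈ satClasses 𝓕 K r then
    (exists_eventually_eq h𝓕 hK h.1 h.2).choose else 0, fun r hr C hC => ?_,
    satAtLeastLinear_uncovered h𝓕 K, noneOrAllSmall_satClasses hK⟩
  dsimp only
  rw [dif_pos ⟨hr, hC⟩]
  exact (exists_eventually_eq h𝓕 hK hr hC).choose_spec

/-! ### Subgraphs given by maps, and cycles. -/

/-- `f` exhibits `T` as a subgraph of `G`. -/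
structure IsSub {W V : Type*} (T : SimpleGraph W) (G : SimpleGraph V) (f : W → V) : Prop where
  inj : Function.Injective f
  adj : ∀ {a b}, T.Adj a b → G.Adj (f a) (f b)

namespace IsSub

variable {U V W : Type*} {T : SimpleGraph W} {G : SimpleGraph V} {f : W → V}

theorem comp {G' : SimpleGraph U} {φ : V → U} (hφ : IsSub G G' φ) (hf : IsSub T G f) :
    IsSub T G' (φ ∘ f) :=
  ⟨hφ.inj.comp hf.inj, fun h => hφ.adj (hf.adj h)⟩

theorem restrict (hf : IsSub T G f) {s : Set V} (hs : ∀ a, f a ∈ s) :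
    IsSub T (G.induce s) (fun a => ⟨f a, hs a⟩) :=
  ⟨fun _ _ h => hf.inj (congrArg Subtype.val h), fun h => hf.adj h⟩

theorem reachable (hf : IsSub T G f) {a b : W} (h : T.Reachable a b) : G.Reachable (f a) (f b) :=
  h.map ⟨f, hf.adj⟩

theorem ofCopy (f : Copy T G) : IsSub T G f := ⟨f.injective, fun h => f.toHom.map_adj h⟩

/-- A subset closed under adjacency that contains one vertex of a connected subgraph contains all
of them. -/
theorem mem_of_closed (hf : IsSub T G f) (hT : T.Preconnected) {s : Set V}
    (hs : ∀ a b, a ∈ s → G.Adj a b → b ∈ s) {a : W} (ha : f a ∈ s) (b : W) : f b ∈ s := by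
  obtain ⟨p⟩ := hT a b
  induction p with
  | nil => exact ha
  | cons h p ih => exact ih (hs _ _ ha (hf.adj h))

end IsSub

/-- The cycle of length `h`. -/
def cyc (h : ℕ) : SimpleGraph (ZMod h) where
  Adj i j := (j = i + 1 ∨ i = j + 1) ∧ i ≠ j
  symm.symm _ _ h := ⟨h.1.symm, h.2.symm⟩
  loopless := ⟨fun _ h => h.2 rfl⟩

theorem ZMod.natCast_ne_zero_of_lt {h a : ℕ} (ha : 0 < a) (hah : a < h) : (a : ZMod h) ≠ 0 := by
  rw [Ne, ZMod.natCast_eq_zero_iff]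
  exact fun hd => absurd (Nat.le_of_dvd ha hd) (by omega)

theorem ZMod.add_one_ne_self {h : ℕ} (hh : 3 ≤ h) (i : ZMod h) : i + 1 ≠ i := by
  have := ZMod.natCast_ne_zero_of_lt (h := h) (a := 1) (by omega) (by omega)
  simpa using this

theorem ZMod.add_one_ne_sub_one {h : ℕ} (hh : 3 ≤ h) (i : ZMod h) : i + 1 ≠ i - 1 := by
  have := ZMod.natCast_ne_zero_of_lt (h := h) (a := 2) (by omega) (by omega)
  intro he
  apply this
  have : (i + 1) - (i - 1) = 0 := sub_eq_zero.2 he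
  rw [← this]
  push_cast
  ring

theorem cyc_adj_add_one {h : ℕ} (hh : 3 ≤ h) (i : ZMod h) : (cyc h).Adj i (i + 1) :=
  ⟨Or.inl rfl, (ZMod.add_one_ne_self hh i).symm⟩

theorem cyc_adj_sub_one {h : ℕ} (hh : 3 ≤ h) (i : ZMod h) : (cyc h).Adj i (i - 1) := by
  have := (cyc_adj_add_one hh (i - 1)).symm
  rwa [sub_add_cancel] at this

theorem cyc_adj_iff {h : ℕ} (hh : 3 ≤ h) {i j : ZMod h} :
    (cyc h).Adj i j ↔ j = i + 1 ∨ j = i - 1 := by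
  constructor
  · rintro ⟨h | h, -⟩
    · exact Or.inl h
    · exact Or.inr (by rw [h, add_sub_cancel_right])
  · rintro (rfl | rfl)
    · exact cyc_adj_add_one hh i
    · exact cyc_adj_sub_one hh i

theorem cyc_preconnected {h : ℕ} (hh : 3 ≤ h) : (cyc h).Preconnected := by
  have : NeZero h := ⟨by omega⟩
  have key : ∀ (i : ZMod h) (m : ℕ), (cyc h).Reachable i (i + m) := by
    intro i m
    induction m with
    | zero => simp
    | succ m ih =>
      have h1 := (cyc_adj_add_one hh (i + m)).reachable
      rw [add_assoc, ← Nat.cast_succ] at h1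
      exact ih.trans h1
  intro i j
  have := key i (j - i).val
  rwa [ZMod.natCast_zmod_val, add_sub_cancel] at this

theorem ncard_edgeSet_cyc_le {h : ℕ} (hh : 3 ≤ h) : (cyc h).edgeSet.ncard ≤ h := by
  have : NeZero h := ⟨by omega⟩
  have hsub : (cyc h).edgeSet ⊆ (fun i : ZMod h => s(i, i + 1)) '' Set.univ := by
    intro e
    induction e using Sym2.ind with
    | _ i j =>
      intro he
      rw [mem_edgeSet] at he
      obtain ⟨rfl | rfl, -⟩ := he
      · exact ⟨i, trivial, rfl⟩
      · exact ⟨j, trivial, Sym2.eq_swap⟩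
  refine (Set.ncard_le_ncard hsub (Set.toFinite _)).trans ((Set.ncard_image_le).trans ?_)
  rw [Set.ncard_univ, Nat.card_zmod]

theorem isSub_cyc {h : ℕ} {V : Type*} {G : SimpleGraph V} {c : ZMod h → V}
    (hinj : Function.Injective c) (hadj : ∀ i, G.Adj (c i) (c (i + 1))) : IsSub (cyc h) G c := by
  refine ⟨hinj, ?_⟩
  rintro i j ⟨rfl | rfl, -⟩
  · exact hadj i
  · exact (hadj j).symm

/-- Three pairwise adjacent vertices form a cycle. -/
theorem isSub_cyc_three {V : Type*} {G : SimpleGraph V} {a b c : V} (hab : G.Adj a b)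
    (hbc : G.Adj b c) (hca : G.Adj c a) : ∃ f, IsSub (cyc 3) G f := by
  refine ⟨(![a, b, c] : Fin 3 → V), isSub_cyc (h := 3) (V := V) (G := G) ?_ ?_⟩
  · change Function.Injective (![a, b, c] : Fin 3 → V)
    intro i j hij
    have h1 := hab.ne
    have h2 := hbc.ne
    have h3 := hca.ne
    fin_cases i <;> fin_cases j <;> simp_all
  · change ∀ i : Fin 3, G.Adj ((![a, b, c] : Fin 3 → V) i) ((![a, b, c] : Fin 3 → V) (i + 1))
    intro i
    fin_cases i
    exacts [hab, hbc, hca]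

theorem isSub_cyc_four {V : Type*} {G : SimpleGraph V} {a b c d : V} (hab : G.Adj a b)
    (hbc : G.Adj b c) (hcd : G.Adj c d) (hda : G.Adj d a) (hac : a ≠ c) (hbd : b ≠ d) :
    ∃ f, IsSub (cyc 4) G f := by
  refine ⟨(![a, b, c, d] : Fin 4 → V), isSub_cyc (h := 4) (V := V) (G := G) ?_ ?_⟩
  · change Function.Injective (![a, b, c, d] : Fin 4 → V)
    intro i j hij
    have h1 := hab.ne
    have h2 := hbc.ne
    have h3 := hcd.ne
    have h4 := hda.ne
    fin_cases i <;> fin_cases j <;> simp_all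
  · change ∀ i : Fin 4, G.Adj ((![a, b, c, d] : Fin 4 → V) i) ((![a, b, c, d] : Fin 4 → V) (i + 1))
    intro i
    fin_cases i
    exacts [hab, hbc, hcd, hda]

/-- A graph whose vertices are ranked in such a way that every vertex has at most one neighbour of
smaller rank, and none of the same rank, has no cycles. -/
theorem not_isSub_cyc_of_rank {V : Type*} {G : SimpleGraph V} (rk : V → ℕ)
    (hne : ∀ a b, G.Adj a b → rk a ≠ rk b)
    (huniq : ∀ x a b, G.Adj x a → G.Adj x b → rk a < rk x → rk b < rk x → a = b)
    {h : ℕ} (hh : 3 ≤ h) {c : ZMod h → V} : ¬ IsSub (cyc h) G c := by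
  intro hc
  have : NeZero h := ⟨by omega⟩
  -- Both neighbours on the cycle of a vertex of maximal rank have smaller rank, so they would
  -- coincide.
  obtain ⟨i, -, hi⟩ := Finset.exists_max_image Finset.univ (fun i => rk (c i)) ⟨0, Finset.mem_univ _⟩
  have key : ∀ j, (cyc h).Adj i j → rk (c j) < rk (c i) := fun j hj =>
    lt_of_le_of_ne (hi j (Finset.mem_univ _)) (hne _ _ (hc.adj hj)).symm
  have h1 := cyc_adj_add_one hh i
  have h2 := cyc_adj_sub_one hh i
  exact ZMod.add_one_ne_sub_one hh i
    (hc.inj (huniq _ _ _ (hc.adj h1) (hc.adj h2) (key _ h1) (key _ h2)))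

/-- A new edge between two components is in no cycle. -/
theorem IsSub.cyc_of_sup_edge {V : Type*} {G : SimpleGraph V} {u v : V} (huv : ¬ G.Reachable u v)
    {h : ℕ} (hh : 3 ≤ h) {c : ZMod h → V} (hc : IsSub (cyc h) (G ⊔ edge u v) c) :
    IsSub (cyc h) G c := by
  have hN : NeZero h := ⟨by omega⟩
  refine isSub_cyc hc.inj fun i => ?_
  by_contra hn
  -- The cycle uses the new edge at most once, so the rest of it is a path in `G` between the ends
  -- of that edge.
  have hadj : ∀ j, j ≠ i → G.Adj (c j) (c (j + 1)) := by
    intro j hj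
    by_contra hn'
    have h1 := (hc.adj (cyc_adj_add_one hh i)).resolve_left hn
    have h2 := (hc.adj (cyc_adj_add_one hh j)).resolve_left hn'
    rw [edge_adj] at h1 h2
    have key : c j = c (i + 1) → c (j + 1) = c i → False := by
      intro h3 h4
      have e1 := hc.inj h3
      have e2 := hc.inj h4
      rw [e1, add_assoc, add_eq_left] at e2
      apply ZMod.natCast_ne_zero_of_lt (h := h) (a := 2) (by omega) (by omega)
      rw [← e2]
      norm_num
    rcases h1.1 with ⟨h1, h1'⟩ | ⟨h1, h1'⟩ <;> rcases h2.1 with ⟨h2, h2'⟩ | ⟨h2, h2'⟩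
    · exact hj (hc.inj (h2.trans h1.symm))
    · exact key (h2.trans h1'.symm) (h2'.trans h1.symm)
    · exact key (h2.trans h1'.symm) (h2'.trans h1.symm)
    · exact hj (hc.inj (h2.trans h1.symm))
  have hreach : ∀ m : ℕ, m < h → G.Reachable (c (i + 1)) (c (i + 1 + m)) := by
    intro m
    induction m with
    | zero => simp
    | succ m ih =>
      intro hm
      refine (ih (by omega)).trans ?_
      have := (hadj (i + 1 + m) ?_).reachable
      · rwa [add_assoc (i + 1), ← Nat.cast_succ] at this
      · intro he
        have h0 := ZMod.natCast_ne_zero_of_lt (h := h) (a := m + 1) (by omega) (by omega)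
        apply h0
        rw [add_assoc, add_eq_left] at he
        rw [← he]
        push_cast
        ring
  have hr := hreach (h - 1) (by omega)
  rw [Nat.cast_sub (by omega), Nat.cast_one, CharP.cast_eq_zero, zero_sub, add_neg_cancel_right] at hr
  have h1 := (hc.adj (cyc_adj_add_one hh i)).resolve_left hn
  rw [edge_adj] at h1
  rcases h1.1 with ⟨h1, h2⟩ | ⟨h1, h2⟩
  · rw [h1, h2] at hr; exact huv hr.symm
  · rw [h1, h2] at hr; exact huv hr

/-! ### Spiders and vertices of degree at least three. -/

/-- The vertices of a spider: a centre, `D` arms, and two leaves attached to each of the first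
`k` arms. -/
abbrev SpiderVertex (k D : ℕ) : Type := Unit ⊕ Fin D ⊕ (Fin k × Fin 2)

namespace SpiderVertex

variable {k D : ℕ}

/-- The centre. -/
abbrev centre : SpiderVertex k D := .inl ()

/-- The arms. -/
abbrev arm (i : Fin D) : SpiderVertex k D := .inr (.inl i)

/-- The leaves attached to arms. -/
abbrev leaf (j : Fin k) (e : Fin 2) : SpiderVertex k D := .inr (.inr (j, e))

/-- The relation of being closer to the centre along an edge. -/
def Below : SpiderVertex k D → SpiderVertex k D → Prop
  | .inl _, .inr (.inl _) => True
  | .inr (.inl i), .inr (.inr p) => (i : ℕ) = p.1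
  | _, _ => False

/-- The distance from the centre. -/
def rank : SpiderVertex k D → ℕ
  | .inl _ => 0
  | .inr (.inl _) => 1
  | .inr (.inr _) => 2

theorem Below.rank_lt {a b : SpiderVertex k D} (h : Below a b) : rank a < rank b := by
  rcases a with a | a | a <;> rcases b with b | b | b <;> simp_all [Below, rank]

theorem Below.eq {a b x : SpiderVertex k D} (h : Below a x) (h' : Below b x) : a = b := by
  rcases a with a | a | a <;> rcases b with b | b | b <;> rcases x with x | x | x <;>
    simp_all [Below, Fin.ext_iff]

end SpiderVertex

open SpiderVertex in
/-- The spider with `D` arms, `k` of which carry two leaves. -/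
def spider (k D : ℕ) : SimpleGraph (SpiderVertex k D) where
  Adj a b := Below a b ∨ Below b a
  symm.symm _ _ h := h.symm
  loopless := ⟨fun _ h => by rcases h with h | h <;> exact absurd h.rank_lt (lt_irrefl _)⟩

section Spider

open SpiderVertex

variable {k D : ℕ}

theorem spider_adj_centre_arm (i : Fin D) : (spider k D).Adj centre (arm i) := Or.inl trivial

theorem spider_adj_arm_leaf (hk : k ≤ D) (j : Fin k) (e : Fin 2) :
    (spider k D).Adj (arm (j.castLE hk)) (leaf j e) := by
  left
  simp [Below]

theorem spider_rank_ne {a b : SpiderVertex k D} (h : (spider k D).Adj a b) : rank a ≠ rank b := by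
  rcases h with h | h
  · exact h.rank_lt.ne
  · exact h.rank_lt.ne'

theorem spider_unique {x a b : SpiderVertex k D} (ha : (spider k D).Adj x a)
    (hb : (spider k D).Adj x b) (ha' : rank a < rank x) (hb' : rank b < rank x) : a = b := by
  rcases ha with ha | ha
  · exact absurd ha.rank_lt (by omega)
  rcases hb with hb | hb
  · exact absurd hb.rank_lt (by omega)
  exact ha.eq hb

theorem spider_preconnected (hk : k ≤ D) : (spider k D).Preconnected := by
  have key : ∀ a, (spider k D).Reachable centre a := by
    rintro (a | i | ⟨j, e⟩)
    · exact Reachable.rfl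
    · exact (spider_adj_centre_arm i).reachable
    · exact (spider_adj_centre_arm _).reachable.trans (spider_adj_arm_leaf hk j e).reachable
  exact fun a b => (key a).symm.trans (key b)

theorem ncard_edgeSet_spider_le (hk : k ≤ D) : (spider k D).edgeSet.ncard ≤ D + 2 * k := by
  have hsub : (spider k D).edgeSet ⊆ Set.range (Sum.elim (fun i : Fin D => s(centre, arm i))
      (fun p : Fin k × Fin 2 => s(arm (p.1.castLE hk), leaf p.1 p.2))) := by
    have key : ∀ a b : SpiderVertex k D, Below a b →
        s(a, b) ∈ Set.range (Sum.elim (fun i : Fin D => s(centre, arm i))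
          (fun p : Fin k × Fin 2 => s(arm (p.1.castLE hk), leaf p.1 p.2))) := by
      rintro (a | a | a) (b | b | ⟨b, e⟩) h <;> simp only [Below] at h
      · exact ⟨.inl b, rfl⟩
      · refine ⟨.inr (b, e), ?_⟩
        have : a = b.castLE hk := Fin.ext h
        rw [this]
        rfl
    intro e
    induction e using Sym2.ind with
    | _ a b =>
      intro he
      rcases he with he | he
      · exact key a b he
      · rw [Sym2.eq_swap]; exact key b a he
  refine (Set.ncard_le_ncard hsub (Set.toFinite _)).trans ?_
  rw [← Set.image_univ]
  refine (Set.ncard_image_le).trans ?_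
  rw [Set.ncard_univ]
  simp [mul_comm]

end Spider

/-- The vertex `v` has at least three neighbours. -/
def Mid {V : Type*} (G : SimpleGraph V) (v : V) : Prop :=
  ∃ a b c, G.Adj v a ∧ G.Adj v b ∧ G.Adj v c ∧ a ≠ b ∧ a ≠ c ∧ b ≠ c

theorem IsSub.mid {V W : Type*} {T : SimpleGraph W} {G : SimpleGraph V} {f : W → V}
    (hf : IsSub T G f) {v : W} (hv : Mid T v) : Mid G (f v) := by
  obtain ⟨a, b, c, ha, hb, hc, hab, hac, hbc⟩ := hv
  exact ⟨f a, f b, f c, hf.adj ha, hf.adj hb, hf.adj hc, hf.inj.ne hab, hf.inj.ne hac,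
    hf.inj.ne hbc⟩

section SpiderMid

open SpiderVertex

variable {k D : ℕ}

theorem mid_spider_centre (hD : 3 ≤ D) : Mid (spider k D) centre :=
  ⟨arm ⟨0, by omega⟩, arm ⟨1, by omega⟩, arm ⟨2, by omega⟩, spider_adj_centre_arm _,
    spider_adj_centre_arm _, spider_adj_centre_arm _, by simp, by simp, by simp⟩

theorem mid_spider_arm (hk : k ≤ D) (j : Fin k) : Mid (spider k D) (arm (j.castLE hk)) :=
  ⟨centre, leaf j 0, leaf j 1, (spider_adj_centre_arm _).symm, spider_adj_arm_leaf hk j 0,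
    spider_adj_arm_leaf hk j 1, by simp, by simp, by simp⟩

/-- A vertex of a spider is the centre, an arm with leaves, or it has degree at most one. -/
theorem spider_cases (hk : k ≤ D) (s : SpiderVertex k D) :
    s = centre ∨ (∃ j : Fin k, s = arm (j.castLE hk)) ∨
      ∀ t t', (spider k D).Adj s t → (spider k D).Adj s t' → t = t' := by
  rcases s with s | i | s
  · exact Or.inl rfl
  · by_cases hi : (i : ℕ) < k
    · exact Or.inr (Or.inl ⟨⟨i, hi⟩, rfl⟩)
    · right; right
      have key : ∀ t, (spider k D).Adj (.inr (.inl i)) t → t = centre := by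
        rintro (t | t | ⟨t, e⟩) ht
        · rfl
        · rcases ht with ht | ht <;> simp [Below] at ht
        · rcases ht with ht | ht <;> simp only [Below] at ht
          have := t.2
          omega
      intro t t' ht ht'
      rw [key t ht, key t' ht']
  · right; right
    intro t t' ht ht'
    have key : ∀ t : SpiderVertex k D, ¬ Below (.inr (.inr s)) t := by
      rintro (t | t | t) h <;> simp [Below] at h
    rcases ht with ht | ht
    · exact absurd ht (key _)
    rcases ht' with ht' | ht'
    · exact absurd ht' (key _)
    exact ht.eq ht'

theorem not_mid_of_subsingleton {V : Type*} {G : SimpleGraph V} {v : V}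
    (h : ∀ a b, G.Adj v a → G.Adj v b → a = b) : ¬ Mid G v := by
  rintro ⟨a, b, c, ha, hb, -, hab, -⟩
  exact hab (h a b ha hb)

theorem spider_subsingleton_of_not_mid (hk : k ≤ D) (hD : 3 ≤ D) {s : SpiderVertex k D}
    (hs : ¬ Mid (spider k D) s) (t t' : SpiderVertex k D) (ht : (spider k D).Adj s t)
    (ht' : (spider k D).Adj s t') : t = t' := by
  rcases spider_cases hk s with rfl | ⟨j, rfl⟩ | h
  · exact absurd (mid_spider_centre hD) hs
  · exact absurd (mid_spider_arm hk j) hs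
  · exact h t t' ht ht'

end SpiderMid

/-! ### The forbidden configurations and the family for the second part. -/

/-- The configurations that cannot occur around disjoint spiders that are components: a spider with
an additional edge at a vertex that is not a leaf, or two additional edges at a leaf, or an
additional edge to a spider; or four consecutive vertices of degree at least three. -/
def SpiderClash (k D : ℕ) {V : Type*} (G : SimpleGraph V) : Prop :=
  (∃ f s w, IsSub (spider k D) G f ∧ G.Adj (f s) w ∧
    (∀ t, (spider k D).Adj s t → w ≠ f t) ∧
    (Mid (spider k D) s ∨
      (∃ w', w ≠ w' ∧ G.Adj (f s) w' ∧ ∀ t, (spider k D).Adj s t → w' ≠ f t) ∨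
      ∃ g s', IsSub (spider k D) G g ∧ w = g s')) ∨
  ∃ v : Fin 4 → V, (∀ i, Mid G (v i)) ∧ G.Adj (v 0) (v 1) ∧ G.Adj (v 1) (v 2) ∧
    G.Adj (v 2) (v 3) ∧ v 0 ≠ v 2 ∧ v 1 ≠ v 3

/-- The orders for which the construction uses stars. -/
abbrev smallOrders : Finset ℕ := {1, 2, 3, 4, 5, 7}

/-- The number of arms of the spider on `r` vertices used in the construction. -/
def arms (r : ℕ) : ℕ := if r ∈ smallOrders then r - 1 else if r = 6 then 3 else r - 5

/-- The number of arms with leaves of the spider on `r` vertices used in the construction. -/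
def legs (r : ℕ) : ℕ := if r ∈ smallOrders then 0 else if r = 6 then 1 else 2

/-- Small orders give stars, order 6 has one arm with leaves out of three, and every r ≥ 8 has two
out of r - 5 ≥ 3. -/
theorem arms_add_legs {r : ℕ} (hr : 1 ≤ r) : 1 + arms r + 2 * legs r = r := by
  unfold arms legs
  split_ifs with h1 h2
  · omega
  · omega
  · simp at h1
    omega

theorem legs_le_arms {r : ℕ} (hr : 1 ≤ r) : legs r ≤ arms r := by
  unfold arms legs
  split_ifs with h1 h2
  · omega
  · omega
  · simp at h1
    omega

theorem three_le_arms {r : ℕ} (hr : 1 ≤ r) (h : r ∉ smallOrders) : 3 ≤ arms r := by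
  unfold arms
  rw [if_neg h]
  split_ifs with h2
  · omega
  · simp at h
    omega

theorem one_le_legs {r : ℕ} (h : r ∉ smallOrders) : 1 ≤ legs r := by
  unfold legs
  rw [if_neg h]
  split_ifs <;> omega

theorem legs_eq_two_or_arms_eq_three {r : ℕ} (h : r ∉ smallOrders) : legs r = 2 ∨ arms r = 3 := by
  unfold legs arms
  rw [if_neg h, if_neg h]
  split_ifs <;> simp

/-- The configurations, containing a cycle `c` of length `h`, that are forbidden by the family for
the order `r`. -/
def CycleClash (L : Set ℕ) (r : ℕ) {h : ℕ} {V : Type*} (G : SimpleGraph V) (c : ZMod h → V) : Prop :=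
  (∃ h' ∈ L, ∃ c' : ZMod h' → V, IsSub (cyc h') G c' ∧ ∀ i j, c i ≠ c' j) ∨
  (∃ i w, G.Adj (c i) w ∧ w ≠ c (i + 1) ∧ w ≠ c (i - 1)) ∨
  (r ∈ smallOrders ∧ ∃ (Y : SimpleGraph (Fin (2 * r))) (g : _), Y.Preconnected ∧ IsSub Y G g ∧
    ∀ i j, c i ≠ g j) ∨
  (r ∉ smallOrders ∧ SpiderClash (legs r) (arms r) G)

/-- The configurations forbidden by the family, for the set `L` of special lengths of cycles and the
order `ρ h` associated with the length `h`. -/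
def Clash (L : Set ℕ) (ρ : ℕ → ℕ) {V : Type*} (G : SimpleGraph V) : Prop :=
  (∃ c, IsSub (cyc 3) G c) ∨ (∃ c, IsSub (cyc 4) G c) ∨
  ∃ h ∈ L, ∃ c : ZMod h → V, IsSub (cyc h) G c ∧ CycleClash L (ρ h) G c

section Mono

variable {V V' : Type*} {G : SimpleGraph V} {G' : SimpleGraph V'} {φ : V → V'}

theorem SpiderClash.mono {k D : ℕ} (hG : SpiderClash k D G) (hφ : IsSub G G' φ) :
    SpiderClash k D G' := by
  rcases hG with ⟨f, s, w, hf, hadj, hw, h⟩ | ⟨v, hv, h1, h2, h3, h4, h5⟩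
  · refine Or.inl ⟨φ ∘ f, s, φ w, hφ.comp hf, hφ.adj hadj, fun t ht => hφ.inj.ne (hw t ht), ?_⟩
    rcases h with h | ⟨w', hww', hadj', hw'⟩ | ⟨g, s', hg, rfl⟩
    · exact Or.inl h
    · exact Or.inr (Or.inl ⟨φ w', hφ.inj.ne hww', hφ.adj hadj', fun t ht => hφ.inj.ne (hw' t ht)⟩)
    · exact Or.inr (Or.inr ⟨φ ∘ g, s', hφ.comp hg, rfl⟩)
  · exact Or.inr ⟨φ ∘ v, fun i => hφ.mid (hv i), hφ.adj h1, hφ.adj h2, hφ.adj h3, hφ.inj.ne h4,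
      hφ.inj.ne h5⟩

theorem CycleClash.mono {L : Set ℕ} {r h : ℕ} {c : ZMod h → V} (hG : CycleClash L r G c)
    (hφ : IsSub G G' φ) : CycleClash L r G' (φ ∘ c) := by
  rcases hG with ⟨h', hh', c', hc', hd⟩ | ⟨i, w, hadj, h1, h2⟩ | ⟨hr, Y, g, hY, hg, hd⟩ | ⟨hr, hn⟩
  · exact Or.inl ⟨h', hh', φ ∘ c', hφ.comp hc', fun i j => hφ.inj.ne (hd i j)⟩
  · exact Or.inr (Or.inl ⟨i, φ w, hφ.adj hadj, hφ.inj.ne h1, hφ.inj.ne h2⟩)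
  · exact Or.inr (Or.inr (Or.inl ⟨hr, Y, φ ∘ g, hY, hφ.comp hg, fun i j => hφ.inj.ne (hd i j)⟩))
  · exact Or.inr (Or.inr (Or.inr ⟨hr, hn.mono hφ⟩))

theorem Clash.mono {L : Set ℕ} {ρ : ℕ → ℕ} (hG : Clash L ρ G) (hφ : IsSub G G' φ) :
    Clash L ρ G' := by
  rcases hG with ⟨c, hc⟩ | ⟨c, hc⟩ | ⟨h, hh, c, hc, hcl⟩
  · exact Or.inl ⟨_, hφ.comp hc⟩
  · exact Or.inr (Or.inl ⟨_, hφ.comp hc⟩)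
  · exact Or.inr (Or.inr ⟨h, hh, _, hφ.comp hc, hcl.mono hφ⟩)

end Mono

/-- The family of forbidden configurations that have at most two components and bounded order. -/
def clashFamily (L : Set ℕ) (ρ : ℕ → ℕ) : Set FinGraph :=
  {X | Clash L ρ X.2 ∧ (∃ x y, ∀ z, X.2.Reachable x z ∨ X.2.Reachable y z) ∧
    (X.1 ≤ 4 ∨ ∃ h ∈ L, ∃ h' ∈ L, X.1 ≤ h + h' + 16)}

theorem Clash.of_containsMember {L : Set ℕ} {ρ : ℕ → ℕ} {V : Type*} {G : SimpleGraph V}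
    (h : ContainsMember (clashFamily L ρ) G) : Clash L ρ G := by
  obtain ⟨X, hX, ⟨f⟩⟩ := h
  exact hX.1.mono (IsSub.ofCopy f)

/-- No member has more than two components at all. -/
theorem isQuasiFinite_clashFamily (L : Set ℕ) (ρ : ℕ → ℕ) : IsQuasiFinite (clashFamily L ρ) := by
  intro m T _
  refine ⟨2, fun X hX => ?_⟩
  obtain ⟨x, y, hxy⟩ := hX.2.1
  refine (Set.ncard_le_ncard (t := {X.2.connectedComponentMk x, X.2.connectedComponentMk y}) ?_
    (Set.toFinite _)).trans ((Set.ncard_insert_le _ _).trans (by simp))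
  intro K _
  induction K using ConnectedComponent.ind with
  | _ z =>
    rcases hxy z with h | h
    · left; exact (ConnectedComponent.sound h).symm
    · right; exact (ConnectedComponent.sound h).symm

theorem finite_clashFamily {L : Set ℕ} (hL : L.Finite) (ρ : ℕ → ℕ) : (clashFamily L ρ).Finite := by
  obtain ⟨M, hM⟩ := hL.bddAbove
  refine Set.Finite.subset (s := ⋃ n ∈ Finset.range (2 * M + 17),
    Set.range (fun G : SimpleGraph (Fin n) => (⟨n, G⟩ : FinGraph))) ?_ ?_
  · exact Set.Finite.biUnion (Finset.finite_toSet _) fun n _ => Set.finite_range _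
  · rintro ⟨n, G⟩ ⟨-, -, h⟩
    have hn : n < 2 * M + 17 := by
      rcases h with h | ⟨a, ha, b, hb, h⟩
      · change n ≤ 4 at h; omega
      · have := hM ha
        have := hM hb
        change n ≤ _ at h
        omega
    simp only [Set.mem_iUnion]
    exact ⟨n, by simpa using hn, G, rfl⟩

theorem ncard_range_le {α β : Type*} [Finite α] (f : α → β) : (Set.range f).ncard ≤ Nat.card α := by
  rw [← Set.image_univ, ← Set.ncard_univ]
  exact Set.ncard_image_le

theorem SimpleGraph.Reachable.induce_mono {V : Type*} {G : SimpleGraph V} {s t : Set V} (hst : s ⊆ t)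
    {x y : s} (h : (G.induce s).Reachable x y) :
    (G.induce t).Reachable ⟨x, hst x.2⟩ ⟨y, hst y.2⟩ :=
  h.map (induceHomOfLE G hst).toHom

theorem isSub_induce_mono {V : Type*} (G : SimpleGraph V) {s t : Set V} (hst : s ⊆ t) :
    IsSub (G.induce s) (G.induce t) (fun x => ⟨x, hst x.2⟩) :=
  ⟨fun _ _ h => Subtype.ext (congrArg (fun z : t => z.1) h), fun h => h⟩

/-- Every vertex of `s` can be reached from `x` inside `s`. -/
def IsRoot {V : Type*} (G : SimpleGraph V) (s : Set V) (x : V) : Prop :=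
  ∃ hx : x ∈ s, ∀ y (hy : y ∈ s), (G.induce s).Reachable ⟨x, hx⟩ ⟨y, hy⟩

theorem IsSub.isRoot_range {V W : Type*} {T : SimpleGraph W} {G : SimpleGraph V} {f : W → V}
    (hf : IsSub T G f) (hT : T.Preconnected) (a : W) : IsRoot G (Set.range f) (f a) := by
  refine ⟨⟨a, rfl⟩, ?_⟩
  rintro _ ⟨b, rfl⟩
  exact (hf.restrict (s := Set.range f) fun a => ⟨a, rfl⟩).reachable (hT a b)

theorem IsRoot.union {V : Type*} {G : SimpleGraph V} {s t : Set V} {x y z : V}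
    (hs : IsRoot G s x) (ht : IsRoot G t y) (hz : z ∈ s) (hzy : G.Adj z y) :
    IsRoot G (s ∪ t) x := by
  obtain ⟨hx, hs⟩ := hs
  obtain ⟨hy, ht⟩ := ht
  refine ⟨Or.inl hx, ?_⟩
  rintro w (hw | hw)
  · exact (hs w hw).induce_mono Set.subset_union_left
  · refine ((hs z hz).induce_mono Set.subset_union_left).trans (Reachable.trans ?_
      ((ht w hw).induce_mono Set.subset_union_right))
    exact Adj.reachable (show (G.induce (s ∪ t)).Adj ⟨z, Or.inl hz⟩ ⟨y, Or.inr hy⟩ from hzy)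

theorem isRoot_singleton {V : Type*} (G : SimpleGraph V) (x : V) : IsRoot G {x} x := by
  refine ⟨rfl, ?_⟩
  rintro y rfl
  exact Reachable.rfl

theorem IsRoot.insert {V : Type*} {G : SimpleGraph V} {s : Set V} {x z w : V}
    (hs : IsRoot G s x) (hz : z ∈ s) (hzw : G.Adj z w) : IsRoot G (s ∪ {w}) x :=
  hs.union (isRoot_singleton G w) hz hzw

/-- A clash inside a union of two connected sets gives a member, since members are exactly the
clashes with two roots and bounded order. -/
theorem containsMember_of_clash_induce {L : Set ℕ} {ρ : ℕ → ℕ} {V : Type*} {G : SimpleGraph V}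
    {s : Set V} (hs : s.Finite) (hc : Clash L ρ (G.induce s)) {x y : V} {s₁ s₂ : Set V}
    (hx : IsRoot G s₁ x) (hy : IsRoot G s₂ y) (hst : s = s₁ ∪ s₂)
    (hcard : s.ncard ≤ 4 ∨ ∃ h ∈ L, ∃ h' ∈ L, s.ncard ≤ h + h' + 16) :
    ContainsMember (clashFamily L ρ) G := by
  subst hst
  have := hs.fintype
  have hn : Fintype.card ↥(s₁ ∪ s₂) = (s₁ ∪ s₂).ncard := by
    rw [← Nat.card_eq_fintype_card, Nat.card_coe_set_eq]
  let e := (G.induce (s₁ ∪ s₂)).overFinIso hn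
  refine ⟨⟨_, (G.induce (s₁ ∪ s₂)).overFin hn⟩, ⟨hc.mono (φ := e) ⟨e.injective, e.map_adj_iff.2⟩,
    ⟨e ⟨x, Or.inl hx.1⟩, e ⟨y, Or.inr hy.1⟩, fun z => ?_⟩, hcard⟩, ?_⟩
  · obtain ⟨⟨z, hz | hz⟩, rfl⟩ := e.surjective z
    · left
      exact ((hx.2 z hz).induce_mono Set.subset_union_left).map e.toHom
    · right
      exact ((hy.2 z hz).induce_mono Set.subset_union_right).map e.toHom
  · exact IsContained.trans e.isContained' ⟨(Embedding.induce _).toCopy⟩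

theorem Mid.induce {V : Type*} {G : SimpleGraph V} {s : Set V} {v a b c : V} (hv : v ∈ s)
    (ha : a ∈ s) (hb : b ∈ s) (hc : c ∈ s) (h : G.Adj v a ∧ G.Adj v b ∧ G.Adj v c ∧ a ≠ b ∧ a ≠ c ∧
      b ≠ c) : Mid (G.induce s) ⟨v, hv⟩ :=
  ⟨⟨a, ha⟩, ⟨b, hb⟩, ⟨c, hc⟩, h.1, h.2.1, h.2.2.1, fun h' => h.2.2.2.1 (congrArg Subtype.val h'),
    fun h' => h.2.2.2.2.1 (congrArg Subtype.val h'), fun h' => h.2.2.2.2.2 (congrArg Subtype.val h')⟩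

/-- A spider clash lives on one connected set: one spider with at most two further vertices, two
adjoining spiders, or a path of four vertices with three neighbours each. -/
theorem SpiderClash.exists_local {k D : ℕ} (hk : k ≤ D) {V : Type*} {G : SimpleGraph V}
    (h : SpiderClash k D G) : ∃ (s : Set V) (x : V), s.Finite ∧ IsRoot G s x ∧
      SpiderClash k D (G.induce s) ∧ s.ncard ≤ 2 * (1 + D + 2 * k) + 16 := by
  have hcard : Nat.card (SpiderVertex k D) = 1 + D + 2 * k := by
    simp only [Nat.card_eq_fintype_card, Fintype.card_sum, Fintype.card_unit, Fintype.card_fin,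
      Fintype.card_prod]
    ring
  rcases h with ⟨f, s, w, hf, hadj, hw, h⟩ | ⟨v, hv, h1, h2, h3, h4, h5⟩
  · have hfr := ncard_range_le f
    rw [hcard] at hfr
    have hroot := hf.isRoot_range (spider_preconnected hk) s
    rcases h with h | ⟨w', hww', hadj', hw'⟩ | ⟨g, s', hg, rfl⟩
    · refine ⟨Set.range f ∪ {w}, f s, Set.toFinite _, hroot.insert ⟨s, rfl⟩ hadj, ?_, ?_⟩
      · exact Or.inl ⟨_, s, ⟨w, Or.inr rfl⟩, hf.restrict fun a => Or.inl ⟨a, rfl⟩, hadj,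
          fun t ht h' => hw t ht (congrArg Subtype.val h'), Or.inl h⟩
      · refine (Set.ncard_union_le _ _).trans ?_
        rw [Set.ncard_singleton]
        omega
    · refine ⟨Set.range f ∪ {w} ∪ {w'}, f s, Set.toFinite _,
        (hroot.insert ⟨s, rfl⟩ hadj).insert (Or.inl ⟨s, rfl⟩) hadj', ?_, ?_⟩
      · exact Or.inl ⟨_, s, ⟨w, Or.inl (Or.inr rfl)⟩, hf.restrict fun a => Or.inl (Or.inl ⟨a, rfl⟩),
          hadj, fun t ht h' => hw t ht (congrArg Subtype.val h'), Or.inr (Or.inl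
            ⟨⟨w', Or.inr rfl⟩, fun h' => hww' (congrArg Subtype.val h'), hadj',
              fun t ht h' => hw' t ht (congrArg Subtype.val h')⟩)⟩
      · refine (Set.ncard_union_le _ _).trans ?_
        rw [Set.ncard_singleton]
        have := Set.ncard_union_le (Set.range f) {w}
        rw [Set.ncard_singleton] at this
        omega
    · have hgr := ncard_range_le g
      rw [hcard] at hgr
      refine ⟨Set.range f ∪ Set.range g, f s, Set.toFinite _,
        hroot.union (hg.isRoot_range (spider_preconnected hk) s') ⟨s, rfl⟩ hadj, ?_, ?_⟩
      · exact Or.inl ⟨_, s, ⟨g s', Or.inr ⟨s', rfl⟩⟩, hf.restrict fun a => Or.inl ⟨a, rfl⟩, hadj,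
          fun t ht h' => hw t ht (congrArg Subtype.val h'), Or.inr (Or.inr
            ⟨_, s', hg.restrict fun a => Or.inr ⟨a, rfl⟩, rfl⟩)⟩
      · refine (Set.ncard_union_le _ _).trans ?_
        omega
  · choose a b c habc using hv
    -- Four vertices with three neighbours each make the 16 in the bound on the order.
    let F : Fin 4 × Fin 4 → V := fun p => ![v p.1, a p.1, b p.1, c p.1] p.2
    have hV : ∀ i, v i ∈ Set.range F := fun i => ⟨(i, 0), rfl⟩
    have hA : ∀ i, a i ∈ Set.range F := fun i => ⟨(i, 1), rfl⟩
    have hB : ∀ i, b i ∈ Set.range F := fun i => ⟨(i, 2), rfl⟩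
    have hC : ∀ i, c i ∈ Set.range F := fun i => ⟨(i, 3), rfl⟩
    have hreach : ∀ i, ((G.induce (Set.range F)).Reachable ⟨v 0, hV 0⟩ ⟨v i, hV i⟩) := by
      have r1 : (G.induce (Set.range F)).Reachable ⟨v 0, hV 0⟩ ⟨v 1, hV 1⟩ :=
        Adj.reachable (show (G.induce (Set.range F)).Adj _ _ from h1)
      have r2 : (G.induce (Set.range F)).Reachable ⟨v 1, hV 1⟩ ⟨v 2, hV 2⟩ :=
        Adj.reachable (show (G.induce (Set.range F)).Adj _ _ from h2)
      have r3 : (G.induce (Set.range F)).Reachable ⟨v 2, hV 2⟩ ⟨v 3, hV 3⟩ :=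
        Adj.reachable (show (G.induce (Set.range F)).Adj _ _ from h3)
      intro i
      fin_cases i
      exacts [Reachable.rfl, r1, r1.trans r2, (r1.trans r2).trans r3]
    refine ⟨Set.range F, v 0, Set.toFinite _, ⟨hV 0, ?_⟩, Or.inr ⟨fun i => ⟨v i, hV i⟩,
      fun i => Mid.induce (hV i) (hA i) (hB i) (hC i) (habc i), h1, h2, h3,
      fun h => h4 (congrArg Subtype.val h), fun h => h5 (congrArg Subtype.val h)⟩, ?_⟩
    · rintro _ ⟨⟨i, j⟩, rfl⟩
      refine (hreach i).trans ?_
      fin_cases j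
      · exact Reachable.rfl
      · exact Adj.reachable (show (G.induce (Set.range F)).Adj _ _ from (habc i).1)
      · exact Adj.reachable (show (G.induce (Set.range F)).Adj _ _ from (habc i).2.1)
      · exact Adj.reachable (show (G.induce (Set.range F)).Adj _ _ from (habc i).2.2.1)
    · refine (ncard_range_le F).trans ?_
      simp

/-- The lengths are at least five, and at least twice the orders. -/
def IsGauge (L : Set ℕ) (ρ : ℕ → ℕ) : Prop := ∀ h ∈ L, 5 ≤ h ∧ 1 ≤ ρ h ∧ 2 * ρ h ≤ h

/-- Every clash localizes to the special cycle and at most one further connected set. As 2ρ(h) ≤ h,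
the size of the latter is bounded through `L`, which is why `L` alone controls the finiteness of the
family. -/
theorem containsMember_clashFamily_iff {L : Set ℕ} {ρ : ℕ → ℕ} (hL : IsGauge L ρ) {V : Type*}
    {G : SimpleGraph V} : ContainsMember (clashFamily L ρ) G ↔ Clash L ρ G := by
  refine ⟨Clash.of_containsMember, ?_⟩
  have hshort : ∀ {h : ℕ} {c : ZMod h → V}, 3 ≤ h → IsSub (cyc h) G c →
      (Set.range c).Finite ∧ (Set.range c).ncard ≤ h := by
    intro h c hh hc
    have : NeZero h := ⟨by omega⟩
    refine ⟨Set.toFinite _, (ncard_range_le c).trans ?_⟩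
    rw [Nat.card_zmod]
  rintro (⟨c, hc⟩ | ⟨c, hc⟩ | ⟨h, hh, c, hc, hcl⟩)
  · have hroot := hc.isRoot_range (cyc_preconnected le_rfl) 0
    obtain ⟨h1, h2⟩ := hshort le_rfl hc
    exact containsMember_of_clash_induce h1
      (Or.inl ⟨_, hc.restrict (s := Set.range c) fun a => ⟨a, rfl⟩⟩) hroot hroot
      (Set.union_self _).symm (Or.inl (by omega))
  · have hroot := hc.isRoot_range (cyc_preconnected (by omega)) 0
    obtain ⟨h1, h2⟩ := hshort (by omega) hc
    exact containsMember_of_clash_induce h1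
      (Or.inr (Or.inl ⟨_, hc.restrict (s := Set.range c) fun a => ⟨a, rfl⟩⟩))
      hroot hroot (Set.union_self _).symm (Or.inl (by omega))
  · obtain ⟨h5, hr1, hr2⟩ := hL h hh
    have hroot := fun i => hc.isRoot_range (cyc_preconnected (by omega)) i
    obtain ⟨hfin, hcard⟩ := hshort (by omega) hc
    rcases hcl with ⟨h', hh', c', hc', hd⟩ | ⟨i, w, hadj, h1, h2⟩ | ⟨hr, Y, g, hY, hg, hd⟩ | ⟨hr, hn⟩
    · obtain ⟨h5', -⟩ := hL h' hh'
      obtain ⟨hfin', hcard'⟩ := hshort (by omega) hc'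
      refine containsMember_of_clash_induce (hfin.union hfin') (Or.inr (Or.inr ⟨h, hh, _,
        hc.restrict fun a => Or.inl ⟨a, rfl⟩, Or.inl ⟨h', hh', _,
          hc'.restrict fun a => Or.inr ⟨a, rfl⟩, fun i j he => hd i j (congrArg Subtype.val he)⟩⟩))
        (hroot 0) (hc'.isRoot_range (cyc_preconnected (by omega)) 0) rfl
        (Or.inr ⟨h, hh, h', hh', (Set.ncard_union_le _ _).trans (by omega)⟩)
    · have hroot' := (hroot i).insert ⟨i, rfl⟩ hadj
      refine containsMember_of_clash_induce (hfin.union (Set.finite_singleton w))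
        (Or.inr (Or.inr ⟨h, hh, _, hc.restrict fun a => Or.inl ⟨a, rfl⟩, Or.inr (Or.inl
          ⟨i, ⟨w, Or.inr rfl⟩, hadj, fun he => h1 (congrArg Subtype.val he),
            fun he => h2 (congrArg Subtype.val he)⟩)⟩)) hroot' hroot' (Set.union_self _).symm
        (Or.inr ⟨h, hh, h, hh, (Set.ncard_union_le _ _).trans ?_⟩)
      rw [Set.ncard_singleton]
      omega
    · have hcg := ncard_range_le g
      rw [Nat.card_fin] at hcg
      refine containsMember_of_clash_induce (hfin.union (Set.finite_range g))
        (Or.inr (Or.inr ⟨h, hh, _, hc.restrict fun a => Or.inl ⟨a, rfl⟩, Or.inr (Or.inr (Or.inl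
          ⟨hr, Y, _, hY, hg.restrict fun a => Or.inr ⟨a, rfl⟩,
            fun i j he => hd i j (congrArg Subtype.val he)⟩))⟩)) (hroot 0)
        (hg.isRoot_range hY ⟨0, by omega⟩) rfl
        (Or.inr ⟨h, hh, h, hh, (Set.ncard_union_le _ _).trans (by omega)⟩)
    · obtain ⟨s, x, hs, hx, hcl, hcs⟩ := hn.exists_local (legs_le_arms hr1)
      rw [arms_add_legs hr1] at hcs
      exact containsMember_of_clash_induce (hfin.union hs)
        (Or.inr (Or.inr ⟨h, hh, _, hc.restrict fun a => Or.inl ⟨a, rfl⟩, Or.inr (Or.inr (Or.inr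
          ⟨hr, hcl.mono (isSub_induce_mono G Set.subset_union_right)⟩))⟩)) (hroot 0) hx rfl
        (Or.inr ⟨h, hh, h, hh, (Set.ncard_union_le _ _).trans (by omega)⟩)

theorem isAdmissible_clashFamily {L : Set ℕ} {ρ : ℕ → ℕ} (hL : IsGauge L ρ) :
    IsAdmissible (clashFamily L ρ) := by
  constructor
  · have : Clash L ρ (cyc 3) := Or.inl ⟨id, Function.injective_id, fun h => h⟩
    obtain ⟨F, hF, -⟩ := (containsMember_clashFamily_iff hL).2 this
    exact ⟨F, hF⟩
  · rintro F ⟨hF, -⟩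
    have key : ∀ {h : ℕ} {c : ZMod h → Fin F.1}, 3 ≤ h → IsSub (cyc h) F.2 c →
        F.2.edgeSet.Nonempty :=
      fun hh hc => ⟨s(_, _), hc.adj (cyc_adj_add_one hh 0)⟩
    rcases hF with ⟨c, hc⟩ | ⟨c, hc⟩ | ⟨h, hh, c, hc, -⟩
    · exact key le_rfl hc
    · exact key (by omega) hc
    · exact key (by have := (hL h hh).1; omega) hc

theorem IsSub.mono {V W : Type*} {T : SimpleGraph W} {G G' : SimpleGraph V} {f : W → V}
    (hf : IsSub T G f) (h : G ≤ G') : IsSub T G' f :=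
  ⟨hf.inj, fun h' => h (hf.adj h')⟩

/-! ### The saturated graphs consisting of a cycle and spiders. -/

/-- An injective endomorphism of a finite graph is an automorphism. -/
theorem IsSub.adj_iff {W : Type*} [Finite W] {T : SimpleGraph W} {f : W → W} (hf : IsSub T T f)
    {a b : W} : T.Adj (f a) (f b) ↔ T.Adj a b := by
  refine ⟨fun h => ?_, hf.adj⟩
  let σ : Equiv.Perm W := Equiv.ofBijective f (Finite.injective_iff_bijective.1 hf.inj)
  have hσ : ∀ (n : ℕ) {a b : W}, T.Adj a b → T.Adj ((σ ^ n) a) ((σ ^ n) b) := by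
    intro n
    induction n with
    | zero => intro a b h; simpa using h
    | succ n ih =>
      intro a b h
      rw [pow_succ]
      exact ih (hf.adj h)
  have hpos := orderOf_pos σ
  have h1 := hσ (orderOf σ - 1) h
  have h2 : ∀ a, (σ ^ (orderOf σ - 1)) (f a) = a := by
    intro a
    change (σ ^ (orderOf σ - 1) * σ) a = a
    rw [← pow_succ, Nat.sub_add_cancel hpos, pow_orderOf_eq_one]
    rfl
  rwa [h2, h2] at h1

/-- The cycle `c` is a component of `G`. -/
structure IsCycleComponent {V : Type*} (G : SimpleGraph V) {h : ℕ} (c : ZMod h → V) : Prop where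
  isSub : IsSub (cyc h) G c
  eq_or_eq : ∀ {i w}, G.Adj (c i) w → w = c (i + 1) ∨ w = c (i - 1)

namespace IsCycleComponent

variable {V : Type*} {G : SimpleGraph V} {h : ℕ} {c : ZMod h → V}

theorem mem_range_of_adj (hc : IsCycleComponent G c) (a b : V) (ha : a ∈ Set.range c)
    (hab : G.Adj a b) : b ∈ Set.range c := by
  obtain ⟨i, rfl⟩ := ha
  rcases hc.eq_or_eq hab with h | h
  · exact ⟨_, h.symm⟩
  · exact ⟨_, h.symm⟩

theorem not_mid (hc : IsCycleComponent G c) (i : ZMod h) : ¬ Mid G (c i) := by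
  rintro ⟨x, y, z, hx, hy, hz, hxy, hxz, hyz⟩
  rcases hc.eq_or_eq hx with h1 | h1 <;> rcases hc.eq_or_eq hy with h2 | h2 <;>
    rcases hc.eq_or_eq hz with h3 | h3 <;> simp_all

/-- A cycle that meets a component that is a cycle is the whole component. -/
theorem of_meets (hc : IsCycleComponent G c) (hh : 3 ≤ h) {h' : ℕ} (hh' : 3 ≤ h')
    {c' : ZMod h' → V} (hc' : IsSub (cyc h') G c') {i : ZMod h} {j : ZMod h'} (hij : c' j = c i) :
    IsCycleComponent G c' ∧ Set.range c' = Set.range c ∧ h' = h := by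
  have : NeZero h := ⟨by omega⟩
  have : NeZero h' := ⟨by omega⟩
  have hsub : ∀ j, c' j ∈ Set.range c :=
    hc'.mem_of_closed (cyc_preconnected hh') hc.mem_range_of_adj (a := j) ⟨i, hij.symm⟩
  have hcomp : IsCycleComponent G c' := by
    refine ⟨hc', fun {j w} hw => ?_⟩
    obtain ⟨i, hi⟩ := hsub j
    have h1 := hc'.adj (cyc_adj_add_one hh' j)
    have h2 := hc'.adj (cyc_adj_sub_one hh' j)
    have hne := hc'.inj.ne (ZMod.add_one_ne_sub_one hh' j)
    rw [← hi] at h1 h2 hw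
    rcases hc.eq_or_eq h1 with h1 | h1 <;> rcases hc.eq_or_eq h2 with h2 | h2 <;>
      rcases hc.eq_or_eq hw with h3 | h3 <;> simp_all
  have hrange : Set.range c' = Set.range c := by
    refine Set.Subset.antisymm (by rintro _ ⟨j, rfl⟩; exact hsub j) ?_
    rintro _ ⟨i', rfl⟩
    exact hc.isSub.mem_of_closed (cyc_preconnected hh) hcomp.mem_range_of_adj (a := i) ⟨j, hij⟩ i'
  refine ⟨hcomp, hrange, ?_⟩
  have h1 := Set.ncard_range_of_injective hc'.inj
  have h2 := Set.ncard_range_of_injective hc.isSub.inj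
  rw [hrange, h2, Nat.card_zmod, Nat.card_zmod] at h1
  exact h1.symm

end IsCycleComponent

section CycleAndSpiders

open SpiderVertex

variable {I : Type*} {k D h : ℕ}

theorem isCycleComponent_inl {W : Type*} (hh : 3 ≤ h) (H : SimpleGraph W) :
    IsCycleComponent (cyc h ⊕g H) (Sum.inl : ZMod h → _) := by
  refine ⟨⟨Sum.inl_injective, fun h => by simpa using h⟩, ?_⟩
  rintro i (w | w) hw
  · rw [sum_adj_inl, cyc_adj_iff hh] at hw
    rcases hw with rfl | rfl
    · exact Or.inl rfl
    · exact Or.inr rfl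
  · simp at hw

/-- Spiders are acyclic, as the distance from the centre is a rank; so every cycle meets, and hence
is, the cycle component. -/
theorem cycle_meets_inl (hh : 3 ≤ h) {h' : ℕ} (hh' : 3 ≤ h')
    {c' : ZMod h' → ZMod h ⊕ (I × SpiderVertex k D)}
    (hc' : IsSub (cyc h') (cyc h ⊕g copies I (spider k D)) c') :
    IsCycleComponent (cyc h ⊕g copies I (spider k D)) c' ∧ Set.range c' = Set.range Sum.inl ∧
      h' = h := by
  by_cases hj : ∃ j i, c' j = .inl i
  · obtain ⟨j, i, hij⟩ := hj
    exact (isCycleComponent_inl hh _).of_meets hh hh' hc' hij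
  · exfalso
    push Not at hj
    have : ∀ j, ∃ p, c' j = .inr p := by
      intro j
      rcases hc : c' j with i | p
      · exact absurd hc (hj j i)
      · exact ⟨p, rfl⟩
    choose p hp using this
    refine not_isSub_cyc_of_rank (G := copies I (spider k D)) (fun q => rank q.2) ?_ ?_ hh'
      (c := p) ⟨?_, ?_⟩
    · rintro ⟨i, a⟩ ⟨j, b⟩ ⟨-, hadj⟩
      exact spider_rank_ne hadj
    · rintro ⟨i, x⟩ ⟨j, a⟩ ⟨j', b⟩ ⟨rfl, ha⟩ ⟨rfl, hb⟩ ha' hb'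
      exact Prod.ext rfl (spider_unique ha hb ha' hb')
    · intro a b hab
      exact hc'.inj (by rw [hp, hp, hab])
    · intro a b hab
      have := hc'.adj hab
      rwa [hp, hp, sum_adj_inr] at this

theorem Mid.exists_of_cycle_sum (hh : 3 ≤ h) {T : SimpleGraph (SpiderVertex k D)}
    {z : ZMod h ⊕ (I × SpiderVertex k D)} (hz : Mid (cyc h ⊕g copies I T) z) :
    ∃ i x, z = .inr (i, x) ∧ Mid T x := by
  rcases z with z | ⟨i, x⟩
  · exact absurd hz ((isCycleComponent_inl hh _).not_mid z)
  · refine ⟨i, x, rfl, ?_⟩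
    obtain ⟨a, b, c, ha, hb, hc, hab, hac, hbc⟩ := hz
    have key : ∀ {w}, (cyc h ⊕g copies I T).Adj (.inr (i, x)) w →
        ∃ y, w = .inr (i, y) ∧ T.Adj x y := by
      rintro (w | ⟨j, y⟩) hw
      · simp at hw
      · obtain ⟨rfl, hw⟩ := sum_adj_inr.1 hw
        exact ⟨y, rfl, hw⟩
    obtain ⟨a, rfl, ha'⟩ := key ha
    obtain ⟨b, rfl, hb'⟩ := key hb
    obtain ⟨c, rfl, hc'⟩ := key hc
    exact ⟨a, b, c, ha', hb', hc', by simpa using hab, by simpa using hac, by simpa using hbc⟩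

/-- All edges at a spider in the disjoint union of a cycle and spiders belong to the spider. -/
theorem exists_eq_of_adj_spider (hh : 3 ≤ h) (hk : k ≤ D) (hD : 3 ≤ D)
    {f : SpiderVertex k D → ZMod h ⊕ (I × SpiderVertex k D)}
    (hf : IsSub (spider k D) (cyc h ⊕g copies I (spider k D)) f) {s : SpiderVertex k D}
    {w : ZMod h ⊕ (I × SpiderVertex k D)}
    (hw : (cyc h ⊕g copies I (spider k D)).Adj (f s) w) :
    ∃ t, (spider k D).Adj s t ∧ w = f t := by
  obtain ⟨i, x, hx, -⟩ := (hf.mid (mid_spider_centre hD)).exists_of_cycle_sum hh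
  have : ∀ a, ∃ b, f a = .inr (i, b) := fun a =>
    reachable_copies_index ⟨f, hf.adj⟩ (spider_preconnected hk centre a) ⟨x, hx⟩
  choose g hg using this
  -- A spider in the union fills a single copy, on which it is an automorphism; so all edges there
  -- are edges of the spider.
  have hg' : IsSub (spider k D) (spider k D) g := by
    refine ⟨fun a b hab => hf.inj (by rw [hg, hg, hab]), fun {a b} hab => ?_⟩
    have := hf.adj hab
    rw [hg, hg, sum_adj_inr] at this
    exact this.2
  rw [hg] at hw
  rcases w with w | ⟨j, y⟩
  · simp at hw
  obtain ⟨rfl, hw⟩ := sum_adj_inr.1 hw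
  obtain ⟨t, rfl⟩ := (Finite.injective_iff_surjective.1 hg'.inj) y
  exact ⟨t, hg'.adj_iff.1 hw, (hg t).symm⟩

theorem rank_cases_of_adj {a b : SpiderVertex k D} (h : (spider k D).Adj a b)
    (ha : Mid (spider k D) a) (hb : Mid (spider k D) b) :
    (a = centre ∧ b ≠ centre) ∨ (b = centre ∧ a ≠ centre) := by
  have key : ∀ a : SpiderVertex k D, Mid (spider k D) a → rank a ≠ 2 := by
    rintro (a | a | a) ha h2
    · simp [rank] at h2
    · simp [rank] at h2
    · refine not_mid_of_subsingleton ?_ ha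
      have : ∀ x, (spider k D).Adj (.inr (.inr a)) x → Below x (.inr (.inr a)) := by
        rintro (x | x | x) (h | h)
        all_goals first | exact h | simp [Below] at h
      exact fun x y hx hy => (this x hx).eq (this y hy)
  have ha := key a ha
  have hb := key b hb
  have := spider_rank_ne h
  rcases a with a | a | a <;> rcases b with b | b | b <;> simp_all [rank]

/-- In a spider, every edge between vertices of degree at least three contains the centre. Along
four such vertices the centre would have to occur twice, so two vertices at distance two on the path
would be equal. -/
theorem not_spiderClash_cycle_sum (hh : 3 ≤ h) (hk : k ≤ D) (hD : 3 ≤ D) :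
    ¬ SpiderClash k D (cyc h ⊕g copies I (spider k D)) := by
  rintro (⟨f, s, w, hf, hadj, hw, -⟩ | ⟨v, hv, h1, h2, h3, h4, h5⟩)
  · obtain ⟨t, ht, rfl⟩ := exists_eq_of_adj_spider hh hk hD hf hadj
    exact hw t ht rfl
  · choose i x hx hm using fun j => (hv j).exists_of_cycle_sum hh
    rw [hx, hx, sum_adj_inr] at h1 h2 h3
    rw [hx, hx, Ne, Sum.inr.injEq, Prod.mk.injEq] at h4 h5
    have e1 := h1.1
    have e2 := h2.1
    have e3 := h3.1
    dsimp only at e1 e2 e3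
    have a1 := rank_cases_of_adj h1.2 (hm _) (hm _)
    have a2 := rank_cases_of_adj h2.2 (hm _) (hm _)
    have a3 := rank_cases_of_adj h3.2 (hm _) (hm _)
    dsimp only at a1 a2 a3
    rcases a1 with a1 | a1 <;> rcases a2 with a2 | a2 <;> rcases a3 with a3 | a3 <;> simp_all

/-- The only cycle is the given one, it is a component, and the other components have r < 2r
vertices. -/
theorem not_clash_cycle_sum {L : Set ℕ} {ρ : ℕ → ℕ} (hL : IsGauge L ρ) (hL' : h ∈ L) :
    ¬ Clash L ρ (cyc h ⊕g copies I (spider (legs (ρ h)) (arms (ρ h)))) := by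
  obtain ⟨h5, hr, -⟩ := hL h hL'
  have hh : 3 ≤ h := by omega
  have hk := legs_le_arms hr
  rintro (⟨c, hc⟩ | ⟨c, hc⟩ | ⟨h', hh', c, hc, hcl⟩)
  · have := (cycle_meets_inl hh le_rfl hc).2.2
    omega
  · have := (cycle_meets_inl hh (by omega) hc).2.2
    omega
  · have h5' := (hL h' hh').1
    obtain ⟨hcomp, hrange, rfl⟩ := cycle_meets_inl hh (by omega) hc
    rcases hcl with ⟨h'', hh'', c', hc', hd⟩ | ⟨i, w, hadj, h1, h2⟩ | ⟨hs, Y, g, hY, hg, hd⟩ |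
      ⟨hs, hn⟩
    · have h5'' := (hL h'' hh'').1
      obtain ⟨-, hrange', -⟩ := cycle_meets_inl hh (by omega) hc'
      have : c 0 ∈ Set.range c' := by rw [hrange', ← hrange]; exact ⟨0, rfl⟩
      obtain ⟨j, hj⟩ := this
      exact hd 0 j hj.symm
    · rcases hcomp.eq_or_eq hadj with h | h
      · exact h1 h
      · exact h2 h
    · have hinr : ∀ j, ∃ p, g j = .inr p := by
        intro j
        rcases hgj : g j with z | p
        · have : g j ∈ Set.range c := by rw [hrange]; exact ⟨z, hgj.symm⟩
          obtain ⟨i, hi⟩ := this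
          exact absurd hi (hd i j)
        · exact ⟨p, rfl⟩
      obtain ⟨⟨i, x⟩, hp⟩ := hinr ⟨0, by omega⟩
      have : ∀ a, ∃ b, g a = .inr (i, b) := fun a =>
        reachable_copies_index ⟨g, hg.adj⟩ (hY _ a) ⟨x, hp⟩
      choose φ hφ using this
      have hφi : Function.Injective φ := fun a b hab => hg.inj (by rw [hφ, hφ, hab])
      have := Fintype.card_le_of_injective φ hφi
      have h6 := arms_add_legs hr
      simp only [Fintype.card_fin, Fintype.card_sum, Fintype.card_unit, Fintype.card_prod] at this
      omega
    · exact not_spiderClash_cycle_sum hh hk (three_le_arms hr hs) hn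

theorem isSub_copies_sup {W V : Type*} (H : SimpleGraph V) (T : SimpleGraph W) (i : I)
    (E : SimpleGraph (V ⊕ (I × W))) :
    IsSub T ((H ⊕g copies I T) ⊔ E) (fun a => .inr (i, a)) :=
  ⟨fun a b hab => by simpa using hab, fun {a b} hab => Or.inl (by simpa using hab)⟩

theorem clash_sup_edge {L : Set ℕ} {ρ : ℕ → ℕ} (hL : IsGauge L ρ) (hL' : h ∈ L)
    (u v : ZMod h ⊕ (I × SpiderVertex (legs (ρ h)) (arms (ρ h)))) (huv : u ≠ v)
    (hadj : ¬ (cyc h ⊕g copies I (spider (legs (ρ h)) (arms (ρ h)))).Adj u v) :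
    Clash L ρ ((cyc h ⊕g copies I (spider (legs (ρ h)) (arms (ρ h)))) ⊔ edge u v) := by
  obtain ⟨h5, hr, -⟩ := hL h hL'
  have hh : 3 ≤ h := by omega
  have hk := legs_le_arms hr
  set T := spider (legs (ρ h)) (arms (ρ h)) with hT
  have hcard := arms_add_legs hr
  have hedge : ∀ u v : ZMod h ⊕ (I × SpiderVertex (legs (ρ h)) (arms (ρ h))), u ≠ v →
      ((cyc h ⊕g copies I T) ⊔ edge u v).Adj u v := fun u v huv =>
    Or.inr (by simp [edge_adj, huv])
  have hcyc : ∀ u v, IsSub (cyc h) ((cyc h ⊕g copies I T) ⊔ edge u v) Sum.inl := fun u v =>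
    (isCycleComponent_inl hh _).isSub.mono le_sup_left
  have hinl : ∀ i v, Sum.inl i ≠ v → ¬ (cyc h ⊕g copies I T).Adj (.inl i) v →
      Clash L ρ ((cyc h ⊕g copies I T) ⊔ edge (.inl i) v) := by
    intro i v hiv hadj
    refine Or.inr (Or.inr ⟨h, hL', Sum.inl, hcyc _ _, Or.inr (Or.inl ⟨i, v, hedge _ _ hiv, ?_, ?_⟩)⟩)
    · rintro rfl
      exact hadj (sum_adj_inl.2 (cyc_adj_add_one hh i))
    · rintro rfl
      exact hadj (sum_adj_inl.2 (cyc_adj_sub_one hh i))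
  rcases u with u | ⟨i, x⟩
  · exact hinl u v huv hadj
  rcases v with v | ⟨j, y⟩
  · rw [edge_comm]
    exact hinl v _ huv.symm (fun h => hadj h.symm)
  have hci := isSub_copies_sup (cyc h) T i (edge (Sum.inr (i, x)) (Sum.inr (j, y)))
  have hcj := isSub_copies_sup (cyc h) T j (edge (Sum.inr (i, x)) (Sum.inr (j, y)))
  by_cases hs : ρ h ∈ smallOrders
  · by_cases hij : i = j
    · subst hij
      have hxy : x ≠ y := fun h => huv (by rw [h])
      have hadj' : ¬ T.Adj x y := fun h => hadj (by simpa using h)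
      have hlegs : legs (ρ h) = 0 := by rw [legs, if_pos hs]
      have key : ∀ z : SpiderVertex (legs (ρ h)) (arms (ρ h)), z = centre ∨ T.Adj centre z := by
        rintro (z | z | z)
        · exact Or.inl rfl
        · exact Or.inr (spider_adj_centre_arm z)
        · exact absurd z.1.2 (by omega)
      rcases key x with rfl | hx
      · rcases key y with rfl | hy
        · exact absurd rfl hxy
        · exact absurd hy hadj'
      · rcases key y with rfl | hy
        · exact absurd hx.symm hadj'
        -- Two nonadjacent vertices of a star are leaves, so their edge closes a triangle through
        -- the centre.
        · exact Or.inl (isSub_cyc_three (hci.adj hx) (hedge _ _ huv) (hci.adj hy).symm)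
    -- Two stars joined by an edge form a connected graph on 2r vertices disjoint from the cycle.
    · let Y := (T ⊕g T) ⊔ edge (Sum.inl x) (Sum.inr y)
      have hY : Y.Preconnected := (spider_preconnected hk).sum_sup_edge (spider_preconnected hk)
      have hcY : Fintype.card (SpiderVertex (legs (ρ h)) (arms (ρ h)) ⊕
          SpiderVertex (legs (ρ h)) (arms (ρ h))) = 2 * ρ h := by
        simp only [Fintype.card_fin, Fintype.card_sum, Fintype.card_unit, Fintype.card_prod]
        omega
      let e := Y.overFinIso hcY
      have hg : IsSub Y ((cyc h ⊕g copies I T) ⊔ edge (.inr (i, x)) (.inr (j, y)))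
          (Sum.elim (fun a => .inr (i, a)) (fun a => .inr (j, a))) := by
        constructor
        · rintro (a | a) (b | b) hab
          · simpa using hab
          · simp only [Sum.elim_inl, Sum.elim_inr, Sum.inr.injEq, Prod.mk.injEq] at hab
            exact absurd hab.1 hij
          · simp only [Sum.elim_inl, Sum.elim_inr, Sum.inr.injEq, Prod.mk.injEq] at hab
            exact absurd hab.1.symm hij
          · simpa using hab
        · have hx := hedge _ _ huv
          rintro (a | a) (b | b) (hab | hab)
          · exact hci.adj (by simpa using hab)
          · simp [edge_adj] at hab
          · simp at hab
          · simp only [edge_adj, Sum.inl.injEq, Sum.inr.injEq] at hab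
            rcases hab.1 with ⟨rfl, rfl⟩ | ⟨h', -⟩
            · exact hx
            · simp at h'
          · simp at hab
          · simp only [edge_adj, Sum.inl.injEq, Sum.inr.injEq] at hab
            rcases hab.1 with ⟨h', -⟩ | ⟨rfl, rfl⟩
            · simp at h'
            · exact hx.symm
          · exact hcj.adj (by simpa using hab)
          · simp [edge_adj] at hab
      refine Or.inr (Or.inr ⟨h, hL', Sum.inl, hcyc _ _, Or.inr (Or.inr (Or.inl
        ⟨hs, Y.overFin hcY, _, ?_, hg.comp (f := e.symm) ⟨e.symm.injective, e.symm.map_adj_iff.2⟩,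
          ?_⟩))⟩)
      · exact (Iso.connected_iff e).1 ⟨hY⟩ |>.preconnected
      · intro a b
        simp only [Function.comp_apply]
        rcases e.symm b with z | z <;> simp
  · refine Or.inr (Or.inr ⟨h, hL', Sum.inl, hcyc _ _, Or.inr (Or.inr (Or.inr
      ⟨hs, Or.inl ⟨_, x, .inr (j, y), hci, hedge _ _ huv, ?_, Or.inr (Or.inr
        ⟨_, y, hcj, rfl⟩)⟩⟩))⟩)
    intro t ht he
    simp only [Sum.inr.injEq, Prod.mk.injEq] at he
    obtain ⟨rfl, rfl⟩ := he
    exact hadj (by simpa using ht)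

theorem isSaturated_cycle_sum {L : Set ℕ} {ρ : ℕ → ℕ} (hL : IsGauge L ρ) (hL' : h ∈ L) :
    IsSaturated (clashFamily L ρ) (cyc h ⊕g copies I (spider (legs (ρ h)) (arms (ρ h)))) :=
  ⟨fun hc => not_clash_cycle_sum hL hL' ((containsMember_clashFamily_iff hL).1 hc),
    fun u v huv hadj => (containsMember_clashFamily_iff hL).2 (clash_sup_edge hL hL' u v huv hadj)⟩

theorem sat_clashFamily_le {L : Set ℕ} {ρ : ℕ → ℕ} (hL : IsGauge L ρ) (hL' : h ∈ L) (m : ℕ) :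
    sat (h + m * ρ h) (clashFamily L ρ) ≤ h + m * (ρ h - 1) := by
  obtain ⟨h5, hr, -⟩ := hL h hL'
  have : NeZero h := ⟨by omega⟩
  have hcard := arms_add_legs hr
  have hsat := isSaturated_cycle_sum (I := Fin m) hL hL'
  refine (sat_le hsat ?_).trans ?_
  · simp only [Fintype.card_fin, Fintype.card_sum, Fintype.card_unit, Fintype.card_prod, ZMod.card]
    rw [show 1 + (arms (ρ h) + legs (ρ h) * 2) = ρ h by omega]
  · rw [ncard_edgeSet_sum, ncard_edgeSet_copies, Nat.card_fin]
    have h1 := ncard_edgeSet_cyc_le (h := h) (by omega)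
    have h2 := ncard_edgeSet_spider_le (legs_le_arms hr)
    gcongr
    omega

end CycleAndSpiders

/-! ### Joining a leaf to a good vertex outside the spiders. -/

section SpiderConstruction

open SpiderVertex

variable {k D : ℕ}

theorem SpiderVertex.Below.mid (hk : k ≤ D) (hD : 3 ≤ D) {a b : SpiderVertex k D}
    (h : Below a b) : Mid (spider k D) a := by
  rcases a with a | a | a <;> rcases b with b | b | ⟨b, e⟩ <;> simp only [Below] at h
  · exact mid_spider_centre hD
  · have : a = b.castLE hk := Fin.ext h
    rw [this]
    exact mid_spider_arm hk b

theorem spider_exists_adj (hk : k ≤ D) (hD : 3 ≤ D) (s : SpiderVertex k D) :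
    ∃ t, (spider k D).Adj s t := by
  rcases s with s | i | ⟨j, e⟩
  · exact ⟨_, spider_adj_centre_arm ⟨0, by omega⟩⟩
  · exact ⟨_, (spider_adj_centre_arm i).symm⟩
  · exact ⟨_, (spider_adj_arm_leaf hk j e).symm⟩

variable {V : Type*} {G : SimpleGraph V}

theorem mid_iff [Finite V] {v : V} : Mid G v ↔ 3 ≤ (G.neighborSet v).ncard := by
  have h := Set.two_lt_ncard_iff (s := G.neighborSet v) (Set.toFinite _)
  change Mid G v ↔ 2 < (G.neighborSet v).ncard
  rw [h]
  rfl

theorem Mid.exists_two {v : V} (hv : Mid G v) (z : V) :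
    ∃ b : Fin 2 → V, (∀ e, G.Adj v (b e) ∧ b e ≠ z) ∧ Function.Injective b := by
  obtain ⟨x, y, w, hx, hy, hw, hxy, hxw, hyw⟩ := hv
  have key : ∀ p q, G.Adj v p → G.Adj v q → p ≠ q → p ≠ z → q ≠ z →
      ∃ b : Fin 2 → V, (∀ e, G.Adj v (b e) ∧ b e ≠ z) ∧ Function.Injective b := by
    intro p q hp hq hpq hpz hqz
    refine ⟨![p, q], fun e => ?_, fun e e' he => ?_⟩
    · fin_cases e
      · exact ⟨hp, hpz⟩
      · exact ⟨hq, hqz⟩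
    · fin_cases e <;> fin_cases e' <;> simp_all
  by_cases hxz : x = z
  · subst hxz
    exact key y w hy hw hyw hxy.symm hxw.symm
  · by_cases hyz : y = z
    · subst hyz
      exact key x w hx hw hxw hxz hyw.symm
    · exact key x y hx hy hxy hxz hyz

/-- In a graph without triangles and quadrilaterals, a vertex of degree at least `D` with `k`
neighbours of degree at least three is the centre of a spider. -/
theorem exists_spider [Finite V] (hk : k ≤ D) (h3 : ∀ c, ¬ IsSub (cyc 3) G c)
    (h4 : ∀ c, ¬ IsSub (cyc 4) G c) {z : V} (hD : D ≤ (G.neighborSet z).ncard) {m : Fin k → V}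
    (hm : Function.Injective m) (hadj : ∀ j, G.Adj z (m j)) (hmid : ∀ j, Mid G (m j)) :
    ∃ f, IsSub (spider k D) G f ∧ f centre = z ∧ ∀ j : Fin k, f (arm (j.castLE hk)) = m j := by
  classical
  have := Fintype.ofFinite V
  have htri : ∀ {a b c}, G.Adj a b → G.Adj b c → G.Adj c a → False := fun h1 h2 h3' => by
    obtain ⟨c, hc⟩ := isSub_cyc_three h1 h2 h3'
    exact h3 c hc
  have hquad : ∀ {a b c d}, G.Adj a b → G.Adj b c → G.Adj c d → G.Adj d a → a ≠ c → b ≠ d →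
      False := fun h1 h2 h3 h4' hac hbd => by
    obtain ⟨c, hc⟩ := isSub_cyc_four h1 h2 h3 h4' hac hbd
    exact h4 c hc
  obtain ⟨t, hmt, htN, htD⟩ := Finset.exists_subsuperset_card_eq
    (s := Finset.univ.image m) (t := (G.neighborSet z).toFinset) (n := D) (by
      intro x hx
      obtain ⟨j, -, rfl⟩ := Finset.mem_image.1 hx
      simpa using hadj j) (by
      rw [Finset.card_image_of_injective _ hm]
      simpa using hk) (by
      rwa [Set.ncard_eq_toFinset_card'] at hD)
  obtain ⟨α, hα⟩ := Finset.exists_equiv_extend_of_card_eq (α := Fin D) (t := t)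
    (s := Finset.univ.filter fun i : Fin D => (i : ℕ) < k)
    (f := fun i => if h : (i : ℕ) < k then m ⟨i, h⟩ else z) (by simp [htD]) (by
      intro x hx
      obtain ⟨i, hi, rfl⟩ := Finset.mem_image.1 hx
      simp only [Finset.mem_filter, Finset.mem_univ, true_and] at hi
      rw [dif_pos hi]
      exact hmt (Finset.mem_image.2 ⟨_, Finset.mem_univ _, rfl⟩)) (by
      intro i hi j hj hij
      simp only [Finset.coe_filter, Finset.mem_univ, true_and, Set.mem_ofPred_eq] at hi hj
      simp only [dif_pos hi, dif_pos hj] at hij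
      have := hm hij
      simpa [Fin.ext_iff] using this)
  have hαm : ∀ j : Fin k, (α (j.castLE hk) : V) = m j := by
    intro j
    rw [hα _ (by simp)]
    simp
  have hαadj : ∀ i, G.Adj z (α i) := by
    intro i
    have := htN (α i).2
    simpa using this
  choose β hβ hβi using fun j => (hmid j).exists_two z
  let f : SpiderVertex k D → V :=
    Sum.elim (fun _ => z) (Sum.elim (fun i => α i) (fun p => β p.1 p.2))
  -- A leaf that is also an arm would give a triangle; a leaf shared by two arms would give a
  -- quadrilateral.
  have hβα : ∀ j e i, β j e ≠ α i := by
    intro j e i he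
    have h1 := (hβ j e).1
    rw [he] at h1
    exact htri (hadj j) h1 (hαadj i).symm
  refine ⟨f, ⟨?_, ?_⟩, rfl, hαm⟩
  · rintro (a | i | ⟨j, e⟩) (b | i' | ⟨j', e'⟩) hab
    · rfl
    · exact absurd hab (hαadj i').ne
    · exact absurd hab.symm (hβ j' e').2
    · exact absurd hab.symm (hαadj i).ne
    · have := α.injective (Subtype.ext hab)
      rw [this]
    · exact absurd hab.symm (hβα _ _ _)
    · exact absurd hab (hβ j e).2
    · exact absurd hab (hβα _ _ _)
    · change β j e = β j' e' at hab
      by_cases hj : j = j'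
      · subst hj
        rw [hβi j hab]
      · exfalso
        have h1 := (hβ j' e').1
        rw [← hab] at h1
        exact hquad (hadj j) (hβ j e).1 h1.symm (hadj j').symm (hβ j e).2.symm (hm.ne hj)
  · have key : ∀ a b : SpiderVertex k D, Below a b → G.Adj (f a) (f b) := by
      rintro (a | a | a) (b | b | ⟨b, e⟩) h <;> simp only [Below] at h
      · exact hαadj b
      · have : a = b.castLE hk := Fin.ext h
        rw [this]
        change G.Adj (α (b.castLE hk)) (β b e)
        rw [hαm]
        exact (hβ b e).1
    rintro a b (h | h)
    · exact key a b h
    · exact (key b a h).symm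

/-- A vertex to which a vertex of degree at most one in another component can be joined without
creating new spiders. -/
def IsGood (k D : ℕ) {V : Type*} (G : SimpleGraph V) (v : V) : Prop :=
  ((G.neighborSet v).ncard ≠ 2 ∧ ¬ ((G.neighborSet v).ncard + 1 = D ∧
    ∃ m : Fin k → V, Function.Injective m ∧ ∀ j, G.Adj v (m j) ∧ Mid G (m j))) ∨
  ((G.neighborSet v).ncard = 2 ∧ ∀ w, G.Adj v w → ¬ Mid G w)

/-- The vertex `x` belongs to a spider. -/
def InSpider (k D : ℕ) {V : Type*} (G : SimpleGraph V) (x : V) : Prop :=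
  ∃ f s, IsSub (spider k D) G f ∧ f s = x

/-- Otherwise the edge leaving the spider is a clash: either its end is not a leaf of the spider, or
that leaf has degree at least three and so two additional edges. -/
theorem InSpider.of_adj_mid (hk : k ≤ D) (hD : 3 ≤ D) (hG : ¬ SpiderClash k D G) {u w : V}
    (hu : InSpider k D G u) (hm : Mid G u) (hw : G.Adj u w) : InSpider k D G w := by
  obtain ⟨f, s, hf, rfl⟩ := hu
  by_contra hn
  have hw' : ∀ t, w ≠ f t := fun t h => hn ⟨f, t, hf, h.symm⟩
  refine hG (Or.inl ⟨f, s, w, hf, hw, fun t _ => hw' t, ?_⟩)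
  by_cases hs : Mid (spider k D) s
  · exact Or.inl hs
  right; left
  obtain ⟨t, ht⟩ := spider_exists_adj hk hD s
  have hleaf : ∀ t', (spider k D).Adj s t' → t' = t := fun t' ht' =>
    spider_subsingleton_of_not_mid hk hD hs _ _ ht' ht
  obtain ⟨b, hb, hbi⟩ := hm.exists_two (f t)
  by_cases h0 : w = b 0
  · refine ⟨b 1, ?_, (hb 1).1, fun t' ht' => by rw [hleaf t' ht']; exact (hb 1).2⟩
    rw [h0]
    exact hbi.ne (by simp)
  · exact ⟨b 0, h0, (hb 0).1, fun t' ht' => by rw [hleaf t' ht']; exact (hb 0).2⟩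

/-- If not all degrees outside the spiders are two, a vertex with another degree is good unless it
has degree D - 1 and k neighbours of degree at least three. Such neighbours lie outside the spiders
too, so they are of the same kind, and for k = 2 four consecutive vertices of degree at least three
arise. -/
theorem exists_isGood [Finite V] (hk : k ≤ D) (hD : 3 ≤ D) (hkD : k = 2 ∨ D = 3)
    (hG : ¬ SpiderClash k D G) {x : V} (hx : ¬ InSpider k D G x) :
    ∃ v, G.Reachable x v ∧ ¬ InSpider k D G v ∧ IsGood k D G v := by
  have hnbr : ∀ {y w}, ¬ InSpider k D G y → G.Adj y w → Mid G w → ¬ InSpider k D G w :=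
    fun hy hyw hw h => hy (h.of_adj_mid hk hD hG hw hyw.symm)
  by_cases hall : ∀ y, G.Reachable x y → ¬ InSpider k D G y → (G.neighborSet y).ncard = 2
  · refine ⟨x, Reachable.rfl, hx, Or.inr ⟨hall x Reachable.rfl hx, fun w hw hm => ?_⟩⟩
    have := hall w hw.reachable (hnbr hx hw hm)
    rw [mid_iff, this] at hm
    omega
  push Not at hall
  obtain ⟨y, hxy, hy, hdeg⟩ := hall
  by_contra hno
  push Not at hno
  have key : ∀ v, G.Reachable x v → ¬ InSpider k D G v → (G.neighborSet v).ncard ≠ 2 →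
      (G.neighborSet v).ncard + 1 = D ∧
        ∃ m : Fin k → V, Function.Injective m ∧ ∀ j, G.Adj v (m j) ∧ Mid G (m j) := by
    intro v h1 h2 h3
    by_contra hcon
    exact hno v h1 h2 (Or.inl ⟨h3, hcon⟩)
  obtain ⟨hd, m, hm, hmy⟩ := key y hxy hy hdeg
  -- For D = 3 the degree would be D - 1 = 2, which is excluded.
  have hk2 : k = 2 := by
    rcases hkD with h | h
    · exact h
    · omega
  subst hk2
  have hymid : Mid G y := by rw [mid_iff]; omega
  have hu := hnbr hy (hmy 0).1 (hmy 0).2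
  have hudeg : (G.neighborSet (m 0)).ncard ≠ 2 := by
    have := mid_iff.1 (hmy 0).2
    omega
  obtain ⟨-, m', hm', hmu⟩ := key (m 0) (hxy.trans (hmy 0).1.reachable) hu hudeg
  obtain ⟨j, hj⟩ : ∃ j, y ≠ m' j := by
    by_contra hcon
    push Not at hcon
    exact absurd (hm' ((hcon 0).symm.trans (hcon 1))) (by simp)
  refine hG (Or.inr ⟨![m 1, y, m 0, m' j], fun i => ?_, (hmy 1).1.symm, (hmy 0).1, (hmu j).1,
    hm.ne (by simp), hj⟩)
  fin_cases i
  exacts [(hmy 1).2, hymid, (hmy 0).2, (hmu j).2]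

/-- The end `v'` has degree at most two afterwards, and `v` was chosen so that its new degree
neither makes it a centre nor creates an edge between vertices of degree at least three. Thus no new
spider arises. If `v'` lies in a spider, the new edge is a single additional edge from a leaf to a
vertex outside the spiders, which the definition of a clash tolerates. -/
theorem not_spiderClash_sup_edge [Finite V] (hk : k ≤ D) (hk1 : 1 ≤ k) (hD : 3 ≤ D)
    (h3 : ∀ c, ¬ IsSub (cyc 3) G c) (h4 : ∀ c, ¬ IsSub (cyc 4) G c)
    (hG : ¬ SpiderClash k D G) {v v' : V} (hv : ¬ InSpider k D G v) (hgood : IsGood k D G v)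
    (hv' : ∀ a b, G.Adj v' a → G.Adj v' b → a = b) (hr : ¬ G.Reachable v v') :
    ¬ SpiderClash k D (G ⊔ edge v v') := by
  set G' := G ⊔ edge v v' with hG'
  have hne : v ≠ v' := fun h => hr (h ▸ Reachable.rfl)
  have hnadj : ¬ G.Adj v v' := fun h => hr h.reachable
  have hadj : ∀ {a b}, G'.Adj a b → G.Adj a b ∨ (a = v ∧ b = v') ∨ (a = v' ∧ b = v) := by
    intro a b h
    rcases h with h | h
    · exact Or.inl h
    · rw [edge_adj] at h
      exact Or.inr h.1
  have hle : G ≤ G' := le_sup_left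
  have hNv : (G'.neighborSet v).ncard = (G.neighborSet v).ncard + 1 := by
    have : G'.neighborSet v = insert v' (G.neighborSet v) := by
      ext b
      simp only [mem_neighborSet, Set.mem_insert_iff]
      constructor
      · intro h
        rcases hadj h with h | ⟨-, h⟩ | ⟨h, -⟩
        · exact Or.inr h
        · exact Or.inl h
        · exact absurd h hne
      · rintro (rfl | h)
        · exact Or.inr (by simp [edge_adj, hne])
        · exact hle h
    rw [this, Set.ncard_insert_of_notMem (by simpa using hnadj)]
  have hNx : ∀ x, x ≠ v → x ≠ v' → G'.neighborSet x = G.neighborSet x := by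
    intro x hx hx'
    ext b
    simp only [mem_neighborSet]
    refine ⟨fun h => ?_, fun h => hle h⟩
    rcases hadj h with h | ⟨h, -⟩ | ⟨h, -⟩
    · exact h
    · exact absurd h hx
    · exact absurd h hx'
  have hmidx : ∀ x, x ≠ v → x ≠ v' → Mid G' x → Mid G x := by
    intro x hx hx' h
    rwa [mid_iff, hNx x hx hx', ← mid_iff] at h
  have hmidv' : ¬ Mid G' v' := by
    intro h
    obtain ⟨b, hb, hbi⟩ := h.exists_two v
    have key : ∀ e, G.Adj v' (b e) := by
      intro e
      rcases hadj (hb e).1 with h | ⟨h, -⟩ | ⟨-, h⟩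
      · exact h
      · exact absurd h.symm hne
      · exact absurd h (hb e).2
    exact absurd (hbi (hv' _ _ (key 0) (key 1))) (by simp)
  -- Adjacent vertices of degree at least three are the same before and after. Only `v` may gain
  -- that property, and in this case, being good, it has no neighbour of degree at least three.
  have hmid : ∀ {x y}, Mid G' x → Mid G' y → G'.Adj x y → G.Adj x y ∧ Mid G x ∧ Mid G y := by
    have aux : ∀ {x y}, Mid G' x → Mid G' y → G'.Adj x y → G.Adj x y := by
      intro x y hx hy hxy
      rcases hadj hxy with h | ⟨-, rfl⟩ | ⟨rfl, -⟩
      · exact h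
      · exact absurd hy hmidv'
      · exact absurd hx hmidv'
    have auxv : ∀ {y}, Mid G' v → Mid G' y → G'.Adj v y → Mid G v ∧ Mid G y := by
      intro y hx hy hxy
      have h1 := aux hx hy hxy
      have h2 := hmidx y hxy.ne' (fun h => hmidv' (h ▸ hy)) hy
      refine ⟨?_, h2⟩
      rcases hgood with h | h
      · rw [mid_iff, hNv] at hx
        rw [mid_iff]
        have := h.1
        omega
      · exact absurd h2 (h.2 y h1)
    intro x y hx hy hxy
    refine ⟨aux hx hy hxy, ?_⟩
    by_cases hxv : x = v
    · subst hxv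
      exact auxv hx hy hxy
    by_cases hyv : y = v
    · subst hyv
      exact (auxv hy hx hxy.symm).symm
    exact ⟨hmidx x hxv (fun h => hmidv' (h ▸ hx)) hx, hmidx y hyv (fun h => hmidv' (h ▸ hy)) hy⟩
  -- Centres and arms with leaves that satisfy the degree conditions in `G` already belong to
  -- spiders there, so they differ from `v`.
  have hcover : ∀ z, D ≤ (G.neighborSet z).ncard → ∀ m : Fin k → V, Function.Injective m →
      (∀ j, G.Adj z (m j)) → (∀ j, Mid G (m j)) → z ≠ v ∧ ∀ j, m j ≠ v := by
    intro z hz m hm h1 h2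
    obtain ⟨f, hf, hc, ha⟩ := exists_spider hk h3 h4 hz hm h1 h2
    exact ⟨fun h => hv ⟨f, _, hf, hc.trans h⟩, fun j h => hv ⟨f, _, hf, (ha j).trans h⟩⟩
  have hsub : ∀ {f}, IsSub (spider k D) G' f → IsSub (spider k D) G f := by
    intro f hf
    have hcm : Mid G' (f centre) := hf.mid (mid_spider_centre hD)
    have hcD : D ≤ (G'.neighborSet (f centre)).ncard := by
      have h1 : Set.range (fun i : Fin D => f (arm i)) ⊆ G'.neighborSet (f centre) := by
        rintro _ ⟨i, rfl⟩
        exact hf.adj (spider_adj_centre_arm i)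
      have h2 := Set.ncard_le_ncard h1 (Set.toFinite _)
      rwa [Set.ncard_range_of_injective (fun i j hij => by simpa using hf.inj hij),
        Nat.card_fin] at h2
    have harm := fun j : Fin k => hmid hcm (hf.mid (mid_spider_arm hk j))
      (hf.adj (spider_adj_centre_arm _))
    have hminj : Function.Injective fun j : Fin k => f (arm (j.castLE hk)) := fun i j hij => by
      simpa using hf.inj hij
    -- In a spider using the new edge, `v'` could only be the outer end, so `v` would be the centre
    -- or an arm with leaves.
    have hbad : ∀ {a b}, (spider k D).Adj a b → f a = v → f b = v' → False := by
      intro a b hab ha hb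
      have hb' : ¬ Mid (spider k D) b := fun h => hmidv' (hb ▸ hf.mid h)
      have ha' : Below a b := by
        rcases hab with h | h
        · exact h
        · exact absurd (h.mid hk hD) hb'
      rcases spider_cases hk a with rfl | ⟨j, rfl⟩ | hs
      · have hcov := fun hdeg => (hcover (f centre) hdeg _ hminj (fun j => (harm j).1)
          (fun j => (harm j).2.2)).1 ha
        rw [ha] at hcD hcov
        rw [hNv] at hcD
        rcases hgood with h | h
        · refine hcov ?_
          by_contra hlt
          refine h.2 ⟨by omega, _, hminj, fun j => ⟨?_, (harm j).2.2⟩⟩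
          rw [← ha]
          exact (harm j).1
        · refine h.2 _ ?_ (harm ⟨0, hk1⟩).2.2
          rw [← ha]
          exact (harm ⟨0, hk1⟩).1
      · refine (hcover (f centre) ?_ _ hminj (fun j => (harm j).1) (fun j => (harm j).2.2)).2 j ha
        rwa [hNx] at hcD
        · rw [← ha]
          exact hf.inj.ne (by simp)
        · exact fun h => hmidv' (h ▸ hcm)
      · exact not_mid_of_subsingleton hs (ha'.mid hk hD)
    refine ⟨hf.inj, fun {a b} hab => ?_⟩
    rcases hadj (hf.adj hab) with h | ⟨h, h'⟩ | ⟨h, h'⟩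
    · exact h
    · exact (hbad hab h h').elim
    · exact (hbad hab.symm h' h).elim
  rintro (⟨f, s, w, hf, hfw, hw, h⟩ | ⟨x, hx, h1, h2, h3, h4, h5⟩)
  · have hf' := hsub hf
    obtain ⟨t, ht⟩ := spider_exists_adj hk hD s
    have hfs : f s ≠ v := fun h => hv ⟨f, s, hf', h⟩
    have hnew : ∀ {w}, G'.Adj (f s) w → ¬ G.Adj (f s) w → f s = v' ∧ w = v := by
      intro w h1 h2
      rcases hadj h1 with h | ⟨h, -⟩ | h
      · exact absurd h h2
      · exact absurd h hfs
      · exact h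
    have hend : ∀ {w}, G.Adj (f s) w → f s = v' → w = f t := by
      intro w h1 h2
      have h3 := hf'.adj ht
      rw [h2] at h1 h3
      exact hv' _ _ h1 h3
    by_cases hold : G.Adj (f s) w
    · refine hG (Or.inl ⟨f, s, w, hf', hold, hw, ?_⟩)
      rcases h with h | ⟨w', hww', hfw', hw'⟩ | ⟨g, s', hg, rfl⟩
      · exact Or.inl h
      · by_cases hold' : G.Adj (f s) w'
        · exact Or.inr (Or.inl ⟨w', hww', hold', hw'⟩)
        · exact absurd (hend hold (hnew hfw' hold').1) (hw t ht)
      · exact Or.inr (Or.inr ⟨g, s', hsub hg, rfl⟩)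
    · obtain ⟨hs, rfl⟩ := hnew hfw hold
      rcases h with h | ⟨w', hww', hfw', hw'⟩ | ⟨g, s', hg, hgs⟩
      · exact hmidv' (hs ▸ hf.mid h)
      · by_cases hold' : G.Adj (f s) w'
        · exact absurd (hend hold' hs) (hw' t ht)
        · exact hww' (hnew hfw' hold').2.symm
      · exact hv ⟨g, s', hsub hg, hgs.symm⟩
  · have e1 := hmid (hx 0) (hx 1) h1
    have e2 := hmid (hx 1) (hx 2) h2
    have e3 := hmid (hx 2) (hx 3) h3
    refine hG (Or.inr ⟨x, fun i => ?_, e1.1, e2.1, e3.1, h4, h5⟩)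
    fin_cases i
    exacts [e1.2.1, e1.2.2, e2.2.2, e3.2.2]

end SpiderConstruction

/-! ### Tree components of a saturated graph. -/

theorem exists_end_of_isTree {V : Type*} [Finite V] {G : SimpleGraph V} {K : G.ConnectedComponent}
    (hK : K.toSimpleGraph.IsTree) :
    ∃ u, G.connectedComponentMk u = K ∧ ∀ a b, G.Adj u a → G.Adj u b → a = b := by
  classical
  have := Fintype.ofFinite V
  have hmem : ∀ (u : K) a, G.Adj u a → a ∈ K.supp := fun u a h =>
    (ConnectedComponent.connectedComponentMk_eq_of_adj h).symm.trans u.2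
  rcases subsingleton_or_nontrivial K with hs | hn
  · obtain ⟨u⟩ := hK.1.nonempty
    refine ⟨u, u.2, fun a b ha _ => ?_⟩
    have h1 := Subsingleton.elim u ⟨a, hmem u a ha⟩
    exact absurd (congrArg Subtype.val h1) ha.ne
  · have := Fintype.ofFinite K
    obtain ⟨u, hu⟩ := hK.exists_vert_degree_one_of_nontrivial
    obtain ⟨s, hs, hs'⟩ := (degree_eq_one_iff_existsUnique_adj).1 hu
    refine ⟨u, u.2, fun a b ha hb => ?_⟩
    have h1 := hs' ⟨a, hmem u a ha⟩ ha
    have h2 := hs' ⟨b, hmem u b hb⟩ hb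
    exact congrArg Subtype.val (h1.trans h2.symm)

section Lower

variable {L : Set ℕ} {ρ : ℕ → ℕ} {V : Type*} {G : SimpleGraph V}

/-- Every clash contains a triangle, a quadrilateral or a special cycle, and an edge between two
components lies on no cycle. -/
theorem preconnected_of_no_cycle (hL : IsGauge L ρ) (hG : ¬ Clash L ρ G)
    (hsat : ∀ u v, u ≠ v → ¬ G.Adj u v → Clash L ρ (G ⊔ edge u v))
    (hno : ∀ h ∈ L, ∀ c : ZMod h → V, ¬ IsSub (cyc h) G c) : G.Preconnected := by
  intro u v
  by_contra hr
  have hne : u ≠ v := fun h => hr (h ▸ Reachable.rfl)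
  rcases hsat u v hne (fun h => hr h.reachable) with ⟨c, hc⟩ | ⟨c, hc⟩ | ⟨h, hh, c, hc, -⟩
  · exact hG (Or.inl ⟨c, hc.cyc_of_sup_edge hr le_rfl⟩)
  · exact hG (Or.inr (Or.inl ⟨c, hc.cyc_of_sup_edge hr (by omega)⟩))
  · exact hno h hh c (hc.cyc_of_sup_edge hr (by have := (hL h hh).1; omega))

variable {h : ℕ} {c : ZMod h → V}

theorem isCycleComponent_of_not_clash (hG : ¬ Clash L ρ G) (hh : h ∈ L)
    (hc : IsSub (cyc h) G c) : IsCycleComponent G c := by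
  refine ⟨hc, fun {i w} hw => ?_⟩
  by_contra hcon
  push Not at hcon
  exact hG (Or.inr (Or.inr ⟨h, hh, c, hc, Or.inr (Or.inl ⟨i, w, hw, hcon⟩)⟩))

/-- What can go wrong when an edge is added between two components. -/
theorem clash_cases_of_sup_edge (hL : IsGauge L ρ) (hG : ¬ Clash L ρ G) (hh : h ∈ L)
    (hc : IsSub (cyc h) G c) {u v : V} (hu : u ∉ Set.range c) (hv : v ∉ Set.range c)
    (hr : ¬ G.Reachable u v) (hcl : Clash L ρ (G ⊔ edge u v)) :
    (ρ h ∈ smallOrders ∧ ∃ (Y : SimpleGraph (Fin (2 * ρ h))) (g : _), Y.Preconnected ∧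
      IsSub Y (G ⊔ edge u v) g ∧ ∀ i j, c i ≠ g j) ∨
    (ρ h ∉ smallOrders ∧ SpiderClash (legs (ρ h)) (arms (ρ h)) (G ⊔ edge u v)) := by
  have h5 := (hL h hh).1
  have hcomp := isCycleComponent_of_not_clash hG hh hc
  rcases hcl with ⟨c', hc'⟩ | ⟨c', hc'⟩ | ⟨h', hh', c', hc', hcl⟩
  · exact absurd (Or.inl ⟨c', hc'.cyc_of_sup_edge hr le_rfl⟩) hG
  · exact absurd (Or.inr (Or.inl ⟨c', hc'.cyc_of_sup_edge hr (by omega)⟩)) hG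
  have h5' := (hL h' hh').1
  replace hc' := hc'.cyc_of_sup_edge hr (by omega)
  by_cases hmeet : ∃ i j, c i = c' j
  swap
  · push Not at hmeet
    exact absurd (Or.inr (Or.inr ⟨h, hh, c, hc, Or.inl ⟨h', hh', c', hc', hmeet⟩⟩)) hG
  obtain ⟨i, j, hij⟩ := hmeet
  obtain ⟨hcomp', hrange, rfl⟩ := hcomp.of_meets (by omega) (by omega) hc' hij.symm
  rcases hcl with ⟨h'', hh'', c'', hc'', hd⟩ | ⟨i, w, hadj, h1, h2⟩ | ⟨hs, Y, g, hY, hg, hd⟩ |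
    ⟨hs, hn⟩
  · have h5'' := (hL h'' hh'').1
    exact absurd (Or.inr (Or.inr ⟨h', hh', c', hc', Or.inl ⟨h'', hh'', c'',
      hc''.cyc_of_sup_edge hr (by omega), hd⟩⟩)) hG
  · exfalso
    have hci : c' i ∈ Set.range c := hrange ▸ ⟨i, rfl⟩
    rcases hadj with hadj | hadj
    · rcases hcomp'.eq_or_eq hadj with h | h
      · exact h1 h
      · exact h2 h
    · rw [edge_adj] at hadj
      rcases hadj.1 with ⟨h, -⟩ | ⟨h, -⟩
      · exact hu (h ▸ hci)
      · exact hv (h ▸ hci)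
  · refine Or.inl ⟨hs, Y, g, hY, hg, fun i j he => ?_⟩
    have hci : c i ∈ Set.range c' := hrange ▸ ⟨i, rfl⟩
    obtain ⟨i', hi'⟩ := hci
    exact hd i' j (hi'.trans he)
  · exact Or.inr ⟨hs, hn⟩

theorem end_notMem_range (hh : 3 ≤ h) (hc : IsSub (cyc h) G c) {u : V}
    (hu : ∀ a b, G.Adj u a → G.Adj u b → a = b) : u ∉ Set.range c := by
  rintro ⟨i, rfl⟩
  exact ZMod.add_one_ne_sub_one hh i (hc.inj (hu _ _ (hc.adj (cyc_adj_add_one hh i))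
    (hc.adj (cyc_adj_sub_one hh i))))

theorem not_inSpider_of_mem_range {k D : ℕ} (hk : k ≤ D) (hD : 3 ≤ D) (hc : IsCycleComponent G c)
    {x : V} (hx : x ∈ Set.range c) : ¬ InSpider k D G x := by
  rintro ⟨f, s, hf, rfl⟩
  obtain ⟨i, hi⟩ := hf.mem_of_closed (spider_preconnected hk) hc.mem_range_of_adj hx .centre
  exact hc.not_mid i (hi ▸ hf.mid (mid_spider_centre hD))

theorem card_component_eq {s : Set V} {x : V} (hx : x ∈ s)
    (hcl : ∀ a b, a ∈ s → G.Adj a b → b ∈ s) (hs : ∀ a ∈ s, G.Reachable x a) :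
    Nat.card (G.connectedComponentMk x) = s.ncard := by
  rw [← Nat.card_coe_set_eq]
  have : (G.connectedComponentMk x).supp = s := by
    ext y
    constructor
    · intro hy
      obtain ⟨p⟩ := (ConnectedComponent.exact hy).symm
      clear hy hs
      induction p with
      | nil => exact hx
      | cons h p ih => exact ih (hcl _ _ hx h)
    · intro hy
      exact (ConnectedComponent.sound (hs y hy)).symm
  change Nat.card (G.connectedComponentMk x).supp = _
  rw [this]

/-- If all vertices outside the cycle belong to spiders, then the other components are spiders. -/
theorem card_eq_of_forall_inSpider {k D : ℕ} (hk : k ≤ D) (hD : 3 ≤ D) (hh : 3 ≤ h)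
    (hc : IsCycleComponent G c) (hG : ¬ SpiderClash k D G)
    (hall : ∀ x, x ∉ Set.range c → InSpider k D G x) (K : G.ConnectedComponent) :
    (K = G.connectedComponentMk (c 0) ∧ Nat.card K = h) ∨ Nat.card K = 1 + D + 2 * k := by
  have : NeZero h := ⟨by omega⟩
  induction K using ConnectedComponent.ind with
  | _ x =>
    by_cases hx : x ∈ Set.range c
    · left
      obtain ⟨i, rfl⟩ := hx
      constructor
      · exact ConnectedComponent.sound (hc.isSub.reachable (cyc_preconnected hh i 0))
      · rw [card_component_eq (s := Set.range c) ⟨i, rfl⟩ hc.mem_range_of_adj, Set.ncard_range_of_injective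
          hc.isSub.inj, Nat.card_zmod]
        rintro _ ⟨j, rfl⟩
        exact hc.isSub.reachable (cyc_preconnected hh i j)
    · right
      obtain ⟨f, s, hf, rfl⟩ := hall x hx
      rw [card_component_eq (s := Set.range f) ⟨s, rfl⟩, Set.ncard_range_of_injective hf.inj]
      · simp only [Nat.card_eq_fintype_card, Fintype.card_sum, Fintype.card_unit, Fintype.card_fin,
          Fintype.card_prod]
        ring
      · rintro _ b ⟨a, rfl⟩ hab
        have hb : b ∉ Set.range c := fun hb =>
          not_inSpider_of_mem_range hk hD hc (hc.mem_range_of_adj _ _ hb hab.symm) ⟨f, a, hf, rfl⟩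
        obtain ⟨g, s', hg, rfl⟩ := hall b hb
        by_contra hn
        exact hG (Or.inl ⟨f, a, g s', hf, hab, fun t _ he => hn ⟨t, he.symm⟩,
          Or.inr (Or.inr ⟨g, s', hg, rfl⟩)⟩)
      · rintro _ ⟨a, rfl⟩
        exact hf.reachable (spider_preconnected hk s a)

variable [Finite V]

/-- In the case of a small order, all but one of the components that are trees are large. -/
theorem treeComponents_le_of_small (hL : IsGauge L ρ) (hG : ¬ Clash L ρ G)
    (hsat : ∀ u v, u ≠ v → ¬ G.Adj u v → Clash L ρ (G ⊔ edge u v)) (hh : h ∈ L)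
    (hc : IsSub (cyc h) G c) (hs : ρ h ∈ smallOrders) :
    {K : G.ConnectedComponent | K.toSimpleGraph.IsTree}.ncard ≤ treeCountGE G (ρ h) + 1 := by
  have h5 := (hL h hh).1
  have hr1 := (hL h hh).2.1
  -- Joining ends of two small trees must create a connected subgraph on 2r vertices. Since it did
  -- not exist before, it uses the new edge and lies in the two trees, which together have fewer
  -- than 2r vertices.
  have hone : {K : G.ConnectedComponent | K.toSimpleGraph.IsTree ∧ Nat.card K < ρ h}.ncard ≤ 1 := by
    rw [Set.ncard_le_one (Set.toFinite _)]
    rintro K ⟨hK, hKr⟩ K' ⟨hK', hKr'⟩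
    by_contra hne
    obtain ⟨u, rfl, hu⟩ := exists_end_of_isTree hK
    obtain ⟨v, rfl, hv⟩ := exists_end_of_isTree hK'
    have hr : ¬ G.Reachable u v := fun h => hne (ConnectedComponent.sound h)
    have huv : u ≠ v := fun h => hne (h ▸ rfl)
    rcases clash_cases_of_sup_edge hL hG hh hc (end_notMem_range (by omega) hc hu)
      (end_notMem_range (by omega) hc hv) hr (hsat u v huv fun h => hr h.reachable) with
      ⟨-, Y, g, hY, hg, hd⟩ | ⟨hs', -⟩
    swap
    · exact hs' hs
    by_cases hug : ∃ j, g j = u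
    · obtain ⟨j, hj⟩ := hug
      let s : Set V := (G.connectedComponentMk u).supp ∪ (G.connectedComponentMk v).supp
      have hcl : ∀ a b, a ∈ s → (G ⊔ edge u v).Adj a b → b ∈ s := by
        rintro a b ha (hab | hab)
        · have hab' := ConnectedComponent.connectedComponentMk_eq_of_adj hab
          rcases ha with ha | ha
          · exact Or.inl (hab'.symm.trans ha)
          · exact Or.inr (hab'.symm.trans ha)
        · rw [edge_adj] at hab
          rcases hab.1 with ⟨-, rfl⟩ | ⟨-, rfl⟩
          · exact Or.inr rfl
          · exact Or.inl rfl
      have hmem := hg.mem_of_closed hY hcl (a := j) (by rw [hj]; exact Or.inl rfl)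
      have hsub : Set.range g ⊆ s := by rintro _ ⟨a, rfl⟩; exact hmem a
      have h1 := Set.ncard_le_ncard hsub (Set.toFinite _)
      rw [Set.ncard_range_of_injective hg.inj, Nat.card_fin] at h1
      have h2 := Set.ncard_union_le (G.connectedComponentMk u).supp (G.connectedComponentMk v).supp
      have h3 := h1.trans h2
      rw [← Nat.card_coe_set_eq, ← Nat.card_coe_set_eq (G.connectedComponentMk v).supp] at h3
      change _ ≤ Nat.card (G.connectedComponentMk u) + Nat.card (G.connectedComponentMk v) at h3
      omega
    · push Not at hug
      refine hG (Or.inr (Or.inr ⟨h, hh, c, hc, Or.inr (Or.inr (Or.inl ⟨hs, Y, g, hY,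
        ⟨hg.inj, fun {a b} hab => ?_⟩, hd⟩))⟩))
      rcases hg.adj hab with h | h
      · exact h
      · rw [edge_adj] at h
        rcases h.1 with ⟨h, -⟩ | ⟨-, h⟩
        · exact absurd h (hug _)
        · exact absurd h (hug _)
  have hsub : {K : G.ConnectedComponent | K.toSimpleGraph.IsTree} ⊆
      {K | K.toSimpleGraph.IsTree ∧ ρ h ≤ Nat.card K} ∪
      {K | K.toSimpleGraph.IsTree ∧ Nat.card K < ρ h} := by
    intro K hK
    rcases le_or_gt (ρ h) (Nat.card K) with h | h
    · exact Or.inl ⟨hK, h⟩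
    · exact Or.inr ⟨hK, h⟩
  exact (Set.ncard_le_ncard hsub (Set.toFinite _)).trans ((Set.ncard_union_le _ _).trans
    (Nat.add_le_add_left hone _))

theorem natCast_card_eq_of_components {r : ℕ} (K₀ : G.ConnectedComponent)
    (hK : ∀ K : G.ConnectedComponent, (K = K₀ ∧ Nat.card K = h) ∨ Nat.card K = r)
    (h₀ : Nat.card K₀ = h) : (Nat.card V : ZMod r) = h := by
  classical
  have := Fintype.ofFinite G.ConnectedComponent
  rw [← sum_card_components G, Nat.cast_sum, Finset.sum_eq_single K₀]
  · rw [h₀]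
  · intro K _ hne
    rcases hK K with ⟨h', -⟩ | h'
    · exact absurd h' hne
    · rw [h']; simp
  · simp

/-- In the case of an order that is not small, there is at most one component that is a tree, or all
components but one are spiders. -/
theorem treeComponents_of_not_small (hL : IsGauge L ρ) (hG : ¬ Clash L ρ G)
    (hsat : ∀ u v, u ≠ v → ¬ G.Adj u v → Clash L ρ (G ⊔ edge u v)) (hh : h ∈ L)
    (hc : IsSub (cyc h) G c) (hs : ρ h ∉ smallOrders) :
    {K : G.ConnectedComponent | K.toSimpleGraph.IsTree}.ncard ≤ 1 ∨
    ((Nat.card V : ZMod (ρ h)) = h ∧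
      {K : G.ConnectedComponent | K.toSimpleGraph.IsTree}.ncard ≤ treeCountGE G (ρ h)) := by
  obtain ⟨h5, hr1, hr2⟩ := hL h hh
  have hk := legs_le_arms hr1
  have hD := three_le_arms hr1 hs
  have hcomp := isCycleComponent_of_not_clash hG hh hc
  have hGs : ¬ SpiderClash (legs (ρ h)) (arms (ρ h)) G := fun hn =>
    hG (Or.inr (Or.inr ⟨h, hh, c, hc, Or.inr (Or.inr (Or.inr ⟨hs, hn⟩))⟩))
  -- If the spiders cover everything outside the cycle, all other components have r vertices, which
  -- determines the order modulo r. Otherwise there is a good vertex.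
  by_cases hall : ∀ x, x ∉ Set.range c → InSpider (legs (ρ h)) (arms (ρ h)) G x
  · right
    have hK := card_eq_of_forall_inSpider hk hD (by omega) hcomp hGs hall
    rw [arms_add_legs hr1] at hK
    have h₀ : Nat.card (G.connectedComponentMk (c 0)) = h := by
      have : NeZero h := ⟨by omega⟩
      rw [card_component_eq (s := Set.range c) ⟨0, rfl⟩ hcomp.mem_range_of_adj,
        Set.ncard_range_of_injective hc.inj, Nat.card_zmod]
      rintro _ ⟨j, rfl⟩
      exact hc.reachable (cyc_preconnected (by omega) 0 j)
    refine ⟨natCast_card_eq_of_components _ hK h₀, Set.ncard_le_ncard ?_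
      (Set.toFinite _)⟩
    intro K hKt
    refine ⟨hKt, ?_⟩
    rcases hK K with ⟨-, h'⟩ | h'
    · omega
    · omega
  · left
    push Not at hall
    obtain ⟨x, hx, hxs⟩ := hall
    obtain ⟨v, hxv, hv, hgood⟩ := exists_isGood hk hD (legs_eq_two_or_arms_eq_three hs) hGs hxs
    have hvc : v ∉ Set.range c := by
      rintro ⟨i, rfl⟩
      obtain ⟨p⟩ := hxv.symm
      have key : ∀ {a b : V} (p : G.Walk a b), a ∈ Set.range c → b ∈ Set.range c := by
        intro a b p
        induction p with
        | nil => exact id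
        | cons h p ih => exact fun ha => ih (hcomp.mem_range_of_adj _ _ ha h)
      exact hx (key p ⟨i, rfl⟩)
    -- Joining the good vertex to an end of another component would create no clash, contrary to
    -- saturation. So all ends lie in one component, and every tree component has an end.
    have hend : ∀ u, (∀ a b, G.Adj u a → G.Adj u b → a = b) → G.Reachable v u := by
      intro u hu
      by_contra hr
      have hne : v ≠ u := fun h => hr (h ▸ Reachable.rfl)
      rcases clash_cases_of_sup_edge hL hG hh hc hvc (end_notMem_range (by omega) hc hu) hr
        (hsat v u hne fun h => hr h.reachable) with ⟨hs', -⟩ | ⟨-, hn⟩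
      · exact hs hs'
      · exact not_spiderClash_sup_edge hk (one_le_legs hs) hD (fun c hc => hG (Or.inl ⟨c, hc⟩))
          (fun c hc => hG (Or.inr (Or.inl ⟨c, hc⟩))) hGs hv hgood hu hr hn
    rw [Set.ncard_le_one (Set.toFinite _)]
    intro K hK K' hK'
    obtain ⟨u, rfl, hu⟩ := exists_end_of_isTree hK
    obtain ⟨u', rfl, hu'⟩ := exists_end_of_isTree hK'
    exact ConnectedComponent.sound ((hend u hu).symm.trans (hend u' hu'))

/-- A saturated graph has at most one component that is a tree, or its order is in a class that is
allowed by a special cycle, and then the number of these components is bounded accordingly. -/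
theorem treeComponents_of_isSaturated (hL : IsGauge L ρ) (hG : IsSaturated (clashFamily L ρ) G) :
    {K : G.ConnectedComponent | K.toSimpleGraph.IsTree}.ncard ≤ 1 ∨
    ∃ h ∈ L, (ρ h ∈ smallOrders ∨ (Nat.card V : ZMod (ρ h)) = h) ∧
      ρ h * {K : G.ConnectedComponent | K.toSimpleGraph.IsTree}.ncard ≤ Nat.card V + ρ h := by
  have hfree : ¬ Clash L ρ G := fun h => hG.1 ((containsMember_clashFamily_iff hL).2 h)
  have hsat : ∀ u v, u ≠ v → ¬ G.Adj u v → Clash L ρ (G ⊔ edge u v) := fun u v huv hadj =>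
    (containsMember_clashFamily_iff hL).1 (hG.2 u v huv hadj)
  by_cases hno : ∀ h ∈ L, ∀ c : ZMod h → V, ¬ IsSub (cyc h) G c
  · left
    have hp := preconnected_of_no_cycle hL hfree hsat hno
    rw [Set.ncard_le_one (Set.toFinite _)]
    intro K _ K' _
    induction K using ConnectedComponent.ind with
    | _ u =>
      induction K' using ConnectedComponent.ind with
      | _ v => exact ConnectedComponent.sound (hp u v)
  push Not at hno
  obtain ⟨h, hh, c, hc⟩ := hno
  have hcount := mul_treeCountGE_le G (ρ h)
  by_cases hs : ρ h ∈ smallOrders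
  · refine Or.inr ⟨h, hh, Or.inl hs, ?_⟩
    have := treeComponents_le_of_small hL hfree hsat hh hc hs
    calc ρ h * _ ≤ ρ h * (treeCountGE G (ρ h) + 1) := Nat.mul_le_mul_left _ this
      _ ≤ _ := by rw [mul_add]; omega
  · rcases treeComponents_of_not_small hL hfree hsat hh hc hs with h1 | ⟨h1, h2⟩
    · exact Or.inl h1
    · refine Or.inr ⟨h, hh, Or.inr h1, ?_⟩
      have := Nat.mul_le_mul_left (ρ h) h2
      omega

end Lower

/-! ### The choice of the special lengths and the conclusion. -/

/-- The order associated with a length. -/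
def lengthOrder (h : ℕ) : ℕ := Nat.sqrt (h / 5)

/-- The lengths from 5r² to 5r² + r - 1 represent every residue modulo r and have the order r; the
factor 5 keeps them clear of triangles and quadrilaterals. -/
theorem lengthOrder_eq {r c : ℕ} (hc : c < r) : lengthOrder (5 * r ^ 2 + c) = r := by
  symm
  rw [lengthOrder, Nat.eq_sqrt']
  constructor
  · omega
  · rw [show (r + 1) ^ 2 = r ^ 2 + 2 * r + 1 by ring]
    omega

theorem five_mul_sq_lengthOrder_le (h : ℕ) : 5 * lengthOrder h ^ 2 ≤ h := by
  have := Nat.sqrt_le' (h / 5)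
  change lengthOrder h ^ 2 ≤ _ at this
  omega

theorem lt_five_mul_sq_lengthOrder (h : ℕ) : h < 5 * (lengthOrder h + 1) ^ 2 := by
  have := Nat.lt_succ_sqrt' (h / 5)
  change _ < (lengthOrder h + 1) ^ 2 at this
  omega

/-- The special lengths: those that lie in a class for their order, if that order is needed. -/
def specialLengths (S : (r : ℕ) → Set (ZMod r)) : Set ℕ :=
  {h | 5 ≤ h ∧ (h : ZMod (lengthOrder h)) ∈ S (lengthOrder h) ∧
    (firstCovered S (lengthOrder h)).Nonempty}

theorem isGauge_specialLengths (S : (r : ℕ) → Set (ZMod r)) :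
    IsGauge (specialLengths S) lengthOrder := by
  rintro h ⟨h5, -, -⟩
  have h1 : 1 ≤ lengthOrder h := by
    rw [lengthOrder, Nat.le_sqrt']
    omega
  refine ⟨h5, h1, ?_⟩
  have := five_mul_sq_lengthOrder_le h
  nlinarith

theorem finite_specialLengths {S : (r : ℕ) → Set (ZMod r)}
    (hS : {r : ℕ | 1 ≤ r ∧ (firstCovered S r).Nonempty}.Finite) : (specialLengths S).Finite := by
  obtain ⟨M, hM⟩ := hS.bddAbove
  refine (Set.finite_Iio (5 * (M + 1) ^ 2)).subset fun h hh => ?_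
  have h1 := hM ⟨(isGauge_specialLengths S h hh).2.1, hh.2.2⟩
  have h2 := lt_five_mul_sq_lengthOrder h
  refine Set.mem_Iio.2 (h2.trans_le ?_)
  gcongr

section Final

variable {S : (r : ℕ) → Set (ZMod r)}

/-- For a small order the congruence with the length is lost, but it is not needed: one special
length puts a class into `S r`, which then contains all classes. -/
theorem le_sat_specialLengths (hS : NoneOrAllSmall S) (n : ℕ) :
    n ≤ sat n (clashFamily (specialLengths S) lengthOrder) + 1 ∨
    ∃ r : ℕ, 1 ≤ r ∧ (n : ZMod r) ∈ S r ∧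
      r * n ≤ r * sat n (clashFamily (specialLengths S) lengthOrder) + n + r := by
  have hL := isGauge_specialLengths S
  obtain ⟨G, hG, hsat⟩ := exists_sat (isAdmissible_clashFamily hL) n
  have hcount := card_le_edges_add_treeComponents G
  rw [hsat, Nat.card_fin] at hcount
  rcases treeComponents_of_isSaturated hL hG with h1 | ⟨h, hh, h1, h2⟩
  · left
    omega
  · right
    rw [Nat.card_fin] at h1 h2
    refine ⟨lengthOrder h, (hL h hh).2.1, ?_, ?_⟩
    · rcases h1 with h1 | h1
      · rcases hS (lengthOrder h) (by simpa using h1) with h3 | h3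
        · have := hh.2.1
          rw [h3] at this
          exact this.elim
        · rw [h3]; trivial
      · rw [h1]
        exact hh.2.1
    · have := Nat.mul_le_mul_left (lengthOrder h) hcount
      rw [mul_add] at this
      omega

theorem satAtLeastLinear_specialLengths (hS : NoneOrAllSmall S) :
    SatAtLeastLinear (clashFamily (specialLengths S) lengthOrder) (uncovered S) := by
  refine ⟨fun _ => -1, isLittleO_const_left.2 (Or.inr
    (tendsto_norm_atTop_atTop.comp tendsto_natCast_atTop_atTop)), fun n hn => ?_⟩
  rcases le_sat_specialLengths hS n with h | ⟨r, hr, hmem, -⟩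
  · have : (n : ℝ) ≤ sat n (clashFamily (specialLengths S) lengthOrder) + 1 := by exact_mod_cast h
    linarith
  · exact absurd hmem (hn r hr)

/-- The class that limits the number of tree components has a modulus q ≥ r, as n is first covered
at r; so the bound for q is at least as strong. -/
theorem sat_specialLengths_ge (hS : NoneOrAllSmall S) {r n : ℕ} (hr : 1 ≤ r)
    (hn : n ∈ firstCovered S r) :
    (1 - 1 / (r : ℝ)) * n - 1 ≤ sat n (clashFamily (specialLengths S) lengthOrder) := by
  have hr0 : (0 : ℝ) < r := by exact_mod_cast hr
  have hn0 : (0 : ℝ) ≤ n := Nat.cast_nonneg n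
  rcases le_sat_specialLengths hS n with h | ⟨q, hq, hmem, h⟩
  · have h1 : (n : ℝ) ≤ sat n (clashFamily (specialLengths S) lengthOrder) + 1 := by exact_mod_cast h
    have h2 : 0 ≤ 1 / (r : ℝ) * n := by positivity
    linarith
  · have hrq : r ≤ q := by
      by_contra hlt
      exact hn.2 q hq (by omega) hmem
    have hq0 : (0 : ℝ) < q := by exact_mod_cast hq
    have h1 : (q : ℝ) * n ≤ q * sat n (clashFamily (specialLengths S) lengthOrder) + n + q := by
      exact_mod_cast h
    have h2 : 1 / (q : ℝ) * n ≤ 1 / (r : ℝ) * n := by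
      have : (r : ℝ) ≤ q := by exact_mod_cast hrq
      gcongr
    have h3 : (n : ℝ) ≤ sat n (clashFamily (specialLengths S) lengthOrder) + 1 / (q : ℝ) * n + 1 := by
      rw [← mul_le_mul_iff_right₀ hq0]
      refine h1.trans (le_of_eq ?_)
      field_simp
    linarith

theorem sat_specialLengths_le {r n : ℕ} (hr : 1 ≤ r) (hn : n ∈ firstCovered S r)
    (hlarge : 5 * r ^ 2 + r ≤ n) :
    (sat n (clashFamily (specialLengths S) lengthOrder) : ℝ) ≤
      (1 - 1 / (r : ℝ)) * n + (5 * r ^ 2 + r : ℕ) := by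
  have hr0 : (0 : ℝ) < r := by exact_mod_cast hr
  have hc : n % r < r := Nat.mod_lt _ hr
  -- The special length congruent to n modulo r; the rest of the n vertices go into spiders on r
  -- vertices.
  set h := 5 * r ^ 2 + n % r with hh
  have hρ : lengthOrder h = r := lengthOrder_eq hc
  have hmem : h ∈ specialLengths S := by
    refine ⟨by have : 1 ≤ r ^ 2 := Nat.one_le_pow _ _ hr
               omega, ?_, ?_⟩
    · rw [hρ]
      have : ((h : ℕ) : ZMod r) = n := by
        rw [hh, ZMod.natCast_eq_natCast_iff]
        unfold Nat.ModEq
        rw [sq, ← mul_assoc, Nat.mul_add_mod_self_right, Nat.mod_mod]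
      rw [this]
      exact hn.1
    · rw [hρ]
      exact ⟨n, hn⟩
  obtain ⟨m, hm⟩ : ∃ m, n = h + m * r := by
    refine ⟨n / r - 5 * r, ?_⟩
    have h1 := Nat.div_add_mod n r
    have h2 : 5 * r ≤ n / r := by
      rw [Nat.le_div_iff_mul_le hr]
      nlinarith
    obtain ⟨m, hm⟩ := Nat.exists_eq_add_of_le h2
    rw [hm] at h1
    rw [hm, Nat.add_sub_cancel_left, hh]
    exact h1.symm.trans (by ring)
  have hs := sat_clashFamily_le (isGauge_specialLengths S) hmem m
  rw [hρ, ← hm] at hs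
  have hs' : (sat n (clashFamily (specialLengths S) lengthOrder) : ℝ) ≤ h + m * (r - 1) := by
    have : (sat n (clashFamily (specialLengths S) lengthOrder) : ℝ) ≤
      ((h + m * (r - 1) : ℕ) : ℝ) := by exact_mod_cast hs
    push_cast [Nat.cast_sub hr] at this
    exact this
  have hn' : (n : ℝ) = h + m * r := by rw [hm]; push_cast; ring
  have hb : (h : ℝ) ≤ (5 * r ^ 2 + r : ℕ) := by exact_mod_cast (by omega)
  have hdiv : 1 / (r : ℝ) * h ≤ h := by
    have h1 : 1 / (r : ℝ) ≤ 1 := by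
      rw [div_le_one hr0]
      exact_mod_cast hr
    have : (0 : ℝ) ≤ h := Nat.cast_nonneg h
    nlinarith
  have hexp : (1 - 1 / (r : ℝ)) * n = h + m * (r - 1) - 1 / (r : ℝ) * h := by
    rw [hn']
    field_simp
    ring
  rw [hexp]
  linarith

theorem exists_bound_specialLengths (hS : NoneOrAllSmall S) {r : ℕ} (hr : 1 ≤ r) :
    ∃ B : ℝ, ∀ n ∈ firstCovered S r,
      |(sat n (clashFamily (specialLengths S) lengthOrder) : ℝ) - (1 - 1 / (r : ℝ)) * n| ≤ B := by
  set 𝓕 := clashFamily (specialLengths S) lengthOrder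
  -- The sum takes care of the finitely many orders too small for the construction.
  refine ⟨1 + (5 * r ^ 2 + r : ℕ) + ∑ i ∈ Finset.range (5 * r ^ 2 + r), (sat i 𝓕 : ℝ),
    fun n hn => ?_⟩
  have h1 : (1 - 1 / (r : ℝ)) * n - 1 ≤ sat n 𝓕 := sat_specialLengths_ge hS hr hn
  have h2 : (0 : ℝ) ≤ (5 * r ^ 2 + r : ℕ) := Nat.cast_nonneg _
  have h3 : (0 : ℝ) ≤ ∑ i ∈ Finset.range (5 * r ^ 2 + r), (sat i 𝓕 : ℝ) :=
    Finset.sum_nonneg fun i _ => Nat.cast_nonneg _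
  rw [abs_le]
  refine ⟨by linarith, ?_⟩
  rcases lt_or_ge n (5 * r ^ 2 + r) with h | h
  · have h4 : (sat n 𝓕 : ℝ) ≤ ∑ i ∈ Finset.range (5 * r ^ 2 + r), (sat i 𝓕 : ℝ) :=
      Finset.single_le_sum (f := fun i => (sat i 𝓕 : ℝ)) (fun i _ => Nat.cast_nonneg _)
        (Finset.mem_range.2 h)
    have h5 : 0 ≤ (1 - 1 / (r : ℝ)) * n := by
      have : 1 / (r : ℝ) ≤ 1 := by
        rw [div_le_one (by exact_mod_cast hr)]
        exact_mod_cast hr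
      exact mul_nonneg (by linarith) (Nat.cast_nonneg _)
    linarith
  · have h4 : (sat n 𝓕 : ℝ) ≤ (1 - 1 / (r : ℝ)) * n + (5 * r ^ 2 + r : ℕ) :=
      sat_specialLengths_le hr hn h
    linarith

end Final

theorem theorem2 :
    (∀ 𝓕 : Set FinGraph, IsAdmissible 𝓕 → IsQuasiFinite 𝓕 →
      ∃ (S : (r : ℕ) → Set (ZMod r)) (k : (r : ℕ) → ZMod r → ℤ),
        (∀ r : ℕ, 1 ≤ r → ∀ C ∈ S r, ∃ N : ℕ, ∀ n : ℕ, N ≤ n → (n : ZMod r) = C →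
          n ∈ avoidsBelow S r →
            (sat n 𝓕 : ℝ) = (((r : ℝ) - 1) * (n : ℝ) + (k r C : ℝ)) / (r : ℝ)) ∧
        SatAtLeastLinear 𝓕 (uncovered S) ∧
        NoneOrAllSmall S) ∧
    (∀ S : (r : ℕ) → Set (ZMod r), NoneOrAllSmall S →
      ∃ 𝓕 : Set FinGraph, IsAdmissible 𝓕 ∧ IsQuasiFinite 𝓕 ∧
        (∀ r : ℕ, 1 ≤ r → ∃ B : ℝ, ∀ n ∈ firstCovered S r,
          |(sat n 𝓕 : ℝ) - (1 - 1 / (r : ℝ)) * (n : ℝ)| ≤ B) ∧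
        SatAtLeastLinear 𝓕 (uncovered S) ∧
        ({r : ℕ | 1 ≤ r ∧ (firstCovered S r).Nonempty}.Finite → 𝓕.Finite)) := by
  refine ⟨fun 𝓕 h𝓕 hq => exists_satClasses h𝓕 hq, fun S hS => ?_⟩
  exact ⟨clashFamily (specialLengths S) lengthOrder,
    isAdmissible_clashFamily (isGauge_specialLengths S), isQuasiFinite_clashFamily _ _,
    fun r hr => exists_bound_specialLengths hS hr, satAtLeastLinear_specialLengths hS,
    fun hR => finite_clashFamily (finite_specialLengths hR) _⟩
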